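/- Let $I\subseteq\mathbb R$ be a time interval and let $v$ be a classical space-periodic incompressible Euler flow on $I$: $v:I\times\mathbb R^3\to\mathbb R^3$ is jointly $C^1$, $2\pi$-periodic in each space coordinate, $\nabla\cdot v=0$, and $\partial_t v+(v\cdot\nabla)v=-\nabla p$ for some pressure $p$ that is $C^1$ and $2\pi$-periodic in space (time derivatives at end points of $I$ are one-sided). Let $\omega=\nabla\times v$ be the vorticity. A trajectory of $v$ on $I$ is a curve $x$ with $\dot x(t)=v(t,x(t))$ for $t\in I$. A field is called Hölder continuous if it is of class $C^{0,\widetilde\gamma}$ for some $\widetilde\gamma>0$. A curve is real-analytic on an interval if at each point of the interval it is given near that point, within the interval, by a convergent power series. Then: 1. (Restart.) If $\omega(t_0)$ is Hölder continuous at some $t_0\in I$, then there are $\tau>0$, an Euler flow $u$ (in the above sense) on $(t_0-\tau,t_0+\tau)$ with Hölder continuous vorticity at every time of that interval, which coincides with $v$ at all times in $I\cap(t_0-\tau,t_0+\tau)$, and vector fields $\xi^{(s)}$, $s\ge1$, on $\mathbb R^3$ such that for every $a\in\mathbb R^3$ the trajectory $X(\cdot,a)$ of $u$ with $X(t_0,a)=a$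 exists on $(t_0-\tau,t_0+\tau)$ and is given there by the convergent Taylor expansion $X(t,a)=a+\sum_{s\ge1}\xi^{(s)}(a)(t-t_0)^s$; $\tau$ does not depend on $a$. 2. (Continuation.) If $\omega(t_0)$ is Hölder continuous at some $t_0\in I$, then there are $t_*\in(t_0,+\infty]$ and an Euler flow $u$ on $[t_0,t_*)$ that coincides with $v$ at all times in $I\cap[t_0,t_*)$, whose vorticity is Hölder continuous at each time in $[t_0,t_*)$, and such that from every point $a$ starts, at time $t_0$, a trajectory of $u$ which exists and is real-analytic on $[t_0,t_*)$. If $t_*<\infty$, then $u$ does not extend to an Euler flow on $[t_0,t_*]$ with Hölder continuous vorticity at time $t_*$. 3. (Analyticity.) If $\omega(t)$ is Hölder continuous for each $t\in I$ (with an exponent that may depend on $t$), then every trajectory of $v$ on $I$ is a real-analytic function of time on $I$. 4. (Equivalent condition.) For every $t\in I$ and $0<\gamma<1$, $\omega(t)\in C^{0,\gamma}$ if and only if $v(t)\in C^{1,\gamma}$. Consequently, if for each $t\in I$ the velocity $v(t)$ is of class $C^{1,\gamma}$ for some $0<\gamma<1$ (which may depend on $t$), then every trajectory of $v$ on $I$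 is a real-analytic function of time on $I$. -/

import Mathlib

open scoped NNReal

namespace PeriodicEuler

/-- Three-dimensional Euclidean space. Functions on the torus of side `2π` are functions on this
space that are `2π`-periodic in each coordinate. -/
abbrev E3 : Type := EuclideanSpace ℝ (Fin 3)

/-- The `i`-th vector of the standard basis. -/
noncomputable def e (i : Fin 3) : E3 := EuclideanSpace.single i 1

/-- `f` is `2π`-periodic in each of the three coordinates. -/
def SpacePeriodic {F : Type} (f : E3 → F) : Prop :=
  ∀ (i : Fin 3) (x : E3), f (x + (2 * Real.pi) • e i) = f x

/-- `partialDeriv i j f x` is the partial derivative of the component `f_j` with respect to the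
`i`-th coordinate, at `x`. -/
noncomputable def partialDeriv (i j : Fin 3) (f : E3 → E3) (x : E3) : ℝ :=
  fderiv ℝ f x (e i) j

/-- The divergence of a vector field. -/
noncomputable def divergence (f : E3 → E3) (x : E3) : ℝ :=
  ∑ i : Fin 3, partialDeriv i i f x

/-- The curl of a vector field; the curl of the velocity is the vorticity. -/
noncomputable def curl (f : E3 → E3) (x : E3) : E3 :=
  !₂[partialDeriv 1 2 f x - partialDeriv 2 1 f x,
     partialDeriv 2 0 f x - partialDeriv 0 2 f x,
     partialDeriv 0 1 f x - partialDeriv 1 0 f x]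

/-- `f` is Hölder continuous (of class `C^{0,γ}`) with some exponent `γ > 0`. For a continuous
periodic function the supremum norm is finite anyway. -/
def IsHolder (f : E3 → E3) : Prop :=
  ∃ γ : ℝ≥0, 0 < γ ∧ MemHolder γ f

/-- `f` is of class `C^{1,γ}`: continuously differentiable with a `γ`-Hölder derivative. -/
def IsC1Holder (γ : ℝ≥0) (f : E3 → E3) : Prop :=
  ContDiff ℝ 1 f ∧ MemHolder γ (fun x => fderiv ℝ f x)

/-- `v` is the velocity of a classical space-periodic incompressible Euler flow on the time
interval `I`: it is jointly `C^1` on `I × ℝ³`, `2π`-periodic in space, divergence free, and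
`∂ₜ v + (v · ∇) v = -∇ p`, `t ∈ I`, for some periodic pressure `p`. The time derivative at an end
point of `I` that belongs to `I` is one-sided. -/
structure IsEulerFlow (I : Set ℝ) (v : ℝ → E3 → E3) : Prop where
  contDiffOn : ContDiffOn ℝ 1 (fun z : ℝ × E3 => v z.1 z.2) (I ×ˢ Set.univ)
  periodic : ∀ t ∈ I, SpacePeriodic (v t)
  div_free : ∀ t ∈ I, ∀ x, divergence (v t) x = 0
  momentum : ∃ p : ℝ → E3 → ℝ, ∀ t ∈ I, ContDiff ℝ 1 (p t) ∧ SpacePeriodic (p t) ∧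
    ∀ x, HasDerivWithinAt (fun s => v s x)
      (-(fderiv ℝ (v t) x (v t x)) - gradient (p t) x) I t

/-- `x` is the trajectory of a fluid particle moving with the velocity `v` during the time
interval `I`: `x'(t) = v(t, x(t))` for `t ∈ I`. -/
def IsTrajectory (I : Set ℝ) (v : ℝ → E3 → E3) (x : ℝ → E3) : Prop :=
  ∀ t ∈ I, HasDerivWithinAt x (v t (x t)) I t

/-- The time interval `[t₀, T)`, where `T` may be `+∞`. -/
def timeInterval (t₀ : ℝ) (T : EReal) : Set ℝ :=
  {t : ℝ | t₀ ≤ t ∧ (t : EReal) < T}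

end PeriodicEuler

/-!
Along an Euler flow `v` with flow map `X` started at time `t₀`, the equations take Cauchy's
Lagrangian form `(∇X)ᵀ ∂ₜ²X = ∇q`, `det ∇X = 1`. Inserting a power series
`X = a + ∑ ξ⁽ˢ⁾(a) (t - t₀)ˢ` turns them into a recursion: the curl of `ξ⁽ˢ⁾` and its divergence are
sums of products of derivatives of earlier coefficients. The curl of the unknown and its divergence
determine a periodic field up to its mean, with a gain of one derivative in Hölder spaces, so if
`ξ⁽¹⁾ = v(t₀)` is of class `C^{1,γ}` the recursion never loses derivatives. The series converges in
`C^{1,γ}` for `|t - t₀| < τ`, uniformly in `a`. This is analyticity in time at limited smoothness in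
space.

**Elliptic estimates.** The first-order potential `pot i g` is an integral
over all scales `s` of the averages of `g` against a derivative of a bump of width `s`, and `rz i j g`
is its derivative. Mean-zero kernels gain `s ^ γ` at small scales; periodicity gives decay at large
scales. Hence `holder_rz` bounds the second-order potentials on `C^{0,γ}`, and
`exists_sum_rz` (the scale integral of a scale derivative) says that their trace returns `g` up to its
mean. No Fourier series and no Newton potential are needed. The conclusions are the Helmholtz
decomposition `exists_helmholtz` and, for divergence-free fields, the equivalence
`memHolder_curl_iff` of `C^{0,γ}` vorticity and `C^{1,γ}` velocity.

**Null forms.** The coefficients are only `C¹`, so the curl of `(∇ξ)ᵀ ζ` and the divergence form of the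
minors and of the determinant of `∇ξ` are understood weakly, tested against rescaled kernels
(`weakCurl_mul_pd`, `weakDiv_minor`, `weakDiv_jac`). In each of them second derivatives cancel, so that
the right-hand sides are in `C^{0,γ}`.

**Convergence.** The majorant `A lˢ / s²` is stable under convolution, and the right-hand sides are at
least quadratic; a small `A` closes the induction for every rate `l` (`exists_coeff`), and `l` is chosen
so large that the initial velocity obeys the bound (`exists_taylor`). The sum of the series is a flow
map (`flowMap_of_taylor`): the coefficient identities become Cauchy's equations by Cauchy products.
Its gradient is close to the identity, so it is invertible, and the velocity read off in Eulerian
coordinates is an Euler flow (`exists_isEulerFlow`) with Hölder continuous vorticity. This is the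
local existence theorem `exists_local_flow`.

**Conclusion.** The energy of the difference of two flows satisfies a linear differential inequality,
so a flow is determined by its values at one time, forwards and backwards (`IsEulerFlow.eq_of_eq`).
Therefore the local flow coincides with `v`, whose trajectories, being unique, are given by the
series (`IsEulerFlow.analyticOn`). The maximal flow is the union of all continuations to compact time
intervals with Hölder continuous vorticity. Were it to extend to its final time with such a
vorticity, the local flow started there would continue it further (`exists_maximal`).
-/

namespace PeriodicEuler

open MeasureTheory Set Filter Topology
open scoped ContDiff

/-! ### Smooth averages over rescaled kernels -/

/-- The `i`-th partial derivative of a scalar function. -/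
noncomputable def pd (i : Fin 3) (f : E3 → ℝ) (x : E3) : ℝ := fderiv ℝ f x (e i)

/-- A smooth compactly supported function, used as a convolution kernel. -/
structure IsKernel (k : E3 → ℝ) : Prop where
  contDiff : ContDiff ℝ ∞ k
  compact : HasCompactSupport k

/-- The average of `g` around `x` at scale `s` with weight `k`, that is, the convolution of `g`
with `s⁻³ k(·/s)`. At scale `0` it is `g x * ∫ k`. -/
noncomputable def avg (k g : E3 → ℝ) (s : ℝ) (x : E3) : ℝ := ∫ y, k y * g (x - s • y)

/-- The generator of dilations acting on kernels: `div (y k(y)) = 3 k(y) + y · ∇k(y)`. -/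
noncomputable def dil (k : E3 → ℝ) (y : E3) : ℝ := 3 * k y + fderiv ℝ k y y

/-- The covector with given components. -/
noncomputable def covec (a : Fin 3 → ℝ) : E3 →L[ℝ] ℝ :=
  ∑ i, a i • (EuclideanSpace.proj i : E3 →L[ℝ] ℝ)

lemma covec_apply (a : Fin 3 → ℝ) (v : E3) : covec a v = ∑ i, a i * v i := by
  simp [covec]

lemma covec_e (a : Fin 3 → ℝ) (i : Fin 3) : covec a (e i) = a i := by
  simp [covec_apply, e]

lemma sum_smul_e (v : E3) : v = ∑ i, v i • e i := by
  ext j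
  simp [e, Fin.sum_univ_three]
  fin_cases j <;> simp

lemma clm_eq_covec (L : E3 →L[ℝ] ℝ) : L = covec (fun i => L (e i)) := by
  ext v
  conv_lhs => rw [sum_smul_e v]
  simp [covec_apply, map_sum, mul_comm]

lemma norm_covec_le (a : Fin 3 → ℝ) : ‖covec a‖ ≤ ∑ i, |a i| := by
  refine ContinuousLinearMap.opNorm_le_bound _ (Finset.sum_nonneg fun i _ => abs_nonneg _) ?_
  intro v
  rw [covec_apply, Finset.sum_mul]
  refine (norm_sum_le _ _).trans (Finset.sum_le_sum fun i _ => ?_)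
  rw [norm_mul, Real.norm_eq_abs]
  exact mul_le_mul_of_nonneg_left (PiLp.norm_apply_le v i) (abs_nonneg _)

lemma norm_e (i : Fin 3) : ‖e i‖ = 1 := by simp [e]

lemma continuous_pd {f : E3 → ℝ} (hf : ContDiff ℝ 1 f) (i : Fin 3) : Continuous (pd i f) :=
  (hf.continuous_fderiv one_ne_zero).clm_apply continuous_const

namespace IsKernel

variable {k : E3 → ℝ}

lemma pd (hk : IsKernel k) (i : Fin 3) : IsKernel (pd i k) where
  contDiff := (hk.contDiff.fderiv_right (m := ∞) (by simp)).clm_apply contDiff_const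
  compact := hk.compact.fderiv_apply (𝕜 := ℝ) (e i)

lemma dil (hk : IsKernel k) : IsKernel (dil k) where
  contDiff := (contDiff_const.mul hk.contDiff).add
    ((hk.contDiff.fderiv_right (m := ∞) (by simp)).clm_apply contDiff_id)
  compact := by
    refine HasCompactSupport.add (hk.compact.mul_left (f := fun _ => (3 : ℝ))) ?_
    refine (hk.compact.fderiv (𝕜 := ℝ)).mono' ?_
    refine (Function.support_subset_iff'.2 fun y hy => ?_)
    rw [image_eq_zero_of_notMem_tsupport hy]
    rfl

lemma contDiff_one (hk : IsKernel k) : ContDiff ℝ 1 k := hk.contDiff.of_le (by simp)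

lemma continuous (hk : IsKernel k) : Continuous k := hk.contDiff.continuous

lemma integrable_mul (hk : IsKernel k) {h : E3 → ℝ} (hh : Continuous h) :
    Integrable (fun y => k y * h y) :=
  (hk.continuous.mul hh).integrable_of_hasCompactSupport hk.compact.mul_right

lemma integrable_abs_mul (hk : IsKernel k) {h : E3 → ℝ} (hh : Continuous h) :
    Integrable (fun y => |k y| * h y) :=
  (hk.continuous.abs.mul hh).integrable_of_hasCompactSupport
    (hk.compact.comp_left (g := fun t => |t|) abs_zero).mul_right

lemma integrable (hk : IsKernel k) : Integrable k :=
  hk.continuous.integrable_of_hasCompactSupport hk.compact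

end IsKernel

lemma integrable_avg {k g : E3 → ℝ} (hk : IsKernel k) (hg : Continuous g) (s : ℝ) (x : E3) :
    Integrable (fun y => k y * g (x - s • y)) :=
  hk.integrable_mul (by fun_prop)

lemma continuous_avg {k g : E3 → ℝ} (hk : IsKernel k) (hg : Continuous g) :
    Continuous (fun p : ℝ × E3 => avg k g p.1 p.2) := by
  have h := continuous_parametric_integral_of_continuous (μ := (volume : Measure E3))
    (f := fun (p : ℝ × E3) (y : E3) => k y * g (p.2 - p.1 • y))
    (by have := hk.continuous; simp only [Function.uncurry_def]; fun_prop) hk.compact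
  convert h using 2 with p
  rw [avg]
  refine (setIntegral_eq_integral_of_forall_compl_eq_zero fun y hy => ?_).symm
  rw [image_eq_zero_of_notMem_tsupport hy, zero_mul]

lemma avg_add {k f g : E3 → ℝ} (hk : IsKernel k) (hf : Continuous f) (hg : Continuous g)
    (s : ℝ) (x : E3) : avg k (fun y => f y + g y) s x = avg k f s x + avg k g s x := by
  simp only [avg, mul_add]
  exact integral_add (integrable_avg hk hf s x) (integrable_avg hk hg s x)

lemma avg_const_mul (k g : E3 → ℝ) (c s : ℝ) (x : E3) :
    avg k (fun y => c * g y) s x = c * avg k g s x := by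
  simp only [avg, ← integral_const_mul]
  congr 1 with y; ring

lemma avg_sum {ι : Type*} {k : E3 → ℝ} (hk : IsKernel k) (t : Finset ι) {f : ι → E3 → ℝ}
    (hf : ∀ i ∈ t, Continuous (f i)) (s : ℝ) (x : E3) :
    avg k (fun y => ∑ i ∈ t, f i y) s x = ∑ i ∈ t, avg k (f i) s x := by
  simp only [avg, Finset.mul_sum]
  exact integral_finsetSum _ fun i hi => integrable_avg hk (hf i hi) s x

lemma avg_neg_left (k g : E3 → ℝ) (s : ℝ) (x : E3) :
    avg (fun y => - k y) g s x = - avg k g s x := by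
  simp only [avg, neg_mul, integral_neg]

lemma avg_sum_left {ι : Type*} (t : Finset ι) {k : ι → E3 → ℝ} (hk : ∀ i ∈ t, IsKernel (k i))
    {g : E3 → ℝ} (hg : Continuous g) (s : ℝ) (x : E3) :
    avg (fun y => ∑ i ∈ t, k i y) g s x = ∑ i ∈ t, avg (k i) g s x := by
  simp only [avg, Finset.sum_mul]
  exact integral_finsetSum _ fun i hi => integrable_avg (hk i hi) hg s x

lemma avg_const (k : E3 → ℝ) (c s : ℝ) (x : E3) : avg k (fun _ => c) s x = (∫ y, k y) * c := by
  simp only [avg, integral_mul_const]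

lemma avg_zero (k g : E3 → ℝ) (x : E3) : avg k g 0 x = (∫ y, k y) * g x := by
  simp only [avg, zero_smul, sub_zero, integral_mul_const]

/-- The first absolute moment of a kernel, with weight `1 + ‖y‖`. -/
noncomputable def moment (k : E3 → ℝ) : ℝ := ∫ y, |k y| * (1 + ‖y‖)

lemma moment_nonneg (k : E3 → ℝ) : 0 ≤ moment k :=
  integral_nonneg fun y => by positivity

lemma abs_avg_le {k g : E3 → ℝ} (hk : IsKernel k) {M : ℝ} (hg : ∀ x, |g x| ≤ M) (s : ℝ)
    (x : E3) : |avg k g s x| ≤ moment k * M := by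
  have hM : 0 ≤ M := (abs_nonneg _).trans (hg 0)
  rw [moment, ← integral_mul_const, ← Real.norm_eq_abs]
  refine norm_integral_le_of_norm_le
    ((hk.integrable_abs_mul (h := fun y => 1 + ‖y‖) (by fun_prop)).mul_const M) ?_
  refine Eventually.of_forall fun y => ?_
  rw [norm_mul, Real.norm_eq_abs, Real.norm_eq_abs]
  refine mul_le_mul ?_ (hg _) (abs_nonneg _) (by positivity)
  nlinarith [abs_nonneg (k y), norm_nonneg y]

lemma avg_periodic {g : E3 → ℝ} (hg : SpacePeriodic g) (k : E3 → ℝ) (s : ℝ) :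
    SpacePeriodic (avg k g s) := by
  intro i x
  simp only [avg]
  congr 1 with y
  rw [add_sub_right_comm, hg i]

/-- A bound `M` for the `C^{0,γ}` norm of `g`: it bounds both the supremum of `|g|` and the
`γ`-Hölder seminorm. -/
structure HB (γ M : ℝ) (g : E3 → ℝ) : Prop where
  bound : ∀ x, |g x| ≤ M
  holder : ∀ x y, |g x - g y| ≤ M * ‖x - y‖ ^ γ

lemma HB.nonneg {γ M : ℝ} {g : E3 → ℝ} (h : HB γ M g) : 0 ≤ M := (abs_nonneg _).trans (h.bound 0)

lemma HB.continuous {γ M : ℝ} {g : E3 → ℝ} (hγ : 0 < γ) (h : HB γ M g) : Continuous g := by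
  rw [continuous_iff_continuousAt]
  intro x
  have h0 : Tendsto (fun y => M * ‖y - x‖ ^ γ) (𝓝 x) (𝓝 0) := by
    have : Continuous fun y : E3 => M * ‖y - x‖ ^ γ :=
      continuous_const.mul ((by fun_prop : Continuous fun y : E3 => ‖y - x‖).rpow_const
        fun _ => Or.inr hγ.le)
    simpa [hγ.ne'] using this.tendsto x
  refine tendsto_iff_norm_sub_tendsto_zero.2 ?_
  exact squeeze_zero (fun _ => norm_nonneg _) (fun y => h.holder y x) h0

lemma rpow_le_one_add {r γ : ℝ} (hr : 0 ≤ r) (hγ : 0 < γ) (hγ1 : γ ≤ 1) : r ^ γ ≤ 1 + r := by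
  rcases le_total r 1 with h | h
  · exact (Real.rpow_le_one hr h hγ.le).trans (by linarith)
  · calc r ^ γ ≤ r ^ (1 : ℝ) := Real.rpow_le_rpow_of_exponent_le h hγ1
      _ ≤ 1 + r := by rw [Real.rpow_one]; linarith

/-- A kernel with vanishing integral gains the factor `s ^ γ` on `γ`-Hölder functions. -/
lemma abs_avg_le_rpow {k g : E3 → ℝ} (hk : IsKernel k) (hk0 : ∫ y, k y = 0) {γ M : ℝ}
    (hγ : 0 < γ) (hγ1 : γ ≤ 1) (hg : HB γ M g) {s : ℝ} (hs : 0 ≤ s) (x : E3) :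
    |avg k g s x| ≤ moment k * M * s ^ γ := by
  have hM := hg.nonneg
  have hgc := hg.continuous hγ
  have h1 : avg k g s x = ∫ y, k y * (g (x - s • y) - g x) := by
    simp only [mul_sub]
    rw [integral_sub (integrable_avg hk hgc s x) (hk.integrable.mul_const _), integral_mul_const,
      hk0, zero_mul, sub_zero]
    rfl
  rw [h1, moment, ← integral_mul_const, ← integral_mul_const, ← Real.norm_eq_abs]
  refine norm_integral_le_of_norm_le
    (((hk.integrable_abs_mul (h := fun y => 1 + ‖y‖) (by fun_prop)).mul_const M).mul_const _) ?_
  refine Eventually.of_forall fun y => ?_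
  rw [norm_mul, Real.norm_eq_abs, Real.norm_eq_abs, mul_assoc, mul_assoc]
  refine mul_le_mul_of_nonneg_left ?_ (abs_nonneg _)
  refine (hg.holder _ _).trans ?_
  have h2 : ‖x - s • y - x‖ ^ γ = ‖y‖ ^ γ * s ^ γ := by
    rw [show x - s • y - x = -(s • y) by abel, norm_neg, norm_smul, Real.norm_of_nonneg hs,
      Real.mul_rpow hs (norm_nonneg _), mul_comm]
  rw [h2]
  calc M * (‖y‖ ^ γ * s ^ γ) = ‖y‖ ^ γ * (M * s ^ γ) := by ring
    _ ≤ (1 + ‖y‖) * (M * s ^ γ) :=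
      mul_le_mul_of_nonneg_right (rpow_le_one_add (norm_nonneg _) hγ hγ1) (by positivity)

/-- Averages of differentiated kernels: the derivative may be moved to a `C¹` function. -/
lemma avg_pd_left {k g : E3 → ℝ} (hk : IsKernel k) (hg : ContDiff ℝ 1 g) (i : Fin 3) (s : ℝ)
    (x : E3) : avg (pd i k) g s x = s * avg k (pd i g) s x := by
  have hd : ∀ y, HasFDerivAt (fun y => g (x - s • y))
      ((fderiv ℝ g (x - s • y)).comp (-(s • ContinuousLinearMap.id ℝ E3))) y := by
    intro y
    have h1 : HasFDerivAt (fun y : E3 => x - s • y) (-(s • ContinuousLinearMap.id ℝ E3)) y :=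
      ((hasFDerivAt_id y).const_smul s).const_sub x
    exact ((hg.differentiable one_ne_zero _).hasFDerivAt).comp y h1
  have hd' : ∀ y, fderiv ℝ (fun y => g (x - s • y)) y (e i) = -(s * pd i g (x - s • y)) := by
    intro y
    rw [(hd y).fderiv]
    simp [pd]
  have hc : Continuous (pd i g) := continuous_pd hg i
  have hgc := hg.continuous
  have := integral_mul_fderiv_eq_neg_fderiv_mul_of_integrable (μ := (volume : Measure E3))
    (f := k) (g := fun y => g (x - s • y)) (v := e i)
    ((hk.pd i).integrable_mul (by fun_prop))
    (by simp only [hd']; exact hk.integrable_mul (by fun_prop))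
    (hk.integrable_mul (by fun_prop))
    (fun y _ => (hk.contDiff_one.differentiable one_ne_zero) y)
    (fun y _ => (hd y).differentiableAt)
  simp only [hd'] at this
  have h2 : avg (pd i k) g s x = ∫ y, fderiv ℝ k y (e i) * g (x - s • y) := rfl
  rw [h2, ← neg_eq_iff_eq_neg.2 this, ← integral_neg]
  simp only [avg, ← integral_const_mul]
  congr 1 with y; ring

/-- The kernel `s⁻³ k(·/s)`. -/
noncomputable def scaled (k : E3 → ℝ) (s : ℝ) (y : E3) : ℝ := s⁻¹ ^ 3 * k (s⁻¹ • y)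

lemma avg_eq_integral (k g : E3 → ℝ) {s : ℝ} (hs : 0 < s) (x : E3) :
    avg k g s x = ∫ z, g z * scaled k s (x - z) := by
  have h1 : ∫ z, g z * scaled k s (x - z) = ∫ z, g (x - z) * scaled k s z := by
    rw [← integral_sub_left_eq_self (fun z => g z * scaled k s (x - z)) volume x]
    simp
  have h2 := Measure.integral_comp_smul_of_nonneg (volume : Measure E3)
    (fun z => g (x - z) * scaled k s z) s (hR := hs.le)
  rw [h1]
  have h3 : Module.finrank ℝ E3 = 3 := by simp
  rw [h3, smul_eq_mul] at h2
  have h4 : ∫ z, g (x - z) * scaled k s z = s ^ 3 * ∫ y, g (x - s • y) * scaled k s (s • y) := by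
    rw [h2]; field_simp
  rw [h4, ← integral_const_mul, avg]
  congr 1 with y
  rw [scaled, smul_smul, inv_mul_cancel₀ hs.ne', one_smul]
  field_simp

lemma hasFDerivAt_scaled {k : E3 → ℝ} (hk : IsKernel k) {s : ℝ} (hs : 0 < s) (y : E3) :
    HasFDerivAt (fun q : ℝ × E3 => scaled k q.1 q.2)
      ((-(s⁻¹ * scaled (dil k) s y)) • ContinuousLinearMap.fst ℝ ℝ E3 +
        (s⁻¹ • covec (fun i => scaled (pd i k) s y)).comp (ContinuousLinearMap.snd ℝ ℝ E3))
      (s, y) := by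
  have h1 : HasFDerivAt (fun q : ℝ × E3 => q.1⁻¹)
      ((-(s ^ 2)⁻¹) • ContinuousLinearMap.fst ℝ ℝ E3) (s, y) :=
    (hasDerivAt_inv hs.ne').comp_hasFDerivAt (s, y) hasFDerivAt_fst
  have h2 := h1.smul (hasFDerivAt_snd (𝕜 := ℝ) (p := (s, y)))
  have h3 := ((hk.contDiff_one.differentiable one_ne_zero) (s⁻¹ • y)).hasFDerivAt.comp (s, y) h2
  have h4 := (h1.pow 3).mul h3
  refine h4.congr_fderiv ?_
  ext v
  · simp [scaled, dil]
    field_simp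
    ring
  · have h5 := clm_eq_covec (fderiv ℝ k (s⁻¹ • y))
    have h6 : fderiv ℝ k (s⁻¹ • y) v = ∑ i, fderiv ℝ k (s⁻¹ • y) (e i) * v i := by
      conv_lhs => rw [h5]
      rw [covec_apply]
    simp [scaled, covec_apply, pd, h6, Fin.sum_univ_three]
    ring

lemma IsKernel.exists_radius {k : E3 → ℝ} (hk : IsKernel k) :
    ∃ R : ℝ, 0 < R ∧ ∀ y, R < ‖y‖ → k y = 0 := by
  obtain ⟨R, hR⟩ := hk.compact.isCompact.isBounded.subset_closedBall 0
  refine ⟨max R 1, by positivity, fun y hy => image_eq_zero_of_notMem_tsupport fun h => ?_⟩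
  have := hR h
  rw [mem_closedBall_zero_iff] at this
  exact absurd (le_max_left R 1) (by linarith)

lemma IsKernel.exists_radius_scaled {k : E3 → ℝ} (hk : IsKernel k) (b : ℝ) :
    ∃ R : ℝ, ∀ s, 0 < s → s ≤ b → ∀ y, y ∉ Metric.closedBall (0 : E3) R → scaled k s y = 0 := by
  obtain ⟨R, hR0, hR⟩ := hk.exists_radius
  refine ⟨b * R, fun s hs hsb y hy => ?_⟩
  rw [mem_closedBall_zero_iff, not_le] at hy
  rw [scaled, hR, mul_zero]
  rw [norm_smul, norm_inv, Real.norm_of_nonneg hs.le, lt_inv_mul_iff₀ hs]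
  nlinarith

lemma contDiffOn_scaled {k : E3 → ℝ} (hk : IsKernel k) {a : ℝ} (ha : 0 < a) (b : ℝ) :
    ContDiffOn ℝ 1 (fun q : ℝ × E3 => scaled k q.1 q.2) (Ioo a b ×ˢ univ) := by
  have h1 : ContDiffOn ℝ 1 (fun q : ℝ × E3 => q.1⁻¹) (Ioo a b ×ˢ univ) :=
    contDiffOn_fst.inv fun q hq => (ha.trans hq.1.1).ne'
  exact (h1.pow 3).mul (hk.contDiff_one.comp_contDiffOn (h1.smul contDiffOn_snd))

lemma continuous_scaled {k : E3 → ℝ} (hk : IsKernel k) (s : ℝ) : Continuous (scaled k s) := by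
  have := hk.continuous
  unfold scaled
  fun_prop

/-- Averages are jointly differentiable in the scale and the point, even if `g` is only continuous:
both derivatives fall on the kernel. -/
lemma hasFDerivAt_avg {k g : E3 → ℝ} (hk : IsKernel k) (hg : Continuous g) {s : ℝ} (hs : 0 < s)
    (x : E3) :
    HasFDerivAt (fun q : ℝ × E3 => avg k g q.1 q.2)
      ((-(s⁻¹ * avg (dil k) g s x)) • ContinuousLinearMap.fst ℝ ℝ E3 +
        (s⁻¹ • covec (fun i => avg (pd i k) g s x)).comp (ContinuousLinearMap.snd ℝ ℝ E3))
      (s, x) := by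
  obtain ⟨R, hR⟩ := hk.exists_radius_scaled (2 * s)
  have hs1 : s ∈ Ioo (s / 2) (2 * s) := ⟨by linarith, by linarith⟩
  have hmain := hasFDerivAt_convolution_right_with_param (μ := (volume : Measure E3))
    (ContinuousLinearMap.mul ℝ ℝ) (f := g) (g := scaled k) (s := Ioo (s / 2) (2 * s))
    isOpen_Ioo (isCompact_closedBall (0 : E3) R)
    (fun p y hp hy => hR p (by linarith [hp.1]) hp.2.le y hy) hg.locallyIntegrable
    (contDiffOn_scaled hk (by positivity) _) (s, x) hs1
  have hD : (fun y : E3 => fderiv ℝ ↿(scaled k) (s, y)) = fun y =>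
      (-(s⁻¹ * scaled (dil k) s y)) • ContinuousLinearMap.fst ℝ ℝ E3 +
        (s⁻¹ • covec (fun i => scaled (pd i k) s y)).comp (ContinuousLinearMap.snd ℝ ℝ E3) :=
    funext fun y => (hasFDerivAt_scaled hk hs y).fderiv
  have hDc : HasCompactSupport fun y : E3 => fderiv ℝ ↿(scaled k) (s, y) := by
    obtain ⟨R0, h0⟩ := hk.dil.exists_radius_scaled s
    choose R1 h1 using fun i => (hk.pd i).exists_radius_scaled s
    refine HasCompactSupport.intro (isCompact_closedBall (0 : E3) (max R0 (max (R1 0)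
      (max (R1 1) (R1 2))))) fun y hy => ?_
    rw [mem_closedBall_zero_iff, not_le] at hy
    simp only [max_lt_iff] at hy
    rw [congrFun hD y, h0 s hs le_rfl y (by simpa using hy.1)]
    have h2 : ∀ i, scaled (pd i k) s y = 0 := by
      intro i
      refine h1 i s hs le_rfl y ?_
      fin_cases i <;> simp [hy]
    simp [h2, covec]
  have hDcont : Continuous fun y : E3 => fderiv ℝ ↿(scaled k) (s, y) := by
    rw [hD]
    have h0 := continuous_scaled hk.dil s
    have h1 := fun i => continuous_scaled (hk.pd i) s
    unfold covec
    fun_prop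
  have hint : ∀ k' : E3 → ℝ, IsKernel k' → Integrable fun z => g z * scaled k' s (x - z) := by
    intro k' hk'
    have h3 := continuous_scaled hk' s
    refine Continuous.integrable_of_hasCompactSupport (by fun_prop) ?_
    obtain ⟨R0, h0⟩ := hk'.exists_radius_scaled s
    refine HasCompactSupport.intro (isCompact_closedBall x R0) fun z hz => ?_
    rw [h0 s hs le_rfl, mul_zero]
    rwa [mem_closedBall_zero_iff, ← dist_eq_norm, dist_comm]
  refine (hmain.congr_fderiv ?_).congr_of_eventuallyEq ?_
  · ext v
    · simp only [ContinuousLinearMap.coe_comp, Function.comp, ContinuousLinearMap.inl_apply]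
      rw [convolution_precompR_apply _ hg.locallyIntegrable hDc hDcont, convolution_def]
      simp only [congrFun hD]
      simp only [avg_eq_integral _ _ hs]
      simp [covec_apply, ← integral_const_mul, ← integral_neg]
      congr 1 with z; ring
    · simp only [ContinuousLinearMap.coe_comp, Function.comp, ContinuousLinearMap.inr_apply]
      rw [convolution_precompR_apply _ hg.locallyIntegrable hDc hDcont, convolution_def]
      simp only [congrFun hD]
      simp only [avg_eq_integral _ _ hs]
      simp [covec_apply, ← integral_const_mul, ← integral_mul_const]
      rw [← integral_finsetSum _ fun i _ => by
        exact (((hint _ (hk.pd i)).mul_const _))]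
      rw [← integral_const_mul]
      congr 1 with z
      simp only [Finset.mul_sum]
      refine Finset.sum_congr rfl fun i _ => ?_
      ring
  · have : ∀ᶠ q : ℝ × E3 in 𝓝 (s, x), 0 < q.1 :=
      continuous_fst.continuousAt.eventually (lt_mem_nhds hs)
    filter_upwards [this] with q hq
    rw [avg_eq_integral _ _ hq]
    rfl

lemma hasFDerivAt_avg_right {k g : E3 → ℝ} (hk : IsKernel k) (hg : Continuous g) {s : ℝ}
    (hs : 0 < s) (x : E3) :
    HasFDerivAt (avg k g s) (s⁻¹ • covec (fun i => avg (pd i k) g s x)) x := by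
  have h1 : HasFDerivAt (fun x : E3 => (s, x)) (ContinuousLinearMap.inr ℝ ℝ E3) x :=
    hasFDerivAt_prodMk_right s x
  refine ((hasFDerivAt_avg hk hg hs x).comp x h1).congr_fderiv ?_
  ext v
  simp

lemma hasDerivAt_avg_scale {k g : E3 → ℝ} (hk : IsKernel k) (hg : Continuous g) {s : ℝ}
    (hs : 0 < s) (x : E3) :
    HasDerivAt (fun s => avg k g s x) (-(s⁻¹ * avg (dil k) g s x)) s := by
  have h1 : HasDerivAt (fun s : ℝ => (s, x)) ((1 : ℝ), (0 : E3)) s :=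
    (hasDerivAt_id s).prodMk (hasDerivAt_const s x)
  have := (hasFDerivAt_avg hk hg hs x).comp_hasDerivAt s h1
  simpa [Function.comp_def] using this

lemma hasDerivAt_avg_line {k g : E3 → ℝ} (hk : IsKernel k) (hg : Continuous g) {s : ℝ}
    (hs : 0 < s) (x : E3) (i : Fin 3) (r : ℝ) :
    HasDerivAt (fun r : ℝ => avg k g s (x + r • e i))
      (s⁻¹ * avg (pd i k) g s (x + r • e i)) r := by
  have h1 : HasDerivAt (fun r : ℝ => x + r • e i) (e i) r := by
    simpa using ((hasDerivAt_id r).smul_const (e i)).const_add x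
  have := (hasFDerivAt_avg_right hk hg hs (x + r • e i)).comp_hasDerivAt r h1
  simpa [covec_e, Function.comp_def] using this

/-- Differentiated kernels have vanishing integral, and so gain a Hölder factor. -/
lemma integral_pd_eq_zero {k : E3 → ℝ} (hk : IsKernel k) (i : Fin 3) : ∫ y, pd i k y = 0 := by
  have h1 := hasDerivAt_avg_line hk (continuous_const (y := (1 : ℝ))) one_pos 0 i 0
  simp only [avg_const, mul_one, inv_one, one_mul] at h1
  exact h1.unique (hasDerivAt_const _ _)

lemma lipschitz_avg {k g : E3 → ℝ} (hk : IsKernel k) (hg : Continuous g) {s : ℝ} (hs : 0 < s)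
    {B : Fin 3 → ℝ} (hB : ∀ i x, |avg (pd i k) g s x| ≤ B i) (x y : E3) :
    |avg k g s x - avg k g s y| ≤ s⁻¹ * (∑ i, B i) * ‖x - y‖ := by
  rw [← Real.norm_eq_abs]
  refine Convex.norm_image_sub_le_of_norm_hasFDerivWithin_le (s := univ)
    (fun z _ => (hasFDerivAt_avg_right hk hg hs z).hasFDerivWithinAt) (fun z _ => ?_)
    convex_univ (mem_univ y) (mem_univ x)
  rw [norm_smul, norm_inv, Real.norm_of_nonneg hs.le]
  refine mul_le_mul_of_nonneg_left ?_ (by positivity)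
  exact (norm_covec_le _).trans (Finset.sum_le_sum fun i _ => hB i z)

/-- For periodic `g`, the function `avg (∂ᵢk) g s` is a derivative of a periodic function, hence it
vanishes somewhere on each line in the direction `e i`, and so it is controlled by its own
derivative. This gives decay at large scales. -/
lemma abs_avg_pd_le {k g : E3 → ℝ} (hk : IsKernel k) (hg : Continuous g) (hp : SpacePeriodic g)
    {s : ℝ} (hs : 0 < s) (i : Fin 3) {B : ℝ} (hB : ∀ x, |avg (pd i (pd i k)) g s x| ≤ B)
    (x : E3) : |avg (pd i k) g s x| ≤ 2 * Real.pi * (s⁻¹ * B) := by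
  have hpi := Real.pi_pos
  have hB0 : 0 ≤ B := (abs_nonneg _).trans (hB 0)
  obtain ⟨r, hr, hr0⟩ := exists_hasDerivAt_eq_zero (f := fun r : ℝ => avg k g s (x + r • e i))
    (a := 0) (b := 2 * Real.pi) (by positivity)
    (fun r _ => (hasDerivAt_avg_line hk hg hs x i r).continuousAt.continuousWithinAt)
    (by simp [avg_periodic hp k s i x]) (fun r _ => hasDerivAt_avg_line hk hg hs x i r)
  have hr1 : avg (pd i k) g s (x + r • e i) = 0 := by
    rcases mul_eq_zero.1 hr0 with h | h
    · exact absurd h (inv_ne_zero hs.ne')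
    · exact h
  have h2 := Convex.norm_image_sub_le_of_norm_hasDerivWithin_le (s := univ)
    (f := fun r : ℝ => avg (pd i k) g s (x + r • e i)) (C := s⁻¹ * B)
    (fun r _ => (hasDerivAt_avg_line (hk.pd i) hg hs x i r).hasDerivWithinAt)
    (fun r _ => by
      rw [norm_mul, norm_inv, Real.norm_of_nonneg hs.le, Real.norm_eq_abs]
      exact mul_le_mul_of_nonneg_left (hB _) (by positivity))
    convex_univ (mem_univ r) (mem_univ 0)
  simp only [hr1, zero_smul, add_zero, sub_zero, zero_sub, norm_neg, Real.norm_eq_abs] at h2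
  refine h2.trans ?_
  rw [abs_of_pos hr.1, mul_comm]
  exact mul_le_mul_of_nonneg_right hr.2.le (by positivity)

/-! ### A radial kernel -/

/-- A smooth radial bump. -/
noncomputable def bump (y : E3) : ℝ := Real.smoothTransition (1 - ‖y‖ ^ 2)

/-- The nonnegative radial kernel `ψ` with `∂ᵢ bump = - yᵢ ψ`. -/
noncomputable def rad (y : E3) : ℝ := 2 * deriv Real.smoothTransition (1 - ‖y‖ ^ 2)

lemma contDiff_one_sub_norm_sq : ContDiff ℝ ∞ (fun y : E3 => 1 - ‖y‖ ^ 2) :=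
  contDiff_const.sub (contDiff_norm_sq ℝ)

lemma contDiff_deriv_smoothTransition : ContDiff ℝ ∞ (deriv Real.smoothTransition) :=
  (contDiff_infty_iff_deriv.1 (Real.smoothTransition.contDiff (n := ⊤))).2

lemma isKernel_bump : IsKernel bump where
  contDiff := (Real.smoothTransition.contDiff (n := ⊤)).comp contDiff_one_sub_norm_sq
  compact := by
    refine HasCompactSupport.intro (isCompact_closedBall (0 : E3) 1) fun y hy => ?_
    rw [mem_closedBall_zero_iff, not_le] at hy
    exact Real.smoothTransition.zero_of_nonpos (by nlinarith)

lemma isKernel_rad : IsKernel rad where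
  contDiff := contDiff_const.mul (contDiff_deriv_smoothTransition.comp contDiff_one_sub_norm_sq)
  compact := by
    refine HasCompactSupport.intro (isCompact_closedBall (0 : E3) 1) fun y hy => ?_
    rw [mem_closedBall_zero_iff, not_le] at hy
    have h1 : Real.smoothTransition =ᶠ[𝓝 (1 - ‖y‖ ^ 2)] fun _ => 0 := by
      filter_upwards [gt_mem_nhds (show 1 - ‖y‖ ^ 2 < 0 by nlinarith)] with r hr
      exact Real.smoothTransition.zero_of_nonpos hr.le
    rw [rad, h1.deriv_eq, deriv_const, mul_zero]

lemma rad_nonneg (y : E3) : 0 ≤ rad y :=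
  mul_nonneg zero_le_two (Real.smoothTransition.monotone.deriv_nonneg)

lemma hasFDerivAt_bump (y : E3) : HasFDerivAt bump (-(rad y • innerSL ℝ y)) y := by
  have h1 : HasFDerivAt (fun y : E3 => 1 - ‖y‖ ^ 2) (-(2 • innerSL ℝ y)) y :=
    (hasStrictFDerivAt_norm_sq y).hasFDerivAt.const_sub 1
  have h2 := ((Real.smoothTransition.contDiff (n := 1)).differentiable one_ne_zero
    (1 - ‖y‖ ^ 2)).hasDerivAt.comp_hasFDerivAt y h1
  refine h2.congr_fderiv ?_
  ext v
  simp [rad]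
  ring

lemma inner_e (y : E3) (i : Fin 3) : inner ℝ y (e i) = y i := by
  simp [e, EuclideanSpace.inner_single_right]

lemma pd_bump (i : Fin 3) : pd i bump = fun y => -(rad y * y i) := by
  ext y
  rw [pd, (hasFDerivAt_bump y).fderiv]
  simp [inner_e]

/-- The Laplacian of the bump is the scale derivative of the averages with kernel `rad`, which makes
the sum of the second-order potentials telescope over the scales. -/
lemma sum_pd_pd_bump (y : E3) : ∑ i, pd i (pd i bump) y = - dil rad y := by
  have h1 : ∀ i, pd i (pd i bump) y = -(rad y + fderiv ℝ rad y (e i) * y i) := by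
    intro i
    rw [pd_bump]
    have h2 := ((isKernel_rad.contDiff_one.differentiable one_ne_zero y).hasFDerivAt.mul
      ((EuclideanSpace.proj i : E3 →L[ℝ] ℝ).hasFDerivAt (x := y))).neg
    have h3 : pd i (fun y => -(rad y * y i)) y = _ := congrArg (fun L => L (e i)) h2.fderiv
    rw [h3]
    simp [e]
    ring
  have h4 : fderiv ℝ rad y y = ∑ i, fderiv ℝ rad y (e i) * y i := by
    conv_lhs => rw [clm_eq_covec (fderiv ℝ rad y)]
    rw [covec_apply]
  simp only [h1, dil, h4, Fin.sum_univ_three]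
  ring

/-- The integral of the radial kernel, the normalizing constant of the potentials. -/
noncomputable def kap : ℝ := ∫ y, rad y

lemma kap_pos : 0 < kap := by
  obtain ⟨r, hr, hr1⟩ := exists_deriv_eq_slope Real.smoothTransition zero_lt_one
    Real.smoothTransition.continuous.continuousOn
    ((Real.smoothTransition.contDiff (n := 1)).differentiable one_ne_zero).differentiableOn
  refine isKernel_rad.continuous.integral_pos_of_hasCompactSupport_nonneg_nonzero
    isKernel_rad.compact rad_nonneg (x := Real.sqrt (1 - r) • e 0) ?_
  rw [rad, norm_smul, norm_e, mul_one, Real.norm_of_nonneg (Real.sqrt_nonneg _),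
    Real.sq_sqrt (by linarith [hr.2]), sub_sub_cancel, hr1]
  simp

/-! ### Periodic potentials as integrals over scales -/

/-- A power of the scale `s` with one exponent below and another one above the threshold `r`. -/
noncomputable def twoPow (r A p B q s : ℝ) : ℝ := if s ≤ r then A * s ^ p else B * s ^ q

lemma integrableOn_twoPow {r p q : ℝ} (hr : 0 < r) (A B : ℝ) (hp : -1 < p) (hq : q < -1) :
    IntegrableOn (twoPow r A p B q) (Ioi 0) := by
  rw [← Ioc_union_Ioi_eq_Ioi hr.le]
  refine IntegrableOn.union ?_ ?_
  · have h1 : IntegrableOn (fun s : ℝ => A * s ^ p) (Ioc 0 r) :=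
      ((intervalIntegrable_iff_integrableOn_Ioc_of_le hr.le).1
        (intervalIntegral.intervalIntegrable_rpow' hp)).const_mul A
    exact h1.congr_fun (fun s hs => by simp [twoPow, hs.2]) measurableSet_Ioc
  · have h1 : IntegrableOn (fun s : ℝ => B * s ^ q) (Ioi r) :=
      (integrableOn_Ioi_rpow_of_lt hq hr).const_mul B
    exact h1.congr_fun (fun s hs => by simp [twoPow, not_le.2 (mem_Ioi.1 hs)]) measurableSet_Ioi

lemma integral_twoPow {r p q : ℝ} (hr : 0 < r) (A B : ℝ) (hp : -1 < p) (hq : q < -1) :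
    ∫ s in Ioi 0, twoPow r A p B q s =
      A * (r ^ (p + 1) / (p + 1)) + B * (-r ^ (q + 1) / (q + 1)) := by
  have hi := integrableOn_twoPow hr A B hp hq
  rw [← Ioc_union_Ioi_eq_Ioi hr.le] at hi ⊢
  rw [setIntegral_union (by simp) measurableSet_Ioi
    hi.left_of_union hi.right_of_union]
  congr 1
  · rw [setIntegral_congr_fun (g := fun s : ℝ => A * s ^ p) measurableSet_Ioc
      (fun s hs => by simp [twoPow, hs.2]), integral_const_mul,
      ← intervalIntegral.integral_of_le hr.le, integral_rpow (Or.inl hp),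
      Real.zero_rpow (by linarith), sub_zero]
  · rw [setIntegral_congr_fun (g := fun s : ℝ => B * s ^ q) measurableSet_Ioi
      (fun s hs => by simp [twoPow, not_le.2 (mem_Ioi.1 hs)]), integral_const_mul,
      integral_Ioi_rpow_of_lt hq hr]

lemma abs_integral_le_twoPow {r p q A B : ℝ} (hr : 0 < r) (hp : -1 < p) (hq : q < -1)
    {F : ℝ → ℝ} (hF : ∀ s, 0 < s → |F s| ≤ twoPow r A p B q s) :
    |∫ s in Ioi 0, F s| ≤ A * (r ^ (p + 1) / (p + 1)) + B * (-r ^ (q + 1) / (q + 1)) := by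
  rw [← integral_twoPow hr A B hp hq, ← Real.norm_eq_abs]
  exact norm_integral_le_of_norm_le (integrableOn_twoPow hr A B hp hq)
    ((ae_restrict_iff' measurableSet_Ioi).2 (Eventually.of_forall fun s hs => hF s hs))

/-- The sum of the moments of all derivatives of the radial bump of orders one to three. -/
noncomputable def momentSum : ℝ :=
  ∑ i, moment (pd i bump) + ∑ i, ∑ j, moment (pd j (pd i bump)) +
    ∑ i, ∑ j, ∑ l, moment (pd l (pd j (pd i bump)))

lemma momentSum_nonneg : 0 ≤ momentSum := by
  have h := moment_nonneg
  unfold momentSum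
  have h1 : 0 ≤ ∑ i, moment (pd i bump) := Finset.sum_nonneg fun i _ => h _
  have h2 : 0 ≤ ∑ i, ∑ j, moment (pd j (pd i bump)) :=
    Finset.sum_nonneg fun i _ => Finset.sum_nonneg fun j _ => h _
  have h3 : 0 ≤ ∑ i, ∑ j, ∑ l, moment (pd l (pd j (pd i bump))) :=
    Finset.sum_nonneg fun i _ => Finset.sum_nonneg fun j _ => Finset.sum_nonneg fun l _ => h _
  linarith

lemma sum_moment_le (i j : Fin 3) : moment (pd i bump) ≤ momentSum ∧
    moment (pd j (pd i bump)) ≤ momentSum ∧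
    ∑ l, moment (pd l (pd j (pd i bump))) ≤ momentSum := by
  have h := moment_nonneg
  have h1 : 0 ≤ ∑ i, moment (pd i bump) := Finset.sum_nonneg fun i _ => h _
  have h2 : 0 ≤ ∑ i, ∑ j, moment (pd j (pd i bump)) :=
    Finset.sum_nonneg fun i _ => Finset.sum_nonneg fun j _ => h _
  have h3 : 0 ≤ ∑ i, ∑ j, ∑ l, moment (pd l (pd j (pd i bump))) :=
    Finset.sum_nonneg fun i _ => Finset.sum_nonneg fun j _ => Finset.sum_nonneg fun l _ => h _
  have e1 : moment (pd i bump) ≤ ∑ i, moment (pd i bump) :=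
    Finset.single_le_sum (f := fun i => moment (pd i bump)) (fun i _ => h _) (Finset.mem_univ i)
  have e2 : moment (pd j (pd i bump)) ≤ ∑ i, ∑ j, moment (pd j (pd i bump)) :=
    (Finset.single_le_sum (f := fun j => moment (pd j (pd i bump))) (fun _ _ => h _)
      (Finset.mem_univ j)).trans
    (Finset.single_le_sum (f := fun i => ∑ j, moment (pd j (pd i bump)))
      (fun _ _ => Finset.sum_nonneg fun _ _ => h _) (Finset.mem_univ i))
  have e3 : ∑ l, moment (pd l (pd j (pd i bump))) ≤
      ∑ i, ∑ j, ∑ l, moment (pd l (pd j (pd i bump))) :=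
    (Finset.single_le_sum (f := fun j => ∑ l, moment (pd l (pd j (pd i bump))))
      (fun _ _ => Finset.sum_nonneg fun _ _ => h _) (Finset.mem_univ j)).trans
    (Finset.single_le_sum (f := fun i => ∑ j, ∑ l, moment (pd l (pd j (pd i bump))))
      (fun _ _ => Finset.sum_nonneg fun _ _ => Finset.sum_nonneg fun _ _ => h _)
      (Finset.mem_univ i))
  unfold momentSum
  exact ⟨by linarith, by linarith, by linarith⟩

lemma moment_third_le (i j l : Fin 3) : moment (pd l (pd j (pd i bump))) ≤ momentSum :=
  (Finset.single_le_sum (f := fun l => moment (pd l (pd j (pd i bump))))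
    (fun _ _ => moment_nonneg _) (Finset.mem_univ l)).trans (sum_moment_le i j).2.2

/-- The first-order potential `κ ∂ᵢ(-Δ)⁻¹ (g - m)`, where `m` is the mean value of `g` and `κ` is
`kap`, written as an integral over all scales. -/
noncomputable def pot (i : Fin 3) (g : E3 → ℝ) (x : E3) : ℝ :=
  ∫ s in Ioi 0, avg (pd i bump) g s x

/-- The second-order potential, the derivative `∂ⱼ (pot i g)`; a singular integral operator. -/
noncomputable def rz (i j : Fin 3) (g : E3 → ℝ) (x : E3) : ℝ :=
  ∫ s in Ioi 0, s⁻¹ * avg (pd j (pd i bump)) g s x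

/-- The constant of the Hölder estimates for the potentials. -/
noncomputable def potConst (γ : ℝ) : ℝ :=
  momentSum * (1 + (2 * Real.pi) ^ 2 + 2 / γ + 2 * Real.pi + 1 / (1 - γ))

section bounds

variable {γ M : ℝ} {g : E3 → ℝ}

/-- The integrand of the first-order potential is bounded at small scales, and decays like `s⁻²` at
large scales because `g` is periodic. -/
lemma abs_avg_one_le (hγ : 0 < γ) (hg : HB γ M g) (hp : SpacePeriodic g) (i : Fin 3) {s : ℝ}
    (hs : 0 < s) (x : E3) : |avg (pd i bump) g s x| ≤
      twoPow 1 (momentSum * M) 0 ((2 * Real.pi) ^ 2 * momentSum * M) (-2) s := by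
  have hM := hg.nonneg
  have hgc := hg.continuous hγ
  have hb := isKernel_bump
  unfold twoPow
  split_ifs with h
  · rw [Real.rpow_zero, mul_one]
    exact (abs_avg_le (hb.pd i) hg.bound s x).trans
      (mul_le_mul_of_nonneg_right (sum_moment_le i i).1 hM)
  · have h1 := fun y => abs_avg_pd_le (hb.pd i) hgc hp hs i
      (fun z => abs_avg_le (((hb.pd i).pd i).pd i) hg.bound s z) y
    refine (abs_avg_pd_le hb hgc hp hs i h1 x).trans ?_
    have h2 : s ^ (-2 : ℝ) = s⁻¹ * s⁻¹ := by
      rw [Real.rpow_neg hs.le, Real.rpow_two, pow_two, mul_inv]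
    rw [h2]
    have h3 := mul_le_mul_of_nonneg_right (moment_third_le i i i) hM
    have h4 : 0 ≤ (2 * Real.pi) ^ 2 * (s⁻¹ * s⁻¹) := by positivity
    have := mul_le_mul_of_nonneg_left h3 h4
    nlinarith

/-- The integrand of the second-order potential is integrable at small scales because `g` is Hölder
continuous, and at large scales because `g` is periodic. -/
lemma abs_avg_two_le (hγ : 0 < γ) (hγ1 : γ < 1) (hg : HB γ M g) (hp : SpacePeriodic g)
    (i j : Fin 3) {s : ℝ} (hs : 0 < s) (x : E3) : |s⁻¹ * avg (pd j (pd i bump)) g s x| ≤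
      twoPow 1 (momentSum * M) (γ - 1) (2 * Real.pi * momentSum * M) (-2) s := by
  have hM := hg.nonneg
  have hgc := hg.continuous hγ
  have hb := isKernel_bump
  rw [abs_mul, abs_inv, abs_of_pos hs]
  unfold twoPow
  split_ifs with h
  · have h1 := abs_avg_le_rpow ((hb.pd i).pd j) (integral_pd_eq_zero (hb.pd i) j) hγ hγ1.le hg
      hs.le x
    rw [Real.rpow_sub_one hs.ne', inv_mul_eq_div, mul_div_assoc']
    gcongr
    refine h1.trans ?_
    gcongr
    exact (sum_moment_le i j).2.1
  · have h1 := abs_avg_pd_le (hb.pd i) hgc hp hs j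
      (fun z => abs_avg_le (((hb.pd i).pd j).pd j) hg.bound s z) x
    have h2 : s ^ (-2 : ℝ) = s⁻¹ * s⁻¹ := by
      rw [Real.rpow_neg hs.le, Real.rpow_two, pow_two, mul_inv]
    rw [h2]
    have h3 := mul_le_mul_of_nonneg_right (moment_third_le i j j) hM
    calc s⁻¹ * |avg (pd j (pd i bump)) g s x|
        ≤ s⁻¹ * (2 * Real.pi * (s⁻¹ * (momentSum * M))) := by
          refine mul_le_mul_of_nonneg_left (h1.trans ?_) (by positivity)
          gcongr
      _ = _ := by ring

lemma continuousOn_avg_scale {k : E3 → ℝ} (hk : IsKernel k) (hg : Continuous g) (x : E3) :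
    Continuous (fun s : ℝ => avg k g s x) :=
  (continuous_avg hk hg).comp (by fun_prop : Continuous fun s : ℝ => (s, x))

lemma integrableOn_of_le_twoPow {r p q A B : ℝ} (hr : 0 < r) (hp : -1 < p) (hq : q < -1)
    {F : ℝ → ℝ} (hFc : ContinuousOn F (Ioi 0)) (hF : ∀ s, 0 < s → |F s| ≤ twoPow r A p B q s) :
    IntegrableOn F (Ioi 0) :=
  (integrableOn_twoPow hr A B hp hq).mono' (hFc.aestronglyMeasurable measurableSet_Ioi)
    ((ae_restrict_iff' measurableSet_Ioi).2 (Eventually.of_forall fun s hs => hF s hs))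

lemma integrableOn_avg_one (hγ : 0 < γ) (hg : HB γ M g) (hp : SpacePeriodic g)
    (i : Fin 3) (x : E3) : IntegrableOn (fun s => avg (pd i bump) g s x) (Ioi 0) :=
  integrableOn_of_le_twoPow one_pos (by norm_num) (by norm_num)
    (continuousOn_avg_scale (isKernel_bump.pd i) (hg.continuous hγ) x).continuousOn
    fun _ hs => abs_avg_one_le hγ hg hp i hs x

lemma integrableOn_avg_two (hγ : 0 < γ) (hγ1 : γ < 1) (hg : HB γ M g) (hp : SpacePeriodic g)
    (i j : Fin 3) (x : E3) :
    IntegrableOn (fun s => s⁻¹ * avg (pd j (pd i bump)) g s x) (Ioi 0) :=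
  integrableOn_of_le_twoPow one_pos (by linarith) (by norm_num)
    ((continuousOn_inv₀.mono fun s hs => (mem_Ioi.1 hs).ne').mul
      (continuousOn_avg_scale ((isKernel_bump.pd i).pd j) (hg.continuous hγ) x).continuousOn)
    fun _ hs => abs_avg_two_le hγ hγ1 hg hp i j hs x

lemma potConst_nonneg (hγ : 0 < γ) (hγ1 : γ < 1) : 0 ≤ potConst γ := by
  have := momentSum_nonneg
  have h1 : 0 < 1 - γ := by linarith
  have := Real.pi_pos
  unfold potConst
  positivity

lemma abs_pot_le (hγ : 0 < γ) (hγ1 : γ < 1) (hg : HB γ M g) (hp : SpacePeriodic g) (i : Fin 3)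
    (x : E3) : |pot i g x| ≤ potConst γ * M := by
  refine (abs_integral_le_twoPow one_pos (by norm_num) (by norm_num)
    fun _ hs => abs_avg_one_le hγ hg hp i hs x).trans ?_
  have h0 := mul_nonneg momentSum_nonneg hg.nonneg
  have h1 : 0 < 1 / (1 - γ) := by apply one_div_pos.2; linarith
  have h2 : 0 < 2 / γ := by positivity
  have := Real.pi_pos
  have e1 : potConst γ * M = momentSum * M * (1 + (2 * Real.pi) ^ 2) +
      momentSum * M * (2 / γ) + momentSum * M * (2 * Real.pi) + momentSum * M * (1 / (1 - γ)) := by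
    rw [potConst]; ring
  have e2 : (-1 : ℝ) / (-2 + 1) = 1 := by norm_num
  rw [e1, Real.one_rpow, Real.one_rpow, e2]
  linarith [mul_nonneg h0 h1.le, mul_nonneg h0 h2.le, mul_nonneg h0 this.le]

/-- The second-order potentials are bounded on `C^{0,γ}`. In the estimate of a difference, scales
below `‖x - y‖` are treated by the cancellation in the kernel at each of the points, and larger
scales by the derivative of the average. -/
lemma holder_rz (hγ : 0 < γ) (hγ1 : γ < 1) (hg : HB γ M g) (hp : SpacePeriodic g) (i j : Fin 3) :
    HB γ (potConst γ * M) (rz i j g) := by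
  have h0 := mul_nonneg momentSum_nonneg hg.nonneg
  have h1 : 0 < 1 / (1 - γ) := by apply one_div_pos.2; linarith
  have h2 : 0 < 1 / γ := by positivity
  have hpi := Real.pi_pos
  have hb := isKernel_bump
  have hgc := hg.continuous hγ
  refine ⟨fun x => ?_, fun x y => ?_⟩
  · refine (abs_integral_le_twoPow one_pos (by linarith) (by norm_num)
      fun _ hs => abs_avg_two_le hγ hγ1 hg hp i j hs x).trans ?_
    rw [sub_add_cancel, Real.one_rpow, Real.one_rpow]
    have e1 : potConst γ * M = momentSum * M + momentSum * M * (2 * Real.pi) ^ 2 +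
        2 * (momentSum * M * (1 / γ)) + momentSum * M * (2 * Real.pi) +
        momentSum * M * (1 / (1 - γ)) := by
      rw [potConst]; ring
    have e2 : (-1 : ℝ) / (-2 + 1) = 1 := by norm_num
    rw [e1, e2]
    linarith [mul_nonneg h0 h1.le, mul_nonneg h0 h2.le, mul_nonneg h0 hpi.le,
      mul_nonneg h0 (sq_nonneg (2 * Real.pi))]
  · rcases eq_or_ne x y with rfl | hxy
    · simp [Real.zero_rpow hγ.ne']
    have hr : 0 < ‖x - y‖ := norm_pos_iff.2 (sub_ne_zero.2 hxy)
    rw [rz, rz, ← integral_sub (integrableOn_avg_two hγ hγ1 hg hp i j x)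
      (integrableOn_avg_two hγ hγ1 hg hp i j y)]
    have hk0 := integral_pd_eq_zero (hb.pd i) j
    -- the threshold between small and large scales is `‖x - y‖`
    refine (abs_integral_le_twoPow (p := γ - 1) (q := γ - 2) (A := 2 * (momentSum * M))
      (B := momentSum * M * ‖x - y‖) hr (by linarith) (by linarith) fun s hs => ?_).trans ?_
    · rw [← mul_sub, abs_mul, abs_inv, abs_of_pos hs]
      unfold twoPow
      split_ifs with h
      · have e1 := abs_avg_le_rpow ((hb.pd i).pd j) hk0 hγ hγ1.le hg hs.le x
        have e2 := abs_avg_le_rpow ((hb.pd i).pd j) hk0 hγ hγ1.le hg hs.le y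
        have e3 := mul_le_mul_of_nonneg_right
          (mul_le_mul_of_nonneg_right (sum_moment_le i j).2.1 hg.nonneg) (Real.rpow_nonneg hs.le γ)
        rw [Real.rpow_sub_one hs.ne', inv_mul_eq_div, mul_div_assoc']
        gcongr
        exact (abs_sub _ _).trans (by linarith)
      · have e1 := lipschitz_avg ((hb.pd i).pd j) hgc hs
          (B := fun l => moment (pd l (pd j (pd i bump))) * M * s ^ γ)
          (fun l z => abs_avg_le_rpow (((hb.pd i).pd j).pd l)
            (integral_pd_eq_zero ((hb.pd i).pd j) l) hγ hγ1.le hg hs.le z) x y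
        rw [← Finset.sum_mul, ← Finset.sum_mul] at e1
        have e2 : s ^ (γ - 2) = s⁻¹ * s⁻¹ * s ^ γ := by
          rw [Real.rpow_sub hs, Real.rpow_two]; field_simp
        rw [e2]
        calc s⁻¹ * |avg (pd j (pd i bump)) g s x - avg (pd j (pd i bump)) g s y|
            ≤ s⁻¹ * (s⁻¹ * (momentSum * M * s ^ γ) * ‖x - y‖) := by
              refine mul_le_mul_of_nonneg_left (e1.trans ?_) (by positivity)
              have := hg.nonneg
              gcongr
              exact (sum_moment_le i j).2.2
          _ = _ := by ring
    · rw [sub_add_cancel, show γ - 2 + 1 = γ - 1 by ring, Real.rpow_sub_one hr.ne']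
      have e1 : momentSum * M * ‖x - y‖ * (-(‖x - y‖ ^ γ / ‖x - y‖) / (γ - 1)) =
          momentSum * M * ‖x - y‖ ^ γ * (1 / (1 - γ)) := by
        have : γ - 1 ≠ 0 := by linarith
        have : 1 - γ ≠ 0 := by linarith
        field_simp
        ring
      rw [e1]
      have h3 : 0 ≤ momentSum * M * ‖x - y‖ ^ γ := by positivity
      rw [potConst]
      have : 2 * (momentSum * M) * (‖x - y‖ ^ γ / γ) = momentSum * M * ‖x - y‖ ^ γ * (2 / γ) := by
        ring
      rw [this]
      have e4 : momentSum * (1 + (2 * Real.pi) ^ 2 + 2 / γ + 2 * Real.pi + 1 / (1 - γ)) * M *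
          ‖x - y‖ ^ γ = momentSum * M * ‖x - y‖ ^ γ *
          (1 + (2 * Real.pi) ^ 2 + 2 * Real.pi) + momentSum * M * ‖x - y‖ ^ γ * (2 / γ)
          + momentSum * M * ‖x - y‖ ^ γ * (1 / (1 - γ)) := by ring
      rw [e4]
      have : 0 ≤ momentSum * M * ‖x - y‖ ^ γ * (1 + (2 * Real.pi) ^ 2 + 2 * Real.pi) := by
        positivity
      linarith

/-- Differentiation under the integral over scales. -/
lemma hasFDerivAt_pot (hγ : 0 < γ) (hγ1 : γ < 1) (hg : HB γ M g) (hp : SpacePeriodic g)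
    (i : Fin 3) (x : E3) : HasFDerivAt (pot i g) (covec (fun j => rz i j g x)) x := by
  have hb := isKernel_bump
  have hgc := hg.continuous hγ
  have hcont : ∀ x, ContinuousOn
      (fun s => s⁻¹ • covec (fun j => avg (pd j (pd i bump)) g s x)) (Ioi 0) := by
    intro x
    refine (continuousOn_inv₀.mono fun s hs => (mem_Ioi.1 hs).ne').smul ?_
    unfold covec
    exact continuousOn_finsetSum _ fun j _ =>
      ((continuousOn_avg_scale ((hb.pd i).pd j) hgc x).continuousOn).fun_smul continuousOn_const
  have hbd : ∀ s, 0 < s → ∀ x, ‖s⁻¹ • covec (fun j => avg (pd j (pd i bump)) g s x)‖ ≤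
      3 * twoPow 1 (momentSum * M) (γ - 1) (2 * Real.pi * momentSum * M) (-2) s := by
    intro s hs x
    rw [norm_smul]
    refine (mul_le_mul_of_nonneg_left (norm_covec_le _) (norm_nonneg _)).trans ?_
    rw [Finset.mul_sum]
    refine (Finset.sum_le_sum fun j _ => ?_).trans_eq
      (b := ∑ _ : Fin 3, twoPow 1 (momentSum * M) (γ - 1) (2 * Real.pi * momentSum * M) (-2) s) ?_
    · have := abs_avg_two_le hγ hγ1 hg hp i j hs x
      rwa [abs_mul, ← Real.norm_eq_abs s⁻¹] at this
    · simp
  have hint := (integrableOn_twoPow one_pos (momentSum * M) (2 * Real.pi * momentSum * M)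
      (show -1 < γ - 1 by linarith) (show (-2 : ℝ) < -1 by norm_num)).const_mul 3
  have hmain := hasFDerivAt_integral_of_dominated_of_fderiv_le (𝕜 := ℝ)
    (μ := volume.restrict (Ioi (0 : ℝ))) (x₀ := x) (s := univ) (H := E3)
    (F := fun x s => avg (pd i bump) g s x)
    (F' := fun x s => s⁻¹ • covec (fun j => avg (pd j (pd i bump)) g s x))
    univ_mem
    (Eventually.of_forall fun z => (integrableOn_avg_one hγ hg hp i z).aestronglyMeasurable)
    (integrableOn_avg_one hγ hg hp i x)
    ((hcont x).aestronglyMeasurable measurableSet_Ioi)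
    ((ae_restrict_iff' measurableSet_Ioi).2 (Eventually.of_forall fun s hs z _ => hbd s hs z))
    hint
    ((ae_restrict_iff' measurableSet_Ioi).2 (Eventually.of_forall fun s hs z _ =>
      hasFDerivAt_avg_right (hb.pd i) hgc hs z))
  refine hmain.congr_fderiv ?_
  rw [clm_eq_covec (∫ s in Ioi (0 : ℝ), _)]
  congr 1 with j
  rw [ContinuousLinearMap.integral_apply]
  · simp [covec_e, rz]
  · exact hint.mono' ((hcont x).aestronglyMeasurable measurableSet_Ioi)
      ((ae_restrict_iff' measurableSet_Ioi).2 (Eventually.of_forall fun s hs => hbd s hs x))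

lemma contDiff_pot (hγ : 0 < γ) (hγ1 : γ < 1) (hg : HB γ M g) (hp : SpacePeriodic g)
    (i : Fin 3) : ContDiff ℝ 1 (pot i g) := by
  rw [contDiff_one_iff_fderiv]
  refine ⟨fun x => (hasFDerivAt_pot hγ hγ1 hg hp i x).differentiableAt, ?_⟩
  have : fderiv ℝ (pot i g) = fun x => covec (fun j => rz i j g x) :=
    funext fun x => (hasFDerivAt_pot hγ hγ1 hg hp i x).fderiv
  rw [this]
  unfold covec
  exact continuous_finsetSum _ fun j _ =>
    ((holder_rz hγ hγ1 hg hp i j).continuous hγ).smul continuous_const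

lemma pot_periodic (hp : SpacePeriodic g) (i : Fin 3) : SpacePeriodic (pot i g) := by
  intro j x
  simp only [pot]
  congr 1 with s
  exact avg_periodic hp _ s j x

/-- The trace of the second-order potentials inverts the averaging over scales: it recovers `g`
up to its mean value `m`, which is the limit of averages over large scales. -/
lemma exists_sum_rz (hγ : 0 < γ) (hγ1 : γ < 1) (hg : HB γ M g) (hp : SpacePeriodic g) :
    ∃ m : ℝ, (∀ x, Tendsto (fun s => avg rad g s x) atTop (𝓝 (kap * m))) ∧
      ∀ x, ∑ i, rz i i g x = kap * (m - g x) := by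
  have hb := isKernel_bump
  have hgc := hg.continuous hγ
  have hsum : ∀ x s, ∑ i, s⁻¹ * avg (pd i (pd i bump)) g s x = -(s⁻¹ * avg (dil rad) g s x) := by
    intro x s
    rw [← Finset.mul_sum, ← avg_sum_left _ (fun i _ => (hb.pd i).pd i) hgc, ← mul_neg,
      ← avg_neg_left]
    congr 2
    funext y
    exact sum_pd_pd_bump y
  have hint : ∀ x, IntegrableOn (fun s => -(s⁻¹ * avg (dil rad) g s x)) (Ioi 0) := by
    intro x
    simp only [← hsum]
    exact integrable_finsetSum _ fun i _ => integrableOn_avg_two hγ hγ1 hg hp i i x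
  -- the integrand is the scale derivative of `avg rad g s x`, so that the integral is the difference
  -- of the limits at large and at small scales
  have hlim : ∀ x, ∃ l, Tendsto (fun s => avg rad g s x) atTop (𝓝 l) := fun x =>
    ⟨_, tendsto_limUnder_of_hasDerivAt_of_integrableOn_Ioi
      (fun s hs => hasDerivAt_avg_scale isKernel_rad hgc hs x) (hint x)⟩
  choose l hl using hlim
  -- averages at scale `s` have a Lipschitz constant of order `s⁻¹`, so their limit is constant
  have hconst : ∀ x, l x = l 0 := by
    intro x
    have h1 : Tendsto (fun s => avg rad g s x - avg rad g s 0) atTop (𝓝 (l x - l 0)) :=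
      (hl x).sub (hl 0)
    have h2 : Tendsto (fun s : ℝ => s⁻¹ * (∑ i, moment (pd i rad) * M) * ‖x - 0‖) atTop (𝓝 0) := by
      simpa using (tendsto_inv_atTop_zero.mul_const (∑ i, moment (pd i rad) * M)).mul_const ‖x - 0‖
    have h3 : Tendsto (fun s => avg rad g s x - avg rad g s 0) atTop (𝓝 0) := by
      refine squeeze_zero_norm' ?_ h2
      filter_upwards [eventually_gt_atTop 0] with s hs
      exact lipschitz_avg isKernel_rad hgc hs
        (fun i z => abs_avg_le (isKernel_rad.pd i) hg.bound s z) x 0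
    exact sub_eq_zero.1 (tendsto_nhds_unique h1 h3)
  have hk := kap_pos.ne'
  refine ⟨l 0 / kap, fun x => ?_, fun x => ?_⟩
  · rw [mul_div_cancel₀ _ hk, ← hconst x]; exact hl x
  · have h1 := integral_Ioi_of_hasDerivAt_of_tendsto
      (continuousOn_avg_scale isKernel_rad hgc x).continuousWithinAt
      (fun s hs => hasDerivAt_avg_scale isKernel_rad hgc hs x) (hint x) (hl x)
    rw [avg_zero] at h1
    simp only [← hsum] at h1
    rw [integral_finsetSum _ fun i _ => integrableOn_avg_two hγ hγ1 hg hp i i x] at h1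
    simp only [rz, h1, mul_sub, mul_div_cancel₀ _ hk, hconst x]
    rfl

end bounds

/-! ### Null forms of continuously differentiable functions -/

lemma IsKernel.pd_comm {k : E3 → ℝ} (hk : IsKernel k) (i j : Fin 3) :
    PeriodicEuler.pd i (PeriodicEuler.pd j k) = PeriodicEuler.pd j (PeriodicEuler.pd i k) := by
  ext y
  have hs : IsSymmSndFDerivAt ℝ k y :=
    (hk.contDiff.contDiffAt).isSymmSndFDerivAt (by simp; exact WithTop.coe_le_coe.2 le_top)
  have h1 : ∀ a b : Fin 3, PeriodicEuler.pd a (PeriodicEuler.pd b k) y =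
      fderiv ℝ (fderiv ℝ k) y (e a) (e b) := by
    intro a b
    have hd : DifferentiableAt ℝ (fderiv ℝ k) y :=
      ((hk.contDiff.fderiv_right (m := ∞) (by simp)).differentiable (by simp)) y
    have : HasFDerivAt (PeriodicEuler.pd b k)
        ((ContinuousLinearMap.apply ℝ ℝ (e b)).comp (fderiv ℝ (fderiv ℝ k) y)) y :=
      (ContinuousLinearMap.apply ℝ ℝ (e b)).hasFDerivAt.comp y hd.hasFDerivAt
    rw [PeriodicEuler.pd, this.fderiv]
    rfl
  rw [h1, h1, hs.eq]

lemma avg_sub {k f g : E3 → ℝ} (hk : IsKernel k) (hf : Continuous f) (hg : Continuous g)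
    (s : ℝ) (x : E3) : avg k (fun y => f y - g y) s x = avg k f s x - avg k g s x := by
  simp only [avg, mul_sub]
  exact integral_sub (integrable_avg hk hf s x) (integrable_avg hk hg s x)

lemma contDiff_avg {k g : E3 → ℝ} (hk : IsKernel k) (hg : Continuous g) {s : ℝ} (hs : 0 < s) :
    ContDiff ℝ 1 (avg k g s) := by
  rw [contDiff_one_iff_fderiv]
  refine ⟨fun x => (hasFDerivAt_avg_right hk hg hs x).differentiableAt, ?_⟩
  have : fderiv ℝ (avg k g s) = fun x => s⁻¹ • covec (fun i => avg (pd i k) g s x) :=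
    funext fun x => (hasFDerivAt_avg_right hk hg hs x).fderiv
  rw [this]
  unfold covec
  have h1 : ∀ j, Continuous fun x => avg (pd j k) g s x := fun j =>
    (continuous_avg (hk.pd j) hg).comp (by fun_prop : Continuous fun x : E3 => (s, x))
  fun_prop

lemma pd_avg {k g : E3 → ℝ} (hk : IsKernel k) (hg : Continuous g) {s : ℝ} (hs : 0 < s)
    (i : Fin 3) (x : E3) : pd i (avg k g s) x = s⁻¹ * avg (pd i k) g s x := by
  rw [pd, (hasFDerivAt_avg_right hk hg hs x).fderiv]
  simp [covec_e]

lemma pd_mul {f g : E3 → ℝ} (hf : ContDiff ℝ 1 f) (hg : ContDiff ℝ 1 g) (i : Fin 3) (x : E3) :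
    pd i (fun y => f y * g y) x = f x * pd i g x + g x * pd i f x := by
  have h1 := ((hf.differentiable one_ne_zero x).hasFDerivAt).mul
    ((hg.differentiable one_ne_zero x).hasFDerivAt)
  have h2 : pd i (fun y => f y * g y) x = _ := congrArg (fun L => L (e i)) h1.fderiv
  rw [h2]
  simp [pd]

/-- Integration by parts against a compactly supported function. -/
lemma integral_mul_pd {h g : E3 → ℝ} (hh : ContDiff ℝ 1 h) (hc : HasCompactSupport h)
    (hg : ContDiff ℝ 1 g) (i : Fin 3) : ∫ x, h x * pd i g x = - ∫ x, pd i h x * g x := by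
  have hhc := continuous_pd hh i
  have hgc := continuous_pd hg i
  have h1 : HasCompactSupport (pd i h) := hc.fderiv_apply (𝕜 := ℝ) (e i)
  refine integral_mul_fderiv_eq_neg_fderiv_mul_of_integrable ?_ ?_ ?_
    (fun y _ => (hh.differentiable one_ne_zero) y) (fun y _ => (hg.differentiable one_ne_zero) y)
  · exact (hhc.mul hg.continuous).integrable_of_hasCompactSupport h1.mul_right
  · exact (hh.continuous.mul hgc).integrable_of_hasCompactSupport hc.mul_right
  · exact (hh.continuous.mul hg.continuous).integrable_of_hasCompactSupport hc.mul_right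

/-- Regularization in the scale parameter: two integrals against a compactly supported function
agree if their mollifications at small positive scales agree. -/
lemma integral_eq_of_mollified {ι : Type*} (t : Finset ι) {h f : ι → E3 → ℝ}
    (hh : ∀ i, Continuous (h i)) (hc : ∀ i, HasCompactSupport (h i)) (hf : ∀ i, Continuous (f i))
    (heq : ∀ s > 0, ∑ i ∈ t, ∫ x, h i x * avg rad (f i) s x = 0) :
    ∑ i ∈ t, ∫ x, h i x * f i x = 0 := by
  have hcont : Continuous fun s : ℝ => ∑ i ∈ t, ∫ x, h i x * avg rad (f i) s x := by
    refine continuous_finsetSum _ fun i _ => ?_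
    have h1 := continuous_parametric_integral_of_continuous (μ := (volume : Measure E3))
      (f := fun (s : ℝ) (x : E3) => h i x * avg rad (f i) s x)
      (by
        have h2 := continuous_avg isKernel_rad (hf i)
        have h3 := hh i
        simp only [Function.uncurry_def]
        exact (h3.comp continuous_snd).mul h2) (hc i)
    convert h1 using 2 with s
    refine (setIntegral_eq_integral_of_forall_compl_eq_zero fun y hy => ?_).symm
    rw [image_eq_zero_of_notMem_tsupport hy, zero_mul]
  have h0 : Tendsto (fun s : ℝ => ∑ i ∈ t, ∫ x, h i x * avg rad (f i) s x) (𝓝[>] 0)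
      (𝓝 (∑ i ∈ t, ∫ x, h i x * avg rad (f i) 0 x)) :=
    (hcont.tendsto 0).mono_left nhdsWithin_le_nhds
  have h1 : (fun s : ℝ => ∑ i ∈ t, ∫ x, h i x * avg rad (f i) s x) =ᶠ[𝓝[>] 0] fun _ => 0 := by
    filter_upwards [self_mem_nhdsWithin] with s hs using heq s hs
  have h2 := tendsto_nhds_unique h0 (tendsto_const_nhds.congr' h1.symm)
  have h3 : ∀ i, ∫ x, h i x * avg rad (f i) 0 x = kap * ∫ x, h i x * f i x := by
    intro i
    rw [← integral_const_mul]
    congr 1 with x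
    rw [avg_zero, kap]; ring
  simp only [h3, ← Finset.mul_sum] at h2
  exact (mul_eq_zero.1 h2).resolve_left kap_pos.ne'

lemma pd_const_mul (c : ℝ) (f : E3 → ℝ) (i : Fin 3) (x : E3) :
    pd i (fun y => c * f y) x = c * pd i f x := by
  have h : fderiv ℝ (fun y => c * f y) x = c • fderiv ℝ f x :=
    congrFun (fderiv_const_smul_field (f := f) c) x
  rw [pd, pd, h]
  rfl

/-- Mollified partial derivatives as derivatives of the kernel. -/
lemma avg_rad_pd {g : E3 → ℝ} (hg : ContDiff ℝ 1 g) {s : ℝ} (hs : 0 < s) (b : Fin 3) :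
    avg rad (pd b g) s = fun x => s⁻¹ * avg (pd b rad) g s x := by
  ext x
  rw [avg_pd_left isKernel_rad hg, inv_mul_cancel_left₀ hs.ne']

lemma contDiff_avg_rad_pd {g : E3 → ℝ} (hg : ContDiff ℝ 1 g) {s : ℝ} (hs : 0 < s) (b : Fin 3) :
    ContDiff ℝ 1 (avg rad (pd b g) s) :=
  contDiff_avg isKernel_rad (continuous_pd hg b) hs

lemma pd_avg_rad_pd {g : E3 → ℝ} (hg : ContDiff ℝ 1 g) {s : ℝ} (hs : 0 < s) (a b : Fin 3)
    (x : E3) : pd a (avg rad (pd b g) s) x = s⁻¹ * (s⁻¹ * avg (pd a (pd b rad)) g s x) := by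
  rw [avg_rad_pd hg hs, pd_const_mul, pd_avg (isKernel_rad.pd b) hg.continuous hs]

lemma pd_avg_rad_pd_comm {g : E3 → ℝ} (hg : ContDiff ℝ 1 g) {s : ℝ} (hs : 0 < s) (a b : Fin 3)
    (x : E3) : pd a (avg rad (pd b g) s) x = pd b (avg rad (pd a g) s) x := by
  rw [pd_avg_rad_pd hg hs, pd_avg_rad_pd hg hs, isKernel_rad.pd_comm a b]

/-- The mixed gradients `∂ᵢh ∂ⱼg - ∂ⱼh ∂ᵢg` integrate to zero. -/
lemma integral_pd_mul_pd_comm {h g : E3 → ℝ} (hh : ContDiff ℝ 1 h) (hc : HasCompactSupport h)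
    (hg : ContDiff ℝ 1 g) (i j : Fin 3) :
    ∫ x, pd i h x * pd j g x = ∫ x, pd j h x * pd i g x := by
  have key : ∀ s : ℝ, 0 < s → ∀ a b : Fin 3, ∫ x, pd a h x * avg rad (pd b g) s x =
      - ∫ x, h x * pd a (avg rad (pd b g) s) x := by
    intro s hs a b
    rw [integral_mul_pd hh hc (contDiff_avg_rad_pd hg hs b), neg_neg]
  have hcs : ∀ a, HasCompactSupport (pd a h) := fun a => hc.fderiv_apply (𝕜 := ℝ) (e a)
  have h1 := integral_eq_of_mollified (Finset.univ : Finset Bool)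
    (h := fun t => if t then pd i h else fun x => - pd j h x)
    (f := fun t => if t then pd j g else pd i g)
    (by
      have h1 := continuous_pd hh i
      have h2 := continuous_pd hh j
      intro t; cases t <;> simp <;> fun_prop)
    (by
      intro t
      cases t
      · exact (hcs j).neg
      · simpa using hcs i)
    (by intro t; cases t <;> simp [continuous_pd hg])
    (by
      intro s hs
      simp only [Fintype.sum_bool, if_true, Bool.false_eq_true, if_false, neg_mul, integral_neg]
      rw [key s hs, key s hs]
      simp [pd_avg_rad_pd_comm hg hs j i])
  simp only [Fintype.sum_bool, if_true, Bool.false_eq_true, if_false, neg_mul, integral_neg] at h1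
  linarith

/-- The Jacobian determinant of three scalar functions. -/
noncomputable def jac (f g h : E3 → ℝ) (x : E3) : ℝ :=
  pd 0 f x * (pd 1 g x * pd 2 h x - pd 2 g x * pd 1 h x) +
  pd 1 f x * (pd 2 g x * pd 0 h x - pd 0 g x * pd 2 h x) +
  pd 2 f x * (pd 0 g x * pd 1 h x - pd 1 g x * pd 0 h x)

/-- The Jacobian determinant of `u`, `f`, `g` integrates to zero when `u` has compact support. -/
lemma integral_jac_eq_zero {u f g : E3 → ℝ} (hu : ContDiff ℝ 1 u) (hc : HasCompactSupport u)
    (hf : ContDiff ℝ 1 f) (hg : ContDiff ℝ 1 g) : ∫ x, jac u f g x = 0 := by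
  have hcs : ∀ a, HasCompactSupport (pd a u) := fun a => hc.fderiv_apply (𝕜 := ℝ) (e a)
  have hfc := fun i => continuous_pd hf i
  have hgc := fun i => continuous_pd hg i
  have huc := fun i => continuous_pd hu i
  let m : Fin 3 → Fin 3 → E3 → ℝ := fun i j x => pd i u x * pd j f x - pd j u x * pd i f x
  have hmc : ∀ i j, Continuous (m i j) := fun i j => by
    have := hfc i; have := hfc j; have := huc i; have := huc j
    simp only [m]; fun_prop
  have hms : ∀ i j, HasCompactSupport (m i j) := fun i j =>
    (hcs i).mul_right.sub (hcs j).mul_right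
  -- mollifying `g` makes its second derivatives available
  have key : ∀ s : ℝ, 0 < s → ∀ i j k : Fin 3, ∫ x, m i j x * avg rad (pd k g) s x =
      (∫ x, u x * (pd j (avg rad (pd k g) s) x * pd i f x)) -
        ∫ x, u x * (pd i (avg rad (pd k g) s) x * pd j f x) := by
    intro s hs i j k
    have hG := contDiff_avg_rad_pd hg hs k
    set G := avg rad (pd k g) s
    have hGc := fun i => continuous_pd hG i
    have h1 := integral_pd_mul_pd_comm (hu.mul hG) hc.mul_right hf i j
    have hint : ∀ {w : E3 → ℝ}, Continuous w → Integrable fun x => u x * w x := fun hw =>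
      (hu.continuous.mul hw).integrable_of_hasCompactSupport hc.mul_right
    have hint2 : ∀ a {w : E3 → ℝ}, Continuous w → Integrable fun x => pd a u x * w x :=
      fun a _ hw => ((huc a).mul hw).integrable_of_hasCompactSupport (hcs a).mul_right
    have h2 : ∀ a b, ∫ x, pd a (fun y => u y * G y) x * pd b f x =
        (∫ x, u x * (pd a G x * pd b f x)) + ∫ x, pd a u x * (pd b f x * G x) := by
      intro a b
      have := hGc a; have := hfc b; have := hG.continuous
      rw [← integral_add (hint (by fun_prop)) (hint2 a (by fun_prop))]
      congr 1 with x
      rw [pd_mul hu hG]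
      ring
    have h1' : ∫ x, pd i (fun y => u y * G y) x * pd j f x =
      ∫ x, pd j (fun y => u y * G y) x * pd i f x := h1
    rw [h2, h2] at h1'
    have h3 : ∫ x, m i j x * G x = (∫ x, pd i u x * (pd j f x * G x)) -
        ∫ x, pd j u x * (pd i f x * G x) := by
      have := hfc i; have := hfc j; have := hG.continuous
      rw [← integral_sub (hint2 i (by fun_prop)) (hint2 j (by fun_prop))]
      congr 1 with x
      simp only [m]; ring
    rw [h3]
    linarith
  have h1 := integral_eq_of_mollified (Finset.univ : Finset (Fin 3))
    (h := fun t => m (t + 1) (t + 2)) (f := fun t => pd t g)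
    (fun t => hmc _ _) (fun t => hms _ _) hgc
    (by
      intro s hs
      have e1 : (1 : Fin 3) + 1 = 2 := rfl
      have e2 : (1 : Fin 3) + 2 = 0 := rfl
      have e3 : (2 : Fin 3) + 1 = 0 := rfl
      have e4 : (2 : Fin 3) + 2 = 1 := rfl
      simp only [key s hs, Fin.sum_univ_three, e1, e2, e3, e4, zero_add]
      simp only [pd_avg_rad_pd_comm hg hs 1 0, pd_avg_rad_pd_comm hg hs 2 0,
        pd_avg_rad_pd_comm hg hs 2 1]
      ring)
  have hi : ∀ i j k, Integrable fun x => m i j x * pd k g x := fun i j k =>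
    ((hmc i j).mul (hgc k)).integrable_of_hasCompactSupport (hms i j).mul_right
  rw [← integral_finsetSum _ fun t _ => hi _ _ _] at h1
  rw [← h1]
  congr 1 with x
  have e1 : (1 : Fin 3) + 1 = 2 := rfl
  have e2 : (1 : Fin 3) + 2 = 0 := rfl
  have e3 : (2 : Fin 3) + 1 = 0 := rfl
  have e4 : (2 : Fin 3) + 2 = 1 := rfl
  simp only [Fin.sum_univ_three, e1, e2, e3, e4, zero_add, m, jac]
  ring

/-! ### Weak curl and weak divergence -/

/-- `C i j` is the distributional derivative `∂ᵢRⱼ - ∂ⱼRᵢ`, tested against rescaled kernels. -/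
def WeakCurl (R : Fin 3 → E3 → ℝ) (C : Fin 3 → Fin 3 → E3 → ℝ) : Prop :=
  ∀ k, IsKernel k → ∀ s > 0, ∀ x i j,
    avg (pd i k) (R j) s x - avg (pd j k) (R i) s x = s * avg k (C i j) s x

/-- `d` is the distributional divergence of `D`, tested against rescaled kernels. -/
def WeakDiv (D : Fin 3 → E3 → ℝ) (d : E3 → ℝ) : Prop :=
  ∀ k, IsKernel k → ∀ s > 0, ∀ x, ∑ j, avg (pd j k) (D j) s x = s * avg k d s x

lemma weakCurl_of_contDiff {v : Fin 3 → E3 → ℝ} (hv : ∀ j, ContDiff ℝ 1 (v j)) :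
    WeakCurl v (fun i j x => pd i (v j) x - pd j (v i) x) := by
  intro k hk s hs x i j
  rw [avg_pd_left hk (hv j), avg_pd_left hk (hv i),
    avg_sub hk (continuous_pd (hv j) i) (continuous_pd (hv i) j)]
  ring

lemma weakDiv_of_contDiff {v : Fin 3 → E3 → ℝ} (hv : ∀ j, ContDiff ℝ 1 (v j)) :
    WeakDiv v (fun x => ∑ j, pd j (v j) x) := by
  intro k hk s hs x
  rw [avg_sum hk _ fun j _ => continuous_pd (hv j) j, Finset.mul_sum]
  exact Finset.sum_congr rfl fun j _ => avg_pd_left hk (hv j) j s x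

/-- The translated and reflected rescaled kernel is an admissible test function. -/
lemma testFunction {k : E3 → ℝ} (hk : IsKernel k) {s : ℝ} (hs : 0 < s) (x : E3) :
    ContDiff ℝ 1 (fun z => scaled k s (x - z)) ∧ HasCompactSupport (fun z => scaled k s (x - z)) ∧
      ∀ i z, pd i (fun z => scaled k s (x - z)) z = -(s⁻¹ * scaled (pd i k) s (x - z)) := by
  refine ⟨?_, ?_, fun i z => ?_⟩
  · exact contDiff_const.mul
      (hk.contDiff_one.comp ((contDiff_const.sub contDiff_id).const_smul s⁻¹))
  · obtain ⟨R0, h0⟩ := hk.exists_radius_scaled s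
    refine HasCompactSupport.intro (isCompact_closedBall x R0) fun z hz => ?_
    rw [h0 s hs le_rfl]
    rwa [mem_closedBall_zero_iff, ← dist_eq_norm, dist_comm]
  · have h1 : HasFDerivAt (fun z : E3 => s⁻¹ • (x - z)) (s⁻¹ • (-ContinuousLinearMap.id ℝ E3)) z :=
      ((hasFDerivAt_id z).const_sub x).const_smul s⁻¹
    have h2 := (((hk.contDiff_one.differentiable one_ne_zero) (s⁻¹ • (x - z))).hasFDerivAt.comp z
      h1).const_mul (s⁻¹ ^ 3)
    have h3 : pd i (fun z => scaled k s (x - z)) z = _ := congrArg (fun L => L (e i)) h2.fderiv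
    rw [h3]
    simp [scaled, pd]
    ring

/-- The field `f ∇g` has the weak curl `∇f × ∇g` although its components need not be
differentiable. -/
lemma weakCurl_mul_pd {f g : E3 → ℝ} (hf : ContDiff ℝ 1 f) (hg : ContDiff ℝ 1 g) :
    WeakCurl (fun j x => f x * pd j g x) (fun i j x => pd i f x * pd j g x - pd j f x * pd i g x) := by
  intro k hk s hs x i j
  obtain ⟨hθ, hθc, hθd⟩ := testFunction hk hs x
  have hav : ∀ i (F : E3 → ℝ), avg (pd i k) F s x =
      ∫ z, -s * (pd i (fun z => scaled k s (x - z)) z * F z) := by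
    intro i F
    rw [avg_eq_integral _ _ hs]
    congr 1 with z
    rw [hθd]
    field_simp
  simp only [hav, avg_eq_integral k _ hs]
  set θ := fun z => scaled k s (x - z)
  have h1 := integral_pd_mul_pd_comm (hθ.mul hf) hθc.mul_right hg i j
  have hθcs : ∀ a, HasCompactSupport (pd a θ) := fun a => hθc.fderiv_apply (𝕜 := ℝ) (e a)
  have hint : ∀ {w : E3 → ℝ}, Continuous w → Integrable fun z => θ z * w z := fun hw =>
    (hθ.continuous.mul hw).integrable_of_hasCompactSupport hθc.mul_right
  have hint2 : ∀ a {w : E3 → ℝ}, Continuous w → Integrable fun z => pd a θ z * w z :=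
    fun a _ hw => ((continuous_pd hθ a).mul hw).integrable_of_hasCompactSupport (hθcs a).mul_right
  have hfc := fun i => continuous_pd hf i
  have hgc := fun i => continuous_pd hg i
  have h2 : ∀ a b, ∫ z, pd a (fun y => θ y * f y) z * pd b g z =
      (∫ z, θ z * (pd a f z * pd b g z)) + ∫ z, pd a θ z * (f z * pd b g z) := by
    intro a b
    have := hfc a; have := hgc b; have := hf.continuous
    rw [← integral_add (hint (by fun_prop)) (hint2 a (by fun_prop))]
    congr 1 with z
    rw [pd_mul hθ hf]
    ring
  have h1' : ∫ z, pd i (fun y => θ y * f y) z * pd j g z =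
    ∫ z, pd j (fun y => θ y * f y) z * pd i g z := h1
  rw [h2, h2] at h1'
  have h3 : ∫ z, (pd i f z * pd j g z - pd j f z * pd i g z) * θ z =
      (∫ z, θ z * (pd i f z * pd j g z)) - ∫ z, θ z * (pd j f z * pd i g z) := by
    have := hfc i; have := hgc j; have := hfc j; have := hgc i
    rw [← integral_sub (hint (by fun_prop)) (hint (by fun_prop))]
    congr 1 with z; ring
  have h4 : ∫ z, (pd i f z * pd j g z - pd j f z * pd i g z) * scaled k s (x - z) =
    ∫ z, (pd i f z * pd j g z - pd j f z * pd i g z) * θ z := rfl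
  rw [h4, h3, integral_const_mul, integral_const_mul]
  linear_combination (-s) * h1'

/-- The divergence form of a `2 × 2` minor of a gradient matrix. -/
lemma weakDiv_minor {f g : E3 → ℝ} (hf : ContDiff ℝ 1 f) (hg : ContDiff ℝ 1 g) {i j : Fin 3}
    (hij : i ≠ j) :
    WeakDiv (fun l x => if l = i then f x * pd j g x else if l = j then -(f x * pd i g x) else 0)
      (fun x => pd i f x * pd j g x - pd j f x * pd i g x) := by
  intro k hk s hs x
  rw [← weakCurl_mul_pd hf hg k hk s hs x i j]
  have h0 : ∀ k : E3 → ℝ, avg k (fun _ => 0) s x = 0 := by simp [avg_const]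
  have h1 : ∀ (k F : E3 → ℝ), avg k (fun y => -F y) s x = - avg k F s x := by
    intro k F; simp [avg, integral_neg]
  have h2 : ∀ l, avg (pd l k)
      (fun x => if l = i then f x * pd j g x else if l = j then -(f x * pd i g x) else 0) s x =
      (if l = i then avg (pd i k) (fun x => f x * pd j g x) s x else 0) +
      (if l = j then - avg (pd j k) (fun x => f x * pd i g x) s x else 0) := by
    intro l
    by_cases hl : l = i
    · subst hl; simp [hij]
    · by_cases hl' : l = j
      · subst hl'; simp [hl, h1]
      · simp [hl, hl', h0]
  simp only [h2, Finset.sum_add_distrib]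
  simp [sub_eq_add_neg]

/-- The divergence form of the Jacobian determinant: `det(∇f, ∇g, ∇h) = div (f ∇g × ∇h)`. -/
lemma weakDiv_jac {f g h : E3 → ℝ} (hf : ContDiff ℝ 1 f) (hg : ContDiff ℝ 1 g)
    (hh : ContDiff ℝ 1 h) :
    WeakDiv (fun l x => f x * (pd (l + 1) g x * pd (l + 2) h x - pd (l + 2) g x * pd (l + 1) h x))
      (jac f g h) := by
  intro k hk s hs x
  obtain ⟨hθ, hθc, hθd⟩ := testFunction hk hs x
  have hav : ∀ i (F : E3 → ℝ), avg (pd i k) F s x =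
      ∫ z, -s * (pd i (fun z => scaled k s (x - z)) z * F z) := by
    intro i F
    rw [avg_eq_integral _ _ hs]
    congr 1 with z
    rw [hθd]
    field_simp
  simp only [hav, avg_eq_integral k _ hs]
  set θ := fun z => scaled k s (x - z)
  have h1 := integral_jac_eq_zero (hθ.mul hf) hθc.mul_right hg hh
  have hθcs : ∀ a, HasCompactSupport (pd a θ) := fun a => hθc.fderiv_apply (𝕜 := ℝ) (e a)
  have hint : ∀ {w : E3 → ℝ}, Continuous w → Integrable fun z => w z * θ z := fun hw =>
    (hw.mul hθ.continuous).integrable_of_hasCompactSupport hθc.mul_left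
  have hint2 : ∀ a {w : E3 → ℝ}, Continuous w → Integrable fun z => -s * (pd a θ z * w z) :=
    fun a _ hw => (((continuous_pd hθ a).mul hw).integrable_of_hasCompactSupport
      (hθcs a).mul_right).const_mul _
  have hfc := fun i => continuous_pd hf i
  have hgc := fun i => continuous_pd hg i
  have hhc := fun i => continuous_pd hh i
  have hfc0 := hf.continuous
  have hcr : ∀ l : Fin 3, Continuous fun z =>
      f z * (pd (l + 1) g z * pd (l + 2) h z - pd (l + 2) g z * pd (l + 1) h z) := fun l => by
    have := hgc (l + 1); have := hgc (l + 2); have := hhc (l + 1); have := hhc (l + 2)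
    fun_prop
  have hjc : Continuous (jac f g h) := by
    have a1 := hfc 0; have a2 := hfc 1; have a3 := hfc 2
    have b1 := hgc 0; have b2 := hgc 1; have b3 := hgc 2
    have c1 := hhc 0; have c2 := hhc 1; have c3 := hhc 2
    unfold jac; fun_prop
  rw [← integral_finsetSum _ fun l _ => hint2 l (hcr l)]
  have h4 : ∫ z, jac f g h z * scaled k s (x - z) = ∫ z, jac f g h z * θ z := rfl
  rw [h4, ← integral_const_mul, ← sub_eq_zero,
    ← integral_sub (integrable_finsetSum _ fun l _ => hint2 l (hcr l)) ((hint hjc).const_mul _)]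
  have h5 : ∫ z, -s * jac (fun y => θ y * f y) g h z = 0 := by
    rw [integral_const_mul]
    exact mul_eq_zero_of_right _ h1
  rw [← h5]
  congr 1 with z
  have e1 : (1 : Fin 3) + 1 = 2 := rfl
  have e2 : (1 : Fin 3) + 2 = 0 := rfl
  have e3 : (2 : Fin 3) + 1 = 0 := rfl
  have e4 : (2 : Fin 3) + 2 = 1 := rfl
  simp only [Fin.sum_univ_three, e1, e2, e3, e4, zero_add, jac, pd_mul hθ hf]
  ring

section linear

variable {ι : Type*} (t : Finset ι)

lemma WeakCurl.sum {R : ι → Fin 3 → E3 → ℝ} {C : ι → Fin 3 → Fin 3 → E3 → ℝ}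
    (hR : ∀ a i, Continuous (R a i)) (hC : ∀ a i j, Continuous (C a i j))
    (h : ∀ a, WeakCurl (R a) (C a)) :
    WeakCurl (fun j x => ∑ a ∈ t, R a j x) (fun i j x => ∑ a ∈ t, C a i j x) := by
  intro k hk s hs x i j
  rw [avg_sum (hk.pd i) t fun a _ => hR a j, avg_sum (hk.pd j) t fun a _ => hR a i,
    avg_sum hk t fun a _ => hC a i j, ← Finset.sum_sub_distrib, Finset.mul_sum]
  exact Finset.sum_congr rfl fun a _ => h a k hk s hs x i j

lemma WeakDiv.sum {D : ι → Fin 3 → E3 → ℝ} {d : ι → E3 → ℝ}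
    (hD : ∀ a i, Continuous (D a i)) (hd : ∀ a, Continuous (d a))
    (h : ∀ a, WeakDiv (D a) (d a)) :
    WeakDiv (fun j x => ∑ a ∈ t, D a j x) (fun x => ∑ a ∈ t, d a x) := by
  intro k hk s hs x
  rw [avg_sum hk t fun a _ => hd a, Finset.mul_sum,
    Finset.sum_congr rfl fun j _ => avg_sum (hk.pd j) t (fun a _ => hD a j) s x, Finset.sum_comm]
  exact Finset.sum_congr rfl fun a _ => h a k hk s hs x

lemma WeakDiv.add {D D' : Fin 3 → E3 → ℝ} {d d' : E3 → ℝ}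
    (hD : ∀ i, Continuous (D i)) (hd : Continuous d) (hD' : ∀ i, Continuous (D' i))
    (hd' : Continuous d') (h : WeakDiv D d) (h' : WeakDiv D' d') :
    WeakDiv (fun j x => D j x + D' j x) (fun x => d x + d' x) := by
  intro k hk s hs x
  rw [avg_add hk hd hd', mul_add, ← h k hk s hs x, ← h' k hk s hs x, ← Finset.sum_add_distrib]
  exact Finset.sum_congr rfl fun j _ => avg_add (hk.pd j) (hD j) (hD' j) s x

lemma WeakCurl.const_mul {R : Fin 3 → E3 → ℝ} {C : Fin 3 → Fin 3 → E3 → ℝ} (h : WeakCurl R C)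
    (c : ℝ) : WeakCurl (fun j x => c * R j x) (fun i j x => c * C i j x) := by
  intro k hk s hs x i j
  rw [avg_const_mul, avg_const_mul, avg_const_mul, ← mul_sub, h k hk s hs x i j]
  ring

end linear

/-! ### The Helmholtz decomposition of Hölder fields -/

section potentials

variable {γ M : ℝ}

/-- Under the integral over scales, a field with a weak curl allows the exchange of the index of
differentiation and the index of the component, up to first-order potentials of the curl. -/
lemma WeakCurl.sum_rz {R : Fin 3 → E3 → ℝ} {C : Fin 3 → Fin 3 → E3 → ℝ} (h : WeakCurl R C)
    (hγ : 0 < γ) (hγ1 : γ < 1) (hR : ∀ i, HB γ M (R i)) (hRp : ∀ i, SpacePeriodic (R i))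
    (j : Fin 3) (x : E3) :
    ∑ i, rz i i (R j) x = ∑ i, rz i j (R i) x + ∑ i, pot i (C i j) x := by
  rw [← Finset.sum_add_distrib]
  refine Finset.sum_congr rfl fun i _ => ?_
  rw [← sub_eq_iff_eq_add', rz, rz, ← integral_sub (integrableOn_avg_two hγ hγ1 (hR j) (hRp j) i i x)
    (integrableOn_avg_two hγ hγ1 (hR i) (hRp i) i j x), pot]
  refine setIntegral_congr_fun measurableSet_Ioi fun s hs => ?_
  have hs : 0 < s := hs
  have := h _ (isKernel_bump.pd i) s hs x i j
  simp only [← mul_sub, this, inv_mul_cancel_left₀ hs.ne']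

/-- A divergence may be moved inside the second-order potentials, where it leaves a first-order
potential of the weak divergence. -/
lemma WeakDiv.sum_rz {D : Fin 3 → E3 → ℝ} {d : E3 → ℝ} (h : WeakDiv D d)
    (hγ : 0 < γ) (hγ1 : γ < 1) (hD : ∀ i, HB γ M (D i)) (hDp : ∀ i, SpacePeriodic (D i))
    (j : Fin 3) (x : E3) : ∑ i, rz i j (D i) x = pot j d x := by
  simp only [rz]
  rw [← integral_finsetSum _ fun i _ => integrableOn_avg_two hγ hγ1 (hD i) (hDp i) i j x, pot]
  refine setIntegral_congr_fun measurableSet_Ioi fun s hs => ?_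
  have hs : 0 < s := hs
  have := h _ (isKernel_bump.pd j) s hs x
  simp only [isKernel_bump.pd_comm j, ← Finset.mul_sum, this, inv_mul_cancel_left₀ hs.ne']

lemma rz_comm (i j : Fin 3) (g : E3 → ℝ) (x : E3) : rz i j g x = rz j i g x := by
  simp only [rz, isKernel_bump.pd_comm j i]

/-- A weak divergence of bounded fields has mean value zero. -/
lemma WeakDiv.sum_rz_self {D : Fin 3 → E3 → ℝ} {d : E3 → ℝ} (h : WeakDiv D d)
    (hγ : 0 < γ) (hγ1 : γ < 1) (hD : ∀ i, HB γ M (D i)) (hd : HB γ M d) (hdp : SpacePeriodic d)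
    (x : E3) : ∑ i, rz i i d x = - (kap * d x) := by
  obtain ⟨m, hm, hm'⟩ := exists_sum_rz hγ hγ1 hd hdp
  have h2 : Tendsto (fun s : ℝ => s⁻¹ * ∑ i, moment (pd i rad) * M) atTop (𝓝 0) := by
    simpa using tendsto_inv_atTop_zero.mul_const (∑ i, moment (pd i rad) * M)
  have h3 : Tendsto (fun s => avg rad d s 0) atTop (𝓝 0) := by
    refine squeeze_zero_norm' ?_ h2
    filter_upwards [eventually_gt_atTop 0] with s hs
    have h4 := h _ isKernel_rad s hs 0
    rw [← inv_mul_cancel_left₀ hs.ne' (avg rad d s 0), ← h4, norm_mul, norm_inv,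
      Real.norm_of_nonneg hs.le]
    refine mul_le_mul_of_nonneg_left ?_ (by positivity)
    exact (norm_sum_le _ _).trans (Finset.sum_le_sum fun i _ =>
      abs_avg_le (isKernel_rad.pd i) (hD i).bound s 0)
  have h5 := tendsto_nhds_unique h3 (hm 0)
  rw [hm', mul_sub, ← h5, zero_sub]

end potentials

lemma HB.mono {γ M M' : ℝ} {g : E3 → ℝ} (h : HB γ M g) (hM : M ≤ M') : HB γ M' g where
  bound x := (h.bound x).trans hM
  holder x y := (h.holder x y).trans (mul_le_mul_of_nonneg_right hM (by positivity))

lemma HB.sum {γ : ℝ} {ι : Type*} (t : Finset ι) {M : ι → ℝ} {g : ι → E3 → ℝ}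
    (h : ∀ a ∈ t, HB γ (M a) (g a)) : HB γ (∑ a ∈ t, M a) (fun x => ∑ a ∈ t, g a x) where
  bound x := (Finset.abs_sum_le_sum_abs _ _).trans (Finset.sum_le_sum fun a ha => (h a ha).bound x)
  holder x y := by
    rw [← Finset.sum_sub_distrib, Finset.sum_mul]
    exact (Finset.abs_sum_le_sum_abs _ _).trans
      (Finset.sum_le_sum fun a ha => (h a ha).holder x y)

lemma HB.add {γ M M' : ℝ} {f g : E3 → ℝ} (hf : HB γ M f) (hg : HB γ M' g) :
    HB γ (M + M') (fun x => f x + g x) where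
  bound x := (abs_add_le _ _).trans (add_le_add (hf.bound x) (hg.bound x))
  holder x y := by
    rw [add_sub_add_comm, add_mul]
    exact (abs_add_le _ _).trans (add_le_add (hf.holder x y) (hg.holder x y))

lemma HB.const_mul {γ M : ℝ} {f : E3 → ℝ} (hf : HB γ M f) (c : ℝ) :
    HB γ (|c| * M) (fun x => c * f x) where
  bound x := by
    rw [abs_mul]; exact mul_le_mul_of_nonneg_left (hf.bound x) (abs_nonneg c)
  holder x y := by
    rw [← mul_sub, abs_mul, mul_assoc]
    exact mul_le_mul_of_nonneg_left (hf.holder x y) (abs_nonneg c)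

lemma HB.neg {γ M : ℝ} {f : E3 → ℝ} (hf : HB γ M f) : HB γ M (fun x => - f x) := by
  simpa using hf.const_mul (-1)

lemma HB.sub {γ M M' : ℝ} {f g : E3 → ℝ} (hf : HB γ M f) (hg : HB γ M' g) :
    HB γ (M + M') (fun x => f x - g x) := by
  simpa [sub_eq_add_neg] using hf.add hg.neg

lemma HB.mul {γ M M' : ℝ} {f g : E3 → ℝ} (hf : HB γ M f) (hg : HB γ M' g) :
    HB γ (2 * M * M') (fun x => f x * g x) where
  bound x := by
    rw [abs_mul]
    have := mul_le_mul (hf.bound x) (hg.bound x) (abs_nonneg _) hf.nonneg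
    have h2 := mul_nonneg hf.nonneg hg.nonneg
    linarith
  holder x y := by
    have h1 : f x * g x - f y * g y = f x * (g x - g y) + (f x - f y) * g y := by ring
    rw [h1]
    refine (abs_add_le _ _).trans ?_
    rw [abs_mul, abs_mul]
    have e1 := mul_le_mul (hf.bound x) (hg.holder x y) (abs_nonneg _) hf.nonneg
    have e2 := mul_le_mul (hf.holder x y) (hg.bound y) (abs_nonneg _)
      (mul_nonneg hf.nonneg (by positivity))
    nlinarith

lemma HB.zero (γ : ℝ) : HB γ 0 (fun _ => 0) := ⟨by simp, by simp⟩

/-- The `j`-th component of a vector field. -/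
def cmp (ξ : E3 → E3) (j : Fin 3) (x : E3) : ℝ := ξ x j

/-- `M` bounds the `C^{1,γ}` norm of the periodic vector field `ξ`, componentwise. -/
structure C1B (γ M : ℝ) (ξ : E3 → E3) : Prop where
  contDiff : ContDiff ℝ 1 ξ
  periodic : SpacePeriodic ξ
  bound : ∀ j x, |cmp ξ j x| ≤ M
  grad : ∀ i j, HB γ M (pd i (cmp ξ j))

lemma contDiff_cmp {ξ : E3 → E3} (h : ContDiff ℝ 1 ξ) (j : Fin 3) : ContDiff ℝ 1 (cmp ξ j) :=
  (contDiff_euclidean.1 h) j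

lemma hasFDerivAt_cmp {ξ : E3 → E3} {L : E3 →L[ℝ] E3} {x : E3} (h : HasFDerivAt ξ L x)
    (j : Fin 3) : HasFDerivAt (cmp ξ j) ((EuclideanSpace.proj j : E3 →L[ℝ] ℝ).comp L) x :=
  (EuclideanSpace.proj j : E3 →L[ℝ] ℝ).hasFDerivAt.comp x h

lemma pd_cmp {ξ : E3 → E3} {x : E3} (h : DifferentiableAt ℝ ξ x) (i j : Fin 3) :
    pd i (cmp ξ j) x = partialDeriv i j ξ x := by
  rw [pd, (hasFDerivAt_cmp h.hasFDerivAt j).fderiv]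
  rfl

lemma periodic_cmp {ξ : E3 → E3} (h : SpacePeriodic ξ) (j : Fin 3) : SpacePeriodic (cmp ξ j) := by
  intro i x
  simp only [cmp, h i x]

lemma periodic_pd {f : E3 → ℝ} (h : SpacePeriodic f) (j : Fin 3) : SpacePeriodic (pd j f) := by
  intro i x
  simp only [pd]
  rw [← fderiv_comp_add_right]
  congr 2
  funext y
  exact h i y

/-- **Helmholtz decomposition** with prescribed divergence. If `R` has weak curl `C` and `d` is
the weak divergence of `D`, all of them Hölder continuous, then there are a field `ξ` of class
`C^{1,γ}` with divergence `-d` and a periodic potential `q` with `ξ + R = ∇q`. Only the curl of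
`R` enters the estimate for `ξ`, through first-order potentials of `C`, so that no derivative is
lost. -/
theorem exists_helmholtz {γ : ℝ} (hγ : 0 < γ) (hγ1 : γ < 1) :
    ∃ K : ℝ, 0 < K ∧ ∀ (M : ℝ) (R D : Fin 3 → E3 → ℝ) (C : Fin 3 → Fin 3 → E3 → ℝ) (d : E3 → ℝ),
      (∀ i, HB γ M (R i)) → (∀ i, HB γ M (D i)) → (∀ i j, HB γ M (C i j)) → HB γ M d →
      (∀ i, SpacePeriodic (R i)) → (∀ i, SpacePeriodic (D i)) → (∀ i j, SpacePeriodic (C i j)) →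
      SpacePeriodic d → (∀ i j x, C i j x = - C j i x) → WeakCurl R C → WeakDiv D d →
      ∃ (ξ : E3 → E3) (q : E3 → ℝ), C1B γ (K * M) ξ ∧ ContDiff ℝ 1 q ∧ SpacePeriodic q ∧
        (∀ x, |q x| ≤ K * M) ∧ (∀ j x, cmp ξ j x + R j x = pd j q x) ∧
        ∀ x, ∑ j, pd j (cmp ξ j) x = - d x := by
  have hk := kap_pos
  have hP := potConst_nonneg hγ hγ1
  set P := potConst γ
  refine ⟨7 * (kap⁻¹ * P) + 1, by positivity, ?_⟩
  intro M R D C d hR hD hC hd hRp hDp hCp hdp hanti hWC hWD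
  have hM := hd.nonneg
  choose m _ hm using fun j => exists_sum_rz hγ hγ1 (hR j) (hRp j)
  have hmb : ∀ j, |m j| ≤ 3 * (kap⁻¹ * P) * M + M := by
    intro j
    have h1 : m j = kap⁻¹ * (∑ i, rz i i (R j) 0) + R j 0 := by
      rw [hm j 0]; field_simp; ring
    rw [h1]
    refine (abs_add_le _ _).trans (add_le_add ?_ ((hR j).bound 0))
    rw [abs_mul, abs_of_pos (inv_pos.2 hk)]
    have h2 : |∑ i, rz i i (R j) 0| ≤ 3 * (P * M) := by
      refine (Finset.abs_sum_le_sum_abs _ _).trans ((Finset.sum_le_sum fun i _ =>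
        (holder_rz hγ hγ1 (hR j) (hRp j) i i).bound 0).trans_eq ?_)
      simp [P]
    calc kap⁻¹ * |∑ i, rz i i (R j) 0| ≤ kap⁻¹ * (3 * (P * M)) := by gcongr
      _ = _ := by ring
  let W : Fin 3 → E3 → ℝ := fun j x => kap⁻¹ * (∑ i, pot i (C i j) x + pot j d x) - m j
  let q : E3 → ℝ := fun x => kap⁻¹ * ∑ i, (pot i (D i) x - pot i (R i) x)
  have hWd : ∀ j x, HasFDerivAt (W j)
      (covec fun l => kap⁻¹ * (∑ i, rz i l (C i j) x + rz j l d x)) x := by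
    intro j x
    have h1 := (((HasFDerivAt.fun_sum (u := Finset.univ) fun i _ =>
      hasFDerivAt_pot hγ hγ1 (hC i j) (hCp i j) i x).add
        (hasFDerivAt_pot hγ hγ1 hd hdp j x)).const_mul kap⁻¹).sub_const (m j)
    refine h1.congr_fderiv ?_
    ext v
    simp [covec_apply, Fin.sum_univ_three]
    ring
  have hqd : ∀ x, HasFDerivAt q
      (covec fun l => kap⁻¹ * ∑ i, (rz i l (D i) x - rz i l (R i) x)) x := by
    intro x
    have h1 := ((HasFDerivAt.fun_sum (u := Finset.univ) fun i _ =>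
      (hasFDerivAt_pot hγ hγ1 (hD i) (hDp i) i x).sub
        (hasFDerivAt_pot hγ hγ1 (hR i) (hRp i) i x))).const_mul kap⁻¹
    refine h1.congr_fderiv ?_
    ext v
    simp [covec_apply, Fin.sum_univ_three]
    ring
  have hWc : ∀ j, ContDiff ℝ 1 (W j) := fun j =>
    (contDiff_const.mul ((ContDiff.sum fun i _ => contDiff_pot hγ hγ1 (hC i j) (hCp i j) i).add
      (contDiff_pot hγ hγ1 hd hdp j))).sub contDiff_const
  have hqc : ContDiff ℝ 1 q := contDiff_const.mul (ContDiff.sum fun i _ =>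
      (contDiff_pot hγ hγ1 (hD i) (hDp i) i).sub (contDiff_pot hγ hγ1 (hR i) (hRp i) i))
  have hWpd : ∀ l j x, pd l (W j) x = kap⁻¹ * (∑ i, rz i l (C i j) x + rz j l d x) := by
    intro l j x
    rw [pd, (hWd j x).fderiv, covec_e]
  have hcmp : ∀ j, cmp (fun x => WithLp.toLp 2 fun j => W j x) j = W j := fun j => rfl
  refine ⟨fun x => WithLp.toLp 2 fun j => W j x, q, ⟨?_, ?_, ?_, ?_⟩, hqc, ?_, ?_, ?_, ?_⟩
  · exact contDiff_euclidean.2 fun j => hWc j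
  · intro i x
    have : ∀ j, W j (x + (2 * Real.pi) • e i) = W j x := by
      intro j
      simp only [W, pot_periodic hdp j i x, fun l => pot_periodic (hCp l j) l i x]
    simp only [this]
  · intro j x
    rw [hcmp]
    have h2 : |∑ i, pot i (C i j) x + pot j d x| ≤ 4 * (P * M) := by
      refine (abs_add_le _ _).trans ?_
      have h3 := (Finset.abs_sum_le_sum_abs (fun i => pot i (C i j) x) Finset.univ).trans
        (Finset.sum_le_sum fun i _ => abs_pot_le hγ hγ1 (hC i j) (hCp i j) i x)
      have h4 := abs_pot_le hγ hγ1 hd hdp j x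
      simp only [Finset.sum_const, Finset.card_univ, Fintype.card_fin, nsmul_eq_mul,
        Nat.cast_ofNat] at h3
      linarith
    refine (abs_sub _ _).trans ?_
    rw [abs_mul, abs_of_pos (inv_pos.2 hk)]
    have h5 : kap⁻¹ * |∑ i, pot i (C i j) x + pot j d x| ≤ kap⁻¹ * (4 * (P * M)) := by gcongr
    have := hmb j
    nlinarith
  · intro l j
    rw [hcmp]
    have h1 : pd l (W j) = fun x => kap⁻¹ * (∑ i, rz i l (C i j) x + rz j l d x) :=
      funext fun x => hWpd l j x
    rw [h1]
    refine (((HB.sum Finset.univ fun i _ => holder_rz hγ hγ1 (hC i j) (hCp i j) i l).add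
      (holder_rz hγ hγ1 hd hdp j l)).const_mul kap⁻¹).mono ?_
    rw [abs_of_pos (inv_pos.2 hk)]
    simp only [Finset.sum_const, Finset.card_univ, Fintype.card_fin, nsmul_eq_mul,
        Nat.cast_ofNat]
    have : 0 ≤ kap⁻¹ * P * M := by positivity
    simp only [P] at this ⊢
    nlinarith
  · intro i x
    simp only [q, fun l => pot_periodic (hDp l) l i x, fun l => pot_periodic (hRp l) l i x]
  · intro x
    have h2 : |∑ i, (pot i (D i) x - pot i (R i) x)| ≤ 6 * (P * M) := by
      refine (Finset.abs_sum_le_sum_abs _ _).trans ((Finset.sum_le_sum fun i _ =>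
        (abs_sub _ _).trans (add_le_add (abs_pot_le hγ hγ1 (hD i) (hDp i) i x)
          (abs_pot_le hγ hγ1 (hR i) (hRp i) i x))).trans_eq ?_)
      simp [P]; ring
    simp only [q]
    rw [abs_mul, abs_of_pos (inv_pos.2 hk)]
    have h5 : kap⁻¹ * |∑ i, (pot i (D i) x - pot i (R i) x)| ≤ kap⁻¹ * (6 * (P * M)) := by gcongr
    have : 0 ≤ kap⁻¹ * P * M := by positivity
    nlinarith
  · intro j x
    rw [hcmp, pd, (hqd x).fderiv, covec_e, Finset.sum_sub_distrib,
      hWD.sum_rz hγ hγ1 hD hDp j x]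
    have h1 := hWC.sum_rz hγ hγ1 hR hRp j x
    rw [hm j x] at h1
    simp only [W]
    field_simp
    linarith
  · intro x
    simp only [hcmp, hWpd]
    rw [← Finset.mul_sum, Finset.sum_add_distrib, hWD.sum_rz_self hγ hγ1 hD hd hdp x]
    have h1 : ∑ j, ∑ i, rz i j (C i j) x = 0 := by
      have h2 : ∀ i j, rz i j (C i j) x = - rz j i (C j i) x := by
        intro i j
        have h3 : C i j = fun x => (-1 : ℝ) * C j i x := by
          funext y; rw [hanti i j y]; ring
        rw [rz_comm i j, h3]
        simp only [rz, avg_const_mul, ← integral_neg]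
        congr 1 with s; ring
      have h4 : ∑ j, ∑ i, rz i j (C i j) x = - ∑ j, ∑ i, rz j i (C j i) x := by
        rw [← Finset.sum_neg_distrib]
        refine Finset.sum_congr rfl fun j _ => ?_
        rw [← Finset.sum_neg_distrib]
        exact Finset.sum_congr rfl fun i _ => h2 i j
      rw [Finset.sum_comm (f := fun j i => rz j i (C j i) x)] at h4
      linarith
    rw [h1, zero_add]
    field_simp

/-- A divergence-free periodic `C¹` field whose curl is Hölder continuous has a Hölder
continuous gradient: it is recovered from its curl by the Biot–Savart potential. -/
theorem holder_grad_of_holder_curl {γ : ℝ} (hγ : 0 < γ) (hγ1 : γ < 1) {v : E3 → E3}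
    (hv : ContDiff ℝ 1 v) (hp : SpacePeriodic v) (hdiv : ∀ x, ∑ j, pd j (cmp v j) x = 0)
    {M M' : ℝ} (hM' : ∀ j, HB γ M' (cmp v j))
    (hcurl : ∀ i j, HB γ M (fun x => pd i (cmp v j) x - pd j (cmp v i) x)) (l j : Fin 3) :
    HB γ (3 * (kap⁻¹ * potConst γ) * M) (pd l (cmp v j)) := by
  have hk := kap_pos
  have hvc := contDiff_cmp hv
  have hvp := periodic_cmp hp
  have hWC := weakCurl_of_contDiff hvc
  have hWD := weakDiv_of_contDiff hvc
  simp only [hdiv] at hWD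
  have hCp : ∀ i j, SpacePeriodic (fun x => pd i (cmp v j) x - pd j (cmp v i) x) := by
    intro i j l x
    simp only [periodic_pd (hvp j) i l x, periodic_pd (hvp i) j l x]
  obtain ⟨m, _, hm⟩ := exists_sum_rz hγ hγ1 (hM' j) (hvp j)
  have hpot0 : ∀ x, pot j (fun _ : E3 => (0 : ℝ)) x = 0 := by
    intro x; simp [pot, avg_const]
  have h1 : cmp v j = fun x => m - kap⁻¹ * ∑ i, pot i
      (fun x => pd i (cmp v j) x - pd j (cmp v i) x) x := by
    funext x
    have h2 := hWC.sum_rz hγ hγ1 hM' hvp j x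
    rw [hm x, hWD.sum_rz hγ hγ1 hM' hvp j x, hpot0, zero_add] at h2
    rw [← h2]
    field_simp
    ring
  have hd : ∀ x, HasFDerivAt (fun x => m - kap⁻¹ * ∑ i, pot i
      (fun x => pd i (cmp v j) x - pd j (cmp v i) x) x)
      (covec fun l => -(kap⁻¹ * ∑ i, rz i l (fun x => pd i (cmp v j) x - pd j (cmp v i) x) x)) x := by
    intro x
    have h1 := ((HasFDerivAt.fun_sum (u := Finset.univ) fun i _ =>
      hasFDerivAt_pot hγ hγ1 (hcurl i j) (hCp i j) i x).const_mul kap⁻¹).const_sub m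
    refine h1.congr_fderiv ?_
    ext v
    simp [covec_apply, Fin.sum_univ_three]
    ring
  have h3 : pd l (cmp v j) = fun x =>
      -(kap⁻¹ * ∑ i, rz i l (fun x => pd i (cmp v j) x - pd j (cmp v i) x) x) := by
    funext x
    rw [pd]
    conv_lhs => rw [h1]
    rw [(hd x).fderiv, covec_e]
  rw [h3]
  refine (((HB.sum Finset.univ fun i _ => holder_rz hγ hγ1 (hcurl i j) (hCp i j) i l).const_mul
    kap⁻¹).neg).mono (le_of_eq ?_)
  rw [abs_of_pos (inv_pos.2 hk)]
  simp
  ring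

/-! ### Hölder classes of periodic fields -/

/-- Every point is congruent modulo the period lattice to a point of a fixed ball. -/
lemma exists_reduced (x : E3) : ∃ y ∈ Metric.closedBall (0 : E3) (6 * Real.pi),
    ∀ {F : Type} (f : E3 → F), SpacePeriodic f → f x = f y := by
  have hpi := Real.two_pi_pos
  let n : Fin 3 → ℤ := fun i => ⌊x i / (2 * Real.pi)⌋
  refine ⟨x - n 0 • ((2 * Real.pi) • e 0) - n 1 • ((2 * Real.pi) • e 1)
    - n 2 • ((2 * Real.pi) • e 2), ?_, fun f hf => ?_⟩
  · set y := x - n 0 • ((2 * Real.pi) • e 0) - n 1 • ((2 * Real.pi) • e 1)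
      - n 2 • ((2 * Real.pi) • e 2)
    have hy : ∀ i, |y i| ≤ 2 * Real.pi := by
      intro i
      have h1 : y i = x i - n i * (2 * Real.pi) := by
        fin_cases i <;> simp [y, e]
      have h2 := Int.floor_le (x i / (2 * Real.pi))
      have h3 := Int.lt_floor_add_one (x i / (2 * Real.pi))
      rw [le_div_iff₀ hpi] at h2
      rw [div_lt_iff₀ hpi] at h3
      rw [h1, abs_le]
      constructor <;> simp only [n] <;> linarith
    rw [mem_closedBall_zero_iff]
    conv_lhs => rw [sum_smul_e y]
    refine (norm_sum_le _ _).trans ?_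
    simp only [norm_smul, norm_e, mul_one, Real.norm_eq_abs, Fin.sum_univ_three]
    linarith [hy 0, hy 1, hy 2]
  · have h : ∀ i, Function.Periodic f ((2 * Real.pi) • e i) := hf
    rw [(h 2).sub_zsmul_eq, (h 1).sub_zsmul_eq, (h 0).sub_zsmul_eq]

lemma exists_bound_of_periodic {F : Type} [NormedAddCommGroup F] {f : E3 → F}
    (hf : Continuous f) (hp : SpacePeriodic f) : ∃ M, ∀ x, ‖f x‖ ≤ M := by
  obtain ⟨M, hM⟩ := (isCompact_closedBall (0 : E3) (6 * Real.pi)).exists_bound_of_continuousOn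
    hf.continuousOn
  refine ⟨M, fun x => ?_⟩
  obtain ⟨y, hy, h⟩ := exists_reduced x
  rw [h f hp]
  exact hM y hy

lemma periodic_fderiv {F : Type} [NormedAddCommGroup F] [NormedSpace ℝ F] {f : E3 → F}
    (h : SpacePeriodic f) : SpacePeriodic (fderiv ℝ f) := by
  intro i x
  rw [← fderiv_comp_add_right]
  congr 2
  funext y
  exact h i y

lemma memHolder_iff {X F : Type} [NormedAddCommGroup X] [NormedAddCommGroup F] {γ : ℝ≥0}
    {f : X → F} : MemHolder γ f ↔ ∃ M : ℝ, ∀ x y, ‖f x - f y‖ ≤ M * ‖x - y‖ ^ (γ : ℝ) := by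
  constructor
  · rintro ⟨C, hC⟩
    refine ⟨C, fun x y => ?_⟩
    rw [← dist_eq_norm, ← dist_eq_norm]
    exact hC.dist_le x y
  · rintro ⟨M, hM⟩
    refine ⟨M.toNNReal, fun x y => ?_⟩
    have h1 : ‖f x - f y‖ ≤ M.toNNReal * ‖x - y‖ ^ (γ : ℝ) :=
      (hM x y).trans (mul_le_mul_of_nonneg_right (Real.le_coe_toNNReal M) (by positivity))
    rw [edist_nndist, edist_nndist, ← ENNReal.coe_rpow_of_nonneg _ (NNReal.coe_nonneg γ), ← ENNReal.coe_mul,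
      ENNReal.coe_le_coe, ← NNReal.coe_le_coe]
    push_cast
    rwa [dist_eq_norm, dist_eq_norm]

/-- A bounded function which is Hölder continuous is so with every smaller exponent. -/
lemma holder_mono {X F : Type} [NormedAddCommGroup X] [NormedAddCommGroup F] {f : X → F}
    {B M γ γ' : ℝ} (hB : ∀ x, ‖f x‖ ≤ B) (hM : ∀ x y, ‖f x - f y‖ ≤ M * ‖x - y‖ ^ γ)
    (hγ' : 0 < γ') (hle : γ' ≤ γ) (x y : X) :
    ‖f x - f y‖ ≤ (|M| + 2 * B) * ‖x - y‖ ^ γ' := by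
  have hB0 : 0 ≤ B := (norm_nonneg _).trans (hB x)
  rcases eq_or_ne x y with rfl | hxy
  · simp [Real.zero_rpow hγ'.ne']
  have hr : 0 < ‖x - y‖ := norm_pos_iff.2 (sub_ne_zero.2 hxy)
  rcases le_total ‖x - y‖ 1 with h | h
  · have h1 := Real.rpow_le_rpow_of_exponent_ge hr h hle
    calc ‖f x - f y‖ ≤ M * ‖x - y‖ ^ γ := hM x y
      _ ≤ |M| * ‖x - y‖ ^ γ' := mul_le_mul (le_abs_self M) h1 (by positivity) (abs_nonneg _)
      _ ≤ _ := mul_le_mul_of_nonneg_right (by linarith) (by positivity)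
  · have h1 := Real.one_le_rpow h hγ'.le
    have h2 := (norm_sub_le (f x) (f y)).trans (add_le_add (hB x) (hB y))
    nlinarith [abs_nonneg M]

/-- A function with bounded gradient components has bounded `C^{0,γ}` norm. -/
lemma HB.of_grad {γ M : ℝ} (hγ : 0 < γ) (hγ1 : γ ≤ 1) {f : E3 → ℝ} (hf : ContDiff ℝ 1 f)
    (hb : ∀ x, |f x| ≤ M) (hg : ∀ i x, |pd i f x| ≤ M) : HB γ (5 * M) f := by
  have hM : 0 ≤ M := (abs_nonneg _).trans (hb 0)
  have hlip : ∀ x y, ‖f x - f y‖ ≤ (3 * M) * ‖x - y‖ ^ (1 : ℝ) := by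
    intro x y
    rw [Real.rpow_one]
    refine Convex.norm_image_sub_le_of_norm_fderiv_le (𝕜 := ℝ) (s := univ)
      (fun z _ => hf.differentiable one_ne_zero z) (fun z _ => ?_)
      convex_univ (mem_univ y) (mem_univ x)
    rw [clm_eq_covec (fderiv ℝ f z)]
    refine (norm_covec_le _).trans ((Finset.sum_le_sum fun i _ => hg i z).trans_eq ?_)
    simp
  refine ⟨fun x => (hb x).trans (by linarith), fun x y => ?_⟩
  have := holder_mono (f := f) hb hlip hγ hγ1 x y
  rw [abs_of_nonneg (by positivity)] at this
  exact this.trans (mul_le_mul_of_nonneg_right (by linarith) (by positivity))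

lemma C1B.holder {γ M : ℝ} (hγ : 0 < γ) (hγ1 : γ ≤ 1) {ξ : E3 → E3} (h : C1B γ M ξ) (j : Fin 3) :
    HB γ (5 * M) (cmp ξ j) :=
  HB.of_grad hγ hγ1 (contDiff_cmp h.contDiff j) (h.bound j) fun i x => (h.grad i j).bound x

lemma C1B.nonneg {γ M : ℝ} {ξ : E3 → E3} (h : C1B γ M ξ) : 0 ≤ M := (h.grad 0 0).nonneg

lemma norm_le_sum_abs (v : E3) : ‖v‖ ≤ ∑ j, |v j| := by
  conv_lhs => rw [sum_smul_e v]
  refine (norm_sum_le _ _).trans (le_of_eq ?_)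
  simp [norm_smul, norm_e]

lemma norm_clm_le (L : E3 →L[ℝ] E3) : ‖L‖ ≤ ∑ i, ∑ j, |L (e i) j| := by
  refine ContinuousLinearMap.opNorm_le_bound _
    (Finset.sum_nonneg fun i _ => Finset.sum_nonneg fun j _ => abs_nonneg _) fun v => ?_
  conv_lhs => rw [sum_smul_e v]
  rw [map_sum, Finset.sum_mul]
  refine (norm_sum_le _ _).trans (Finset.sum_le_sum fun i _ => ?_)
  rw [map_smul, norm_smul, mul_comm]
  exact mul_le_mul (norm_le_sum_abs _) (PiLp.norm_apply_le v i) (norm_nonneg _)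
    (Finset.sum_nonneg fun j _ => abs_nonneg _)

lemma abs_clm_le (L : E3 →L[ℝ] E3) (i j : Fin 3) : |L (e i) j| ≤ ‖L‖ :=
  (PiLp.norm_apply_le (L (e i)) j).trans ((L.le_opNorm _).trans (by rw [norm_e, mul_one]))

lemma continuous_partialDeriv {v : E3 → E3} (hv : ContDiff ℝ 1 v) (i j : Fin 3) :
    Continuous (partialDeriv i j v) := by
  have h1 : partialDeriv i j v = pd i (cmp v j) :=
    funext fun x => (pd_cmp (hv.differentiable one_ne_zero x) i j).symm
  rw [h1]
  exact continuous_pd (contDiff_cmp hv j) i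

lemma curl_zero (v : E3 → E3) (x : E3) :
    curl v x 0 = partialDeriv 1 2 v x - partialDeriv 2 1 v x := rfl

lemma curl_one (v : E3 → E3) (x : E3) :
    curl v x 1 = partialDeriv 2 0 v x - partialDeriv 0 2 v x := rfl

lemma curl_two (v : E3 → E3) (x : E3) :
    curl v x 2 = partialDeriv 0 1 v x - partialDeriv 1 0 v x := rfl

lemma continuous_curl {v : E3 → E3} (hv : ContDiff ℝ 1 v) : Continuous (curl v) := by
  have h := fun i j => continuous_partialDeriv hv i j
  refine (PiLp.continuous_toLp 2 _).comp (continuous_pi fun j => ?_)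
  fin_cases j
  · exact (h 1 2).sub (h 2 1)
  · exact (h 2 0).sub (h 0 2)
  · exact (h 0 1).sub (h 1 0)

lemma periodic_curl {v : E3 → E3} (hp : SpacePeriodic v) : SpacePeriodic (curl v) := by
  intro i x
  simp only [curl, partialDeriv, periodic_fderiv hp i x]

/-- The antisymmetric part of the gradient is made of components of the curl. -/
lemma abs_antisymm_le {v : E3 → E3} (x y : E3) (i j : Fin 3) (c : ℝ) :
    |(partialDeriv i j v x - partialDeriv j i v x) -
      c * (partialDeriv i j v y - partialDeriv j i v y)| ≤ ‖curl v x - c • curl v y‖ := by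
  have h := fun l => PiLp.norm_apply_le (curl v x - c • curl v y) l
  have h0 := h 0
  have h1 := h 1
  have h2 := h 2
  simp only [PiLp.sub_apply, PiLp.smul_apply, smul_eq_mul, curl_zero, curl_one, curl_two,
    Real.norm_eq_abs] at h0 h1 h2
  fin_cases i <;> fin_cases j <;> simp only [Fin.zero_eta, Fin.mk_one, Fin.reduceFinMk, sub_self,
    mul_zero, abs_zero, norm_nonneg]
  · exact h2
  · rw [← abs_neg]; convert h1 using 2; ring
  · rw [← abs_neg]; convert h2 using 2; ring
  · exact h0
  · exact h1
  · rw [← abs_neg]; convert h0 using 2; ring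

lemma holderCurl_of_bound {v : E3 → E3} (hv : ContDiff ℝ 1 v) {γ B M : ℝ}
    (hB : ∀ x, ‖curl v x‖ ≤ B) (hM : ∀ x y, ‖curl v x - curl v y‖ ≤ M * ‖x - y‖ ^ γ)
    (i j : Fin 3) : HB γ (max B M) (fun x => pd i (cmp v j) x - pd j (cmp v i) x) := by
  have hd := hv.differentiable one_ne_zero
  refine ⟨fun x => ?_, fun x y => ?_⟩
  · rw [pd_cmp (hd x), pd_cmp (hd x)]
    have := abs_antisymm_le (v := v) x x i j 0
    rw [zero_mul, sub_zero, zero_smul, sub_zero] at this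
    exact this.trans ((hB x).trans (le_max_left _ _))
  · rw [pd_cmp (hd x), pd_cmp (hd x), pd_cmp (hd y), pd_cmp (hd y)]
    have := abs_antisymm_le (v := v) x y i j 1
    rw [one_mul, one_smul] at this
    exact this.trans ((hM x y).trans (mul_le_mul_of_nonneg_right (le_max_right _ _)
      (by positivity)))

lemma exists_holder_cmp {γ : ℝ} (hγ : 0 < γ) (hγ1 : γ ≤ 1) {v : E3 → E3} (hv : ContDiff ℝ 1 v)
    (hp : SpacePeriodic v) : ∃ M, ∀ j, HB γ M (cmp v j) := by
  obtain ⟨B, hB⟩ := exists_bound_of_periodic hv.continuous hp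
  obtain ⟨B', hB'⟩ := exists_bound_of_periodic (hv.continuous_fderiv one_ne_zero)
    (periodic_fderiv hp)
  refine ⟨5 * max B B', fun j => HB.of_grad hγ hγ1 (contDiff_cmp hv j) (fun x => ?_)
    (fun i x => ?_)⟩
  · exact (PiLp.norm_apply_le (v x) j).trans ((hB x).trans (le_max_left _ _))
  · rw [pd_cmp (hv.differentiable one_ne_zero x)]
    exact (abs_clm_le _ i j).trans ((hB' x).trans (le_max_right _ _))

lemma divergence_eq {v : E3 → E3} {x : E3} (h : DifferentiableAt ℝ v x) :
    divergence v x = ∑ j, pd j (cmp v j) x := by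
  simp only [divergence, pd_cmp h]

/-- A divergence-free periodic `C¹` field with Hölder continuous curl is of class `C^{1,γ}`. -/
theorem exists_C1B {v : E3 → E3} (hv : ContDiff ℝ 1 v) (hp : SpacePeriodic v)
    (hdiv : ∀ x, divergence v x = 0) {γ M : ℝ} (hγ : 0 < γ) (hγ1 : γ < 1)
    (hM : ∀ x y, ‖curl v x - curl v y‖ ≤ M * ‖x - y‖ ^ γ) : ∃ M', C1B γ M' v := by
  obtain ⟨B, hB⟩ := exists_bound_of_periodic (continuous_curl hv) (periodic_curl hp)
  obtain ⟨M₁, hM₁⟩ := exists_holder_cmp hγ hγ1.le hv hp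
  have h1 := holder_grad_of_holder_curl hγ hγ1 hv hp
    (fun x => by rw [← divergence_eq (hv.differentiable one_ne_zero x), hdiv]) hM₁
    (holderCurl_of_bound hv hB hM)
  exact ⟨max M₁ (3 * (kap⁻¹ * potConst γ) * max B M), hv, hp,
    fun j x => ((hM₁ j).bound x).trans (le_max_left _ _),
    fun i j => (h1 i j).mono (le_max_right _ _)⟩

lemma C1B.norm_fderiv_sub_le {γ M : ℝ} {ξ : E3 → E3} (h : C1B γ M ξ) (x y : E3) :
    ‖fderiv ℝ ξ x - fderiv ℝ ξ y‖ ≤ 9 * M * ‖x - y‖ ^ γ := by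
  have hd := h.contDiff.differentiable one_ne_zero
  refine (norm_clm_le _).trans ((Finset.sum_le_sum fun i _ => Finset.sum_le_sum fun j _ =>
    ((?_ : _ ≤ M * ‖x - y‖ ^ γ))).trans_eq ?_)
  · have := (h.grad i j).holder x y
    rwa [pd_cmp (hd x), pd_cmp (hd y)] at this
  · simp; ring

lemma C1B.norm_fderiv_le {γ M : ℝ} {ξ : E3 → E3} (h : C1B γ M ξ) (x : E3) :
    ‖fderiv ℝ ξ x‖ ≤ 9 * M := by
  have hd := h.contDiff.differentiable one_ne_zero
  refine (norm_clm_le _).trans ((Finset.sum_le_sum fun i _ => Finset.sum_le_sum fun j _ =>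
    ((?_ : _ ≤ M))).trans_eq ?_)
  · have := (h.grad i j).bound x
    rwa [pd_cmp (hd x)] at this
  · simp; ring

lemma norm_curl_sub_le (v : E3 → E3) (x y : E3) :
    ‖curl v x - curl v y‖ ≤ 6 * ‖fderiv ℝ v x - fderiv ℝ v y‖ := by
  have h : ∀ i j, |partialDeriv i j v x - partialDeriv i j v y| ≤ ‖fderiv ℝ v x - fderiv ℝ v y‖ :=
    fun i j => abs_clm_le (fderiv ℝ v x - fderiv ℝ v y) i j
  refine (norm_le_sum_abs _).trans ?_
  simp only [Fin.sum_univ_three, PiLp.sub_apply, curl_zero, curl_one, curl_two]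
  have key : ∀ i j, |partialDeriv i j v x - partialDeriv j i v x -
      (partialDeriv i j v y - partialDeriv j i v y)| ≤ 2 * ‖fderiv ℝ v x - fderiv ℝ v y‖ := by
    intro i j
    have h1 := abs_le.1 (h i j)
    have h2 := abs_le.1 (h j i)
    exact abs_le.2 ⟨by linarith [h1.1, h2.2], by linarith [h1.2, h2.1]⟩
  linarith [key 1 2, key 2 0, key 0 1]

/-- For divergence-free periodic `C¹` fields, `C^{0,γ}` vorticity and `C^{1,γ}` velocity are
equivalent. -/
theorem memHolder_curl_iff {v : E3 → E3} (hv : ContDiff ℝ 1 v) (hp : SpacePeriodic v)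
    (hdiv : ∀ x, divergence v x = 0) {γ : ℝ≥0} (hγ : 0 < γ) (hγ1 : γ < 1) :
    MemHolder γ (curl v) ↔ IsC1Holder γ v := by
  constructor
  · intro h
    obtain ⟨M, hM⟩ := memHolder_iff.1 h
    obtain ⟨M', hM'⟩ := exists_C1B hv hp hdiv (γ := γ) (by exact_mod_cast hγ)
      (by exact_mod_cast hγ1) hM
    exact ⟨hv, memHolder_iff.2 ⟨9 * M', hM'.norm_fderiv_sub_le⟩⟩
  · rintro ⟨_, h⟩
    obtain ⟨M, hM⟩ := memHolder_iff.1 h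
    refine memHolder_iff.2 ⟨6 * M, fun x y => (norm_curl_sub_le v x y).trans ?_⟩
    rw [mul_assoc]
    exact mul_le_mul_of_nonneg_left (hM x y) (by norm_num)

/-- A field with Hölder continuous curl is of class `C^{1,γ}` for some `γ < 1`. -/
theorem exists_C1B_of_isHolder {v : E3 → E3} (hv : ContDiff ℝ 1 v) (hp : SpacePeriodic v)
    (hdiv : ∀ x, divergence v x = 0) (h : IsHolder (curl v)) :
    ∃ γ M : ℝ, 0 < γ ∧ γ < 1 ∧ C1B γ M v := by
  obtain ⟨γ, hγ, h⟩ := h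
  obtain ⟨M, hM⟩ := memHolder_iff.1 h
  obtain ⟨B, hB⟩ := exists_bound_of_periodic (continuous_curl hv) (periodic_curl hp)
  have hγ' : (0 : ℝ) < γ := by exact_mod_cast hγ
  have h0 : 0 < min (γ : ℝ) (1 / 2) := lt_min hγ' (by norm_num)
  have h1 : min (γ : ℝ) (1 / 2) < 1 := (min_le_right _ _).trans_lt (by norm_num)
  obtain ⟨M', hM'⟩ := exists_C1B hv hp hdiv h0 h1 (holder_mono hB hM h0 (min_le_left _ _))
  exact ⟨_, M', h0, h1, hM'⟩

open Finset.HasAntidiagonal (antidiagonal)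

/-! ### The recursion for the Lagrangian Taylor coefficients -/

/-- Construction of a sequence by recursion on all earlier terms, with a relation `Q` between each
term and the truncated sequence of its predecessors. -/
lemma exists_seq_of_step {α : Type*} [Zero α] (P : ℕ → α → Prop) (Q : ℕ → (ℕ → α) → α → Prop)
    (step : ∀ s (f : ℕ → α), (∀ m < s, P m (f m)) → (∀ m, s ≤ m → f m = 0) →
      ∃ y, P s y ∧ Q s f y) :
    ∃ f : ℕ → α, ∀ s, P s (f s) ∧ Q s (fun m => if m < s then f m else 0) (f s) := by
  classical
  let g : (s : ℕ) → ((m : ℕ) → m < s → α) → α := fun s prev =>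
    if H : ∃ y, P s y ∧ Q s (fun m => if h : m < s then prev m h else 0) y then H.choose else 0
  let f : ℕ → α := WellFounded.fix Nat.lt_wfRel.wf g
  have hf : ∀ s, f s = g s fun m _ => f m := fun s => WellFounded.fix_eq _ g s
  refine ⟨f, fun s => ?_⟩
  induction s using Nat.strong_induction_on with
  | _ s ih =>
    have H : ∃ y, P s y ∧ Q s (fun m => if h : m < s then f m else 0) y :=
      step s _ (fun m hm => by simpa [hm] using (ih m hm).1) fun m hm => by simp [not_lt.2 hm]
    have h1 : f s = H.choose := by
      rw [hf s]
      exact dif_pos H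
    rw [h1]
    exact H.choose_spec

lemma sum_inv_sq_le (n : ℕ) :
    ∑ m ∈ Finset.range (n + 2), (1 : ℝ) / (m : ℝ) ^ 2 ≤ 2 - 1 / ((n : ℝ) + 1) := by
  induction n with
  | zero => norm_num [Finset.sum_range_succ]
  | succ n ih =>
    rw [Finset.sum_range_succ]
    refine (add_le_add_left ih _).trans ?_
    push_cast
    have h1 : (0 : ℝ) < n + 1 := by positivity
    rw [← sub_nonneg]
    have h3 : 2 - 1 / ((n : ℝ) + 1 + 1) - (2 - 1 / ((n : ℝ) + 1) + 1 / ((n : ℝ) + 2) ^ 2) =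
        1 / ((n + 1) * (n + 2) ^ 2) := by
      have : (n : ℝ) + 1 + 1 = n + 2 := by ring
      rw [this]
      field_simp
      ring
    rw [show ((n : ℝ) + 1 + 1) = n + 2 by ring] at *
    rw [h3]
    positivity

/-- The sequence `1 / s²` is, up to a constant, stable under convolution. -/
lemma sum_antidiagonal_inv_sq_le (s : ℕ) :
    ∑ p ∈ antidiagonal s, (1 / (p.1 : ℝ) ^ 2) * (1 / (p.2 : ℝ) ^ 2) ≤ 8 / (s : ℝ) ^ 2 := by
  rcases Nat.eq_zero_or_pos s with rfl | hs
  · simp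
  have hs' : (0 : ℝ) < s := by exact_mod_cast hs
  have h1 : ∀ p ∈ antidiagonal s, (1 / (p.1 : ℝ) ^ 2) * (1 / (p.2 : ℝ) ^ 2) ≤
      2 / (s : ℝ) ^ 2 * (1 / (p.1 : ℝ) ^ 2 + 1 / (p.2 : ℝ) ^ 2) := by
    rintro ⟨a, b⟩ hp
    have hab : (a : ℝ) + b = s := by exact_mod_cast Finset.HasAntidiagonal.mem_antidiagonal.1 hp
    rcases Nat.eq_zero_or_pos a with rfl | ha
    · simp; positivity
    rcases Nat.eq_zero_or_pos b with rfl | hb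
    · simp; positivity
    have ha' : (0 : ℝ) < a := by exact_mod_cast ha
    have hb' : (0 : ℝ) < b := by exact_mod_cast hb
    rw [← hab, div_mul_div_comm, div_add_div _ _ (by positivity) (by positivity),
      div_mul_div_comm, div_le_div_iff₀ (by positivity) (by positivity)]
    have : 0 ≤ (a : ℝ) ^ 2 * b ^ 2 * (a - b) ^ 2 := by positivity
    nlinarith
  have h2 : ∑ m ∈ Finset.range (s + 1), (1 : ℝ) / (m : ℝ) ^ 2 ≤ 2 := by
    have := sum_inv_sq_le s
    have h3 : ∑ m ∈ Finset.range (s + 1), (1 : ℝ) / (m : ℝ) ^ 2 ≤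
        ∑ m ∈ Finset.range (s + 2), (1 : ℝ) / (m : ℝ) ^ 2 :=
      Finset.sum_le_sum_of_subset_of_nonneg (by simp) fun _ _ _ => by positivity
    have h4 : (0 : ℝ) < 1 / ((s : ℝ) + 1) := by positivity
    linarith
  have h5 : ∑ p ∈ antidiagonal s, 1 / (p.1 : ℝ) ^ 2 =
      ∑ m ∈ Finset.range (s + 1), (1 : ℝ) / (m : ℝ) ^ 2 :=
    Finset.Nat.sum_antidiagonal_eq_sum_range_succ (fun m _ => (1 : ℝ) / (m : ℝ) ^ 2) s
  have h6 : ∑ p ∈ antidiagonal s, 1 / (p.2 : ℝ) ^ 2 =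
      ∑ p ∈ antidiagonal s, 1 / (p.1 : ℝ) ^ 2 :=
    Finset.Nat.sum_antidiagonal_swap (f := fun p : ℕ × ℕ => 1 / (p.1 : ℝ) ^ 2)
  refine (Finset.sum_le_sum h1).trans ?_
  rw [← Finset.mul_sum, Finset.sum_add_distrib, h6, h5]
  calc 2 / (s : ℝ) ^ 2 * (_ + _) ≤ 2 / (s : ℝ) ^ 2 * (2 + 2) := by gcongr
    _ = _ := by ring

/-- The majorant of the Taylor coefficients. It vanishes for `s = 0`. -/
noncomputable def maj (A l : ℝ) (s : ℕ) : ℝ := A * l ^ s * (1 / (s : ℝ) ^ 2)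

lemma maj_nonneg {A l : ℝ} (hA : 0 ≤ A) (hl : 0 ≤ l) (s : ℕ) : 0 ≤ maj A l s := by
  unfold maj; positivity

lemma sum_maj_mul_le {A l : ℝ} (hl : 0 ≤ l) (A' : ℝ) (hA : 0 ≤ A * A') (s : ℕ) :
    ∑ p ∈ antidiagonal s, maj A l p.1 * maj A' l p.2 ≤ maj (8 * A * A') l s := by
  have h1 : ∀ p ∈ antidiagonal s, maj A l p.1 * maj A' l p.2 =
      A * A' * l ^ s * ((1 / (p.1 : ℝ) ^ 2) * (1 / (p.2 : ℝ) ^ 2)) := by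
    rintro ⟨a, b⟩ hp
    rw [← Finset.HasAntidiagonal.mem_antidiagonal.1 hp, maj, maj, pow_add]
    ring
  rw [Finset.sum_congr rfl h1, ← Finset.mul_sum]
  refine (mul_le_mul_of_nonneg_left (sum_antidiagonal_inv_sq_le s) (by positivity)).trans_eq ?_
  rw [maj]; ring

lemma sum_maj_mul_mul_le {A l : ℝ} (hA : 0 ≤ A) (hl : 0 ≤ l) (s : ℕ) :
    ∑ p ∈ antidiagonal s, ∑ r ∈ antidiagonal p.1,
      maj A l r.1 * maj A l r.2 * maj A l p.2 ≤ maj (64 * A ^ 3) l s := by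
  have h1 : ∀ p ∈ antidiagonal s, ∑ r ∈ antidiagonal p.1,
      maj A l r.1 * maj A l r.2 * maj A l p.2 ≤ maj (8 * A * A) l p.1 * maj A l p.2 := by
    intro p _
    rw [← Finset.sum_mul]
    exact mul_le_mul_of_nonneg_right (sum_maj_mul_le hl A (by positivity) _) (maj_nonneg hA hl _)
  refine (Finset.sum_le_sum h1).trans ((sum_maj_mul_le hl A (by positivity) s).trans_eq ?_)
  congr 1; ring

/-- The `(i, j)` minor of the gradients of the components `i` of `a` and `j` of `b`. -/
noncomputable def minor (i j : Fin 3) (a b : E3 → E3) (x : E3) : ℝ :=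
  pd i (cmp a i) x * pd j (cmp b j) x - pd j (cmp a i) x * pd i (cmp b j) x

/-- The polarized sum of the principal `2 × 2` minors of the gradient matrix. -/
noncomputable def minors (a b : E3 → E3) (x : E3) : ℝ :=
  ∑ c : Fin 3, minor c (c + 1) a b x

/-- The coefficient of order `s` of the sum of the principal `2 × 2` minors. -/
noncomputable def minorSum (ξ : ℕ → E3 → E3) (s : ℕ) (x : E3) : ℝ :=
  ∑ p ∈ antidiagonal s, minors (ξ p.1) (ξ p.2) x

/-- The coefficient of order `s` of the determinant of the gradient matrix. -/
noncomputable def detSum (ξ : ℕ → E3 → E3) (s : ℕ) (x : E3) : ℝ :=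
  ∑ p ∈ antidiagonal s, ∑ r ∈ antidiagonal p.1,
    jac (cmp (ξ r.1) 0) (cmp (ξ r.2) 1) (cmp (ξ p.2) 2) x

/-- The coefficient of `t ^ (s - 2)` of the `j`-th component of `(∇ξ)ᵀ ∂ₜ²ξ`. -/
noncomputable def accelSum (ξ : ℕ → E3 → E3) (s : ℕ) (j : Fin 3) (x : E3) : ℝ :=
  ∑ p ∈ antidiagonal s, ((p.1 : ℝ) * (p.1 - 1)) *
    ∑ k, cmp (ξ p.1) k x * pd j (cmp (ξ p.2) k) x

lemma contDiff_of_C1B {γ M : ℝ} {ξ : E3 → E3} (h : C1B γ M ξ) (j : Fin 3) :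
    ContDiff ℝ 1 (cmp ξ j) := contDiff_cmp h.contDiff j

lemma HB.jac {γ a b c : ℝ} {f g h : E3 → ℝ} (hf : ∀ i, HB γ a (pd i f)) (hg : ∀ i, HB γ b (pd i g))
    (hh : ∀ i, HB γ c (pd i h)) : HB γ (24 * (a * b * c)) (PeriodicEuler.jac f g h) := by
  have h1 : ∀ i j k, HB γ (8 * (a * b * c)) (fun x => pd i f x * (pd j g x * pd k h x -
      pd k g x * pd j h x)) := fun i j k =>
    ((hf i).mul (((hg j).mul (hh k)).sub ((hg k).mul (hh j)))).mono (le_of_eq (by ring))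
  exact (((h1 0 1 2).add (h1 1 2 0)).add (h1 2 0 1)).mono (le_of_eq (by ring))

lemma C1B.zero (γ : ℝ) : C1B γ 0 (0 : E3 → E3) where
  contDiff := contDiff_const
  periodic := fun _ _ => rfl
  bound j x := by simp [cmp]
  grad i j := by
    have : pd i (cmp (0 : E3 → E3) j) = fun _ => 0 := by
      funext x
      have : cmp (0 : E3 → E3) j = fun _ => 0 := by funext y; simp [cmp]
      rw [this, pd, fderiv_const_apply]; rfl
    rw [this]
    exact HB.zero γ

lemma C1B.mono {γ M M' : ℝ} {ξ : E3 → E3} (h : C1B γ M ξ) (hM : M ≤ M') : C1B γ M' ξ where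
  contDiff := h.contDiff
  periodic := h.periodic
  bound j x := (h.bound j x).trans hM
  grad i j := (h.grad i j).mono hM

/-- The flux field whose weak divergence is `minorSum + detSum`. -/
noncomputable def flux (f : ℕ → E3 → E3) (s : ℕ) (m : Fin 3) (x : E3) : ℝ :=
  (∑ p ∈ antidiagonal s, ∑ c : Fin 3,
    (if m = c then cmp (f p.1) c x * pd (c + 1) (cmp (f p.2) (c + 1)) x else
      if m = c + 1 then -(cmp (f p.1) c x * pd c (cmp (f p.2) (c + 1)) x) else 0)) +
  ∑ p ∈ antidiagonal s, ∑ r ∈ antidiagonal p.1,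
    cmp (f r.1) 0 x * (pd (m + 1) (cmp (f r.2) 1) x * pd (m + 2) (cmp (f p.2) 2) x -
      pd (m + 2) (cmp (f r.2) 1) x * pd (m + 1) (cmp (f p.2) 2) x)

lemma C1B.mul_pd {γ a b : ℝ} (hγ : 0 < γ) (hγ1 : γ ≤ 1) {ξ ζ : E3 → E3} (hξ : C1B γ a ξ)
    (hζ : C1B γ b ζ) (j k k' : Fin 3) :
    HB γ (10 * (a * b)) (fun x => cmp ξ k x * pd j (cmp ζ k') x) :=
  ((hξ.holder hγ hγ1 k).mul (hζ.grad j k')).mono (le_of_eq (by ring))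

lemma C1B.minor {γ a b : ℝ} {ξ ζ : E3 → E3} (hξ : C1B γ a ξ) (hζ : C1B γ b ζ)
    (i j k k' : Fin 3) :
    HB γ (4 * (a * b)) (fun x => pd i (cmp ξ k) x * pd j (cmp ζ k') x -
        pd j (cmp ξ k) x * pd i (cmp ζ k') x) :=
  (((hξ.grad i k).mul (hζ.grad j k')).sub ((hξ.grad j k).mul (hζ.grad i k'))).mono
    (le_of_eq (by ring))

lemma C1B.cross {γ a b c : ℝ} (hγ : 0 < γ) (hγ1 : γ ≤ 1) {ξ ζ χ : E3 → E3} (hξ : C1B γ a ξ)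
    (hζ : C1B γ b ζ) (hχ : C1B γ c χ) (i j : Fin 3) (k k' k'' : Fin 3) :
    HB γ (40 * (a * b * c)) (fun x => cmp ξ k x * (pd i (cmp ζ k') x * pd j (cmp χ k'') x -
        pd j (cmp ζ k') x * pd i (cmp χ k'') x)) :=
  ((hξ.holder hγ hγ1 k).mul (hζ.minor hχ i j k' k'')).mono (le_of_eq (by ring))

lemma weakDiv_flux {γ : ℝ} {B : ℕ → ℝ} (hγ : 0 < γ) (hγ1 : γ ≤ 1) {f : ℕ → E3 → E3}
    (hf : ∀ m, C1B γ (B m) (f m)) (s : ℕ) :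
    WeakDiv (flux f s) (fun x => minorSum f s x + detSum f s x) := by
  have hc := fun m j => contDiff_of_C1B (hf m) j
  have hmin : ∀ (p : ℕ × ℕ) (c : Fin 3), Continuous (minor c (c + 1) (f p.1) (f p.2)) :=
    fun p c => ((hf p.1).minor (hf p.2) c (c + 1) c (c + 1)).continuous hγ
  have hjac : ∀ (p r : ℕ × ℕ), Continuous (jac (cmp (f r.1) 0) (cmp (f r.2) 1) (cmp (f p.2) 2)) :=
    fun p r => (HB.jac (fun i => (hf r.1).grad i 0) (fun i => (hf r.2).grad i 1)
      (fun i => (hf p.2).grad i 2)).continuous hγ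
  have hfl : ∀ (p : ℕ × ℕ) (c m : Fin 3), Continuous fun x =>
      (if m = c then cmp (f p.1) c x * pd (c + 1) (cmp (f p.2) (c + 1)) x else
      if m = c + 1 then -(cmp (f p.1) c x * pd c (cmp (f p.2) (c + 1)) x) else 0) := by
    intro p c m
    split_ifs
    · exact ((hf p.1).mul_pd hγ hγ1 (hf p.2) _ _ _).continuous hγ
    · exact ((hf p.1).mul_pd hγ hγ1 (hf p.2) _ _ _).neg.continuous hγ
    · exact continuous_const
  have hcr : ∀ (p r : ℕ × ℕ) (m : Fin 3), Continuous fun x =>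
      cmp (f r.1) 0 x * (pd (m + 1) (cmp (f r.2) 1) x * pd (m + 2) (cmp (f p.2) 2) x -
      pd (m + 2) (cmp (f r.2) 1) x * pd (m + 1) (cmp (f p.2) 2) x) := fun p r m =>
    ((hf r.1).cross hγ hγ1 (hf r.2) (hf p.2) _ _ _ _ _).continuous hγ
  refine WeakDiv.add (fun m => ?_) ?_ (fun m => ?_) ?_
    (WeakDiv.sum _ (fun p m => ?_) (fun p => ?_) fun p =>
      WeakDiv.sum _ (fun c m => hfl p c m) (fun c => hmin p c) fun c =>
        weakDiv_minor (hc _ _) (hc _ _) (by fin_cases c <;> decide))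
    (WeakDiv.sum _ (fun p m => ?_) (fun p => ?_) fun p =>
      WeakDiv.sum _ (fun r m => hcr p r m) (fun r => hjac p r) fun r =>
        weakDiv_jac (hc _ _) (hc _ _) (hc _ _))
  · exact continuous_finsetSum _ fun p _ => continuous_finsetSum _ fun c _ => hfl p c m
  · exact continuous_finsetSum _ fun p _ => continuous_finsetSum _ fun c _ => hmin p c
  · exact continuous_finsetSum _ fun p _ => continuous_finsetSum _ fun r _ => hcr p r m
  · exact continuous_finsetSum _ fun p _ => continuous_finsetSum _ fun r _ => hjac p r
  · exact continuous_finsetSum _ fun c _ => hfl p c m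
  · exact continuous_finsetSum _ fun c _ => hmin p c
  · exact continuous_finsetSum _ fun r _ => hcr p r m
  · exact continuous_finsetSum _ fun r _ => hjac p r

/-- The weak curl of `(∇ξ)ᵀ ∂ₜ²ξ` at order `s`. -/
noncomputable def accelCurl (f : ℕ → E3 → E3) (s : ℕ) (i j : Fin 3) (x : E3) : ℝ :=
  ∑ p ∈ antidiagonal s, ((p.1 : ℝ) * (p.1 - 1)) * ∑ k,
    (pd i (cmp (f p.1) k) x * pd j (cmp (f p.2) k) x -
      pd j (cmp (f p.1) k) x * pd i (cmp (f p.2) k) x)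

lemma weakCurl_accelSum {γ : ℝ} {B : ℕ → ℝ} (hγ : 0 < γ) (hγ1 : γ ≤ 1) {f : ℕ → E3 → E3}
    (hf : ∀ m, C1B γ (B m) (f m)) (s : ℕ) : WeakCurl (accelSum f s) (accelCurl f s) := by
  have hc := fun m j => contDiff_of_C1B (hf m) j
  have h1 : ∀ (p : ℕ × ℕ) (k j : Fin 3), Continuous fun x =>
      cmp (f p.1) k x * pd j (cmp (f p.2) k) x := fun p k j =>
    ((hf p.1).mul_pd hγ hγ1 (hf p.2) _ _ _).continuous hγ
  have h2 : ∀ (p : ℕ × ℕ) (k i j : Fin 3), Continuous fun x =>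
      pd i (cmp (f p.1) k) x * pd j (cmp (f p.2) k) x -
        pd j (cmp (f p.1) k) x * pd i (cmp (f p.2) k) x := fun p k i j =>
    ((hf p.1).minor (hf p.2) _ _ _ _).continuous hγ
  exact WeakCurl.sum _
    (fun p j => continuous_const.mul (continuous_finsetSum _ fun k _ => h1 p k j))
    (fun p i j => continuous_const.mul (continuous_finsetSum _ fun k _ => h2 p k i j))
    fun p => WeakCurl.const_mul (WeakCurl.sum _ (fun k j => h1 p k j) (fun k i j => h2 p k i j)
      fun k => weakCurl_mul_pd (hc _ _) (hc _ _)) _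

section bounds

variable {γ A l : ℝ} {f : ℕ → E3 → E3} {s : ℕ}

/-- The normalized weights `m (m - 1) / (s (s - 1))` do not spoil the majorant. -/
lemma hb_weighted (hA : 0 ≤ A) (hl : 0 ≤ l) (hs : 2 ≤ s) {b : ℝ} (hb : 0 ≤ b)
    {g : ℕ × ℕ → E3 → ℝ} (hg : ∀ p, HB γ (b * (maj A l p.1 * maj A l p.2)) (g p)) :
    HB γ (b * maj (8 * A * A) l s) (fun x => ((s : ℝ) * (s - 1))⁻¹ *
      ∑ p ∈ antidiagonal s, ((p.1 : ℝ) * (p.1 - 1)) * g p x) := by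
  have hs' : (2 : ℝ) ≤ s := by exact_mod_cast hs
  have hs0 : 0 < (s : ℝ) * (s - 1) := by nlinarith
  refine ((HB.sum _ fun p _ => (hg p).const_mul ((p.1 : ℝ) * (p.1 - 1))).const_mul _).mono ?_
  rw [abs_of_pos (inv_pos.2 hs0), Finset.mul_sum]
  refine (Finset.sum_le_sum (g := fun p : ℕ × ℕ => b * (maj A l p.1 * maj A l p.2))
    fun p hp => ?_).trans ?_
  · have hp1 : (p.1 : ℝ) ≤ s := by
      have := Finset.HasAntidiagonal.mem_antidiagonal.1 hp
      exact_mod_cast (by omega : p.1 ≤ s)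
    have hp0 : (0 : ℝ) ≤ p.1 * (p.1 - 1) := by
      rcases Nat.eq_zero_or_pos p.1 with h | h
      · simp [h]
      · have : (1 : ℝ) ≤ p.1 := by exact_mod_cast h
        nlinarith
    have h1 : ((s : ℝ) * (s - 1))⁻¹ * (p.1 * (p.1 - 1)) ≤ 1 := by
      rw [inv_mul_le_iff₀ hs0, mul_one]
      nlinarith [(Nat.cast_nonneg p.1 : (0 : ℝ) ≤ p.1)]
    rw [abs_of_nonneg hp0, ← mul_assoc]
    exact mul_le_of_le_one_left
      (mul_nonneg hb (mul_nonneg (maj_nonneg hA hl _) (maj_nonneg hA hl _))) h1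
  · rw [← Finset.mul_sum]
    exact mul_le_mul_of_nonneg_left (sum_maj_mul_le hl A (by positivity) s) hb

lemma hb_accelSum (hγ : 0 < γ) (hγ1 : γ ≤ 1) (hA : 0 ≤ A) (hl : 0 ≤ l) (hs : 2 ≤ s)
    (hf : ∀ m, C1B γ (maj A l m) (f m)) (j : Fin 3) :
    HB γ (30 * maj (8 * A * A) l s) (fun x => ((s : ℝ) * (s - 1))⁻¹ * accelSum f s j x) := by
  refine hb_weighted hA hl hs (by norm_num) fun p =>
    (HB.sum _ fun k _ => (hf p.1).mul_pd hγ hγ1 (hf p.2) j k k).mono (le_of_eq ?_)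
  simp; ring

lemma hb_accelCurl (hA : 0 ≤ A) (hl : 0 ≤ l) (hs : 2 ≤ s)
    (hf : ∀ m, C1B γ (maj A l m) (f m)) (i j : Fin 3) :
    HB γ (30 * maj (8 * A * A) l s) (fun x => ((s : ℝ) * (s - 1))⁻¹ * accelCurl f s i j x) := by
  refine hb_weighted hA hl hs (by norm_num) fun p =>
    (HB.sum _ fun k _ => (hf p.1).minor (hf p.2) i j k k).mono ?_
  have := mul_nonneg (maj_nonneg hA hl p.1) (maj_nonneg hA hl p.2)
  simp
  linarith

lemma hb_sum_pair (hl : 0 ≤ l) {b : ℝ} (hb : 0 ≤ b) (hA : 0 ≤ A)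
    {g : ℕ × ℕ → E3 → ℝ} (hg : ∀ p, HB γ (b * (maj A l p.1 * maj A l p.2)) (g p)) :
    HB γ (b * maj (8 * A * A) l s) (fun x => ∑ p ∈ antidiagonal s, g p x) := by
  refine (HB.sum _ fun p _ => hg p).mono ?_
  rw [← Finset.mul_sum]
  exact mul_le_mul_of_nonneg_left (sum_maj_mul_le hl A (by positivity) s) hb

lemma hb_sum_triple (hl : 0 ≤ l) {b : ℝ} (hb : 0 ≤ b) (hA : 0 ≤ A)
    {g : ℕ × ℕ → ℕ × ℕ → E3 → ℝ}
    (hg : ∀ p r, HB γ (b * (maj A l r.1 * maj A l r.2 * maj A l p.2)) (g p r)) :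
    HB γ (b * maj (64 * A ^ 3) l s)
      (fun x => ∑ p ∈ antidiagonal s, ∑ r ∈ antidiagonal p.1, g p r x) := by
  refine (HB.sum _ fun p _ => HB.sum _ fun r _ => hg p r).mono ?_
  simp only [← Finset.mul_sum]
  exact mul_le_mul_of_nonneg_left (sum_maj_mul_mul_le hA hl s) hb

lemma hb_flux (hγ : 0 < γ) (hγ1 : γ ≤ 1) (hA : 0 ≤ A) (hl : 0 ≤ l)
    (hf : ∀ m, C1B γ (maj A l m) (f m)) (m : Fin 3) :
    HB γ (30 * maj (8 * A * A) l s + 40 * maj (64 * A ^ 3) l s) (flux f s m) := by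
  refine HB.add (hb_sum_pair hl (by norm_num) hA fun p => ?_)
    (hb_sum_triple hl (by norm_num) hA fun p r => (hf r.1).cross hγ hγ1 (hf r.2) (hf p.2) _ _ _ _ _)
  have h0 := mul_nonneg (maj_nonneg hA hl p.1) (maj_nonneg hA hl p.2)
  refine (HB.sum _ (M := fun _ => 10 * (maj A l p.1 * maj A l p.2)) fun c _ => ?_).mono
    (le_of_eq (by simp; ring))
  split_ifs
  · exact (hf p.1).mul_pd hγ hγ1 (hf p.2) _ _ _
  · exact ((hf p.1).mul_pd hγ hγ1 (hf p.2) _ _ _).neg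
  · exact (HB.zero γ).mono (by positivity)

lemma hb_div (hA : 0 ≤ A) (hl : 0 ≤ l)
    (hf : ∀ m, C1B γ (maj A l m) (f m)) :
    HB γ (30 * maj (8 * A * A) l s + 40 * maj (64 * A ^ 3) l s)
      (fun x => minorSum f s x + detSum f s x) := by
  refine HB.add (hb_sum_pair hl (by norm_num) hA fun p => ?_)
    (hb_sum_triple hl (by norm_num) hA fun p r => (HB.jac (fun i => (hf r.1).grad i 0)
      (fun i => (hf r.2).grad i 1) (fun i => (hf p.2).grad i 2)).mono ?_)
  · have h0 := mul_nonneg (maj_nonneg hA hl p.1) (maj_nonneg hA hl p.2)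
    refine (HB.sum _ fun c _ => (hf p.1).minor (hf p.2) c (c + 1) c (c + 1)).mono ?_
    simp
    linarith
  · have h0 := mul_nonneg (mul_nonneg (maj_nonneg hA hl r.1) (maj_nonneg hA hl r.2))
      (maj_nonneg hA hl p.2)
    linarith

end bounds

section periodicity

variable {γ : ℝ} {B : ℕ → ℝ} {f : ℕ → E3 → E3}

lemma C1B.shift_cmp {M : ℝ} {ξ : E3 → E3} (h : C1B γ M ξ) (i j : Fin 3) (x : E3) :
    cmp ξ j (x + (2 * Real.pi) • e i) = cmp ξ j x := periodic_cmp h.periodic j i x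

lemma C1B.shift_pd {M : ℝ} {ξ : E3 → E3} (h : C1B γ M ξ) (i j l : Fin 3) (x : E3) :
    pd l (cmp ξ j) (x + (2 * Real.pi) • e i) = pd l (cmp ξ j) x :=
  periodic_pd (periodic_cmp h.periodic j) l i x

lemma periodic_accelSum (hf : ∀ m, C1B γ (B m) (f m)) (s : ℕ) (j : Fin 3) :
    SpacePeriodic (accelSum f s j) := by
  intro i x
  simp only [accelSum, fun m => (hf m).shift_cmp i, fun m => (hf m).shift_pd i]

lemma periodic_accelCurl (hf : ∀ m, C1B γ (B m) (f m)) (s : ℕ) (a b : Fin 3) :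
    SpacePeriodic (accelCurl f s a b) := by
  intro i x
  simp only [accelCurl, fun m => (hf m).shift_pd i]

lemma periodic_flux (hf : ∀ m, C1B γ (B m) (f m)) (s : ℕ) (j : Fin 3) :
    SpacePeriodic (flux f s j) := by
  intro i x
  simp only [flux, fun m => (hf m).shift_cmp i, fun m => (hf m).shift_pd i]

lemma periodic_div (hf : ∀ m, C1B γ (B m) (f m)) (s : ℕ) :
    SpacePeriodic (fun x => minorSum f s x + detSum f s x) := by
  intro i x
  simp only [minorSum, minors, minor, detSum, jac, fun m => (hf m).shift_pd i]

end periodicity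

/-- Admissible Taylor coefficients of order `s`: the displacement coefficient and the potential
of the corresponding coefficient of `(∇X)ᵀ ∂ₜ²X`, with their bounds. -/
structure CoeffBound (γ B : ℝ) (y : (E3 → E3) × (E3 → ℝ)) : Prop where
  disp : C1B γ B y.1
  contDiff : ContDiff ℝ 1 y.2
  periodic : SpacePeriodic y.2
  bound : ∀ x, |y.2 x| ≤ B
  grad : ∀ j x, |pd j y.2 x| ≤ B

/-- The equations for the Taylor coefficients of order `s`, in terms of the sequence `f`. -/
def CoeffEq (s : ℕ) (f : ℕ → E3 → E3) (y : (E3 → E3) × (E3 → ℝ)) : Prop :=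
  (∀ j x, (s : ℝ) * (s - 1) * cmp y.1 j x + accelSum f s j x = s * (s - 1) * pd j y.2 x) ∧
    ∀ x, ∑ j, pd j (cmp y.1 j) x + (minorSum f s x + detSum f s x) = 0

/-- One step of the recursion. The right-hand sides are at least quadratic in the preceding
coefficients, so a convolution estimate bounds them by multiples of `A² lˢ / s²` and `A³ lˢ / s²`. A
small `A` absorbs these factors and the constant of the Helmholtz decomposition. -/
lemma exists_coeff {γ : ℝ} (hγ : 0 < γ) (hγ1 : γ < 1) :
    ∃ A : ℝ, 0 < A ∧ A ≤ 1 ∧ ∀ l, 0 ≤ l → ∀ s, 2 ≤ s → ∀ f : ℕ → E3 → E3,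
      (∀ m, C1B γ (maj A l m) (f m)) → ∃ y, CoeffBound γ (maj A l s) y ∧ CoeffEq s f y := by
  obtain ⟨K, hK, hH⟩ := exists_helmholtz hγ hγ1
  -- `2800 = 30 * 8 + 40 * 64` comes from the quadratic and cubic terms of the bound `M` below
  have hA0 : 0 < 1 / (2800 * (K + 1)) := by positivity
  set A := 1 / (2800 * (K + 1)) with hA
  have hA1 : A ≤ 1 := by
    rw [hA, div_le_one (by positivity)]; linarith
  refine ⟨A, hA0, hA1, fun l hl s hs f hf => ?_⟩
  set M := 30 * maj (8 * A * A) l s + 40 * maj (64 * A ^ 3) l s with hM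
  have h1 : 30 * maj (8 * A * A) l s ≤ M := by
    have := maj_nonneg (A := 64 * A ^ 3) (l := l) (by positivity) hl s
    linarith
  have hKM : (K + 1) * M ≤ maj A l s := by
    have h2 : (K + 1) * M = ((K + 1) * (240 * A + 2560 * A ^ 2)) * maj A l s := by
      rw [hM]; simp only [maj]; ring
    rw [h2]
    refine mul_le_of_le_one_left (maj_nonneg hA0.le hl s) ?_
    have h3 : (K + 1) * (2800 * A) = 1 := by rw [hA]; field_simp
    nlinarith [mul_nonneg (by positivity : 0 ≤ K + 1) (mul_nonneg hA0.le (sub_nonneg.2 hA1))]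
  have hs' : (2 : ℝ) ≤ s := by exact_mod_cast hs
  have hs0 : (s : ℝ) * (s - 1) ≠ 0 := by nlinarith
  have hR := fun j => (hb_accelSum hγ hγ1.le hA0.le hl hs hf j).mono h1
  have hd := hb_div (s := s) hA0.le hl hf
  obtain ⟨ξ, q, hξ, hq, hqp, hqb, heq, hdiv⟩ := hH M
    (fun j x => ((s : ℝ) * (s - 1))⁻¹ * accelSum f s j x) (flux f s)
    (fun i j x => ((s : ℝ) * (s - 1))⁻¹ * accelCurl f s i j x)
    (fun x => minorSum f s x + detSum f s x) hR (hb_flux hγ hγ1.le hA0.le hl hf)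
    (fun i j => (hb_accelCurl hA0.le hl hs hf i j).mono h1) hd
    (fun j i x => by simp only [periodic_accelSum hf s j i x])
    (periodic_flux hf s) (fun a b i x => by simp only [periodic_accelCurl hf s a b i x])
    (periodic_div hf s)
    (fun i j x => by
      rw [← mul_neg]
      congr 1
      simp only [accelCurl, ← Finset.sum_neg_distrib, ← mul_neg, neg_sub])
    ((weakCurl_accelSum hγ hγ1.le hf s).const_mul _) (weakDiv_flux hγ hγ1.le hf s)
  have hM0 := hd.nonneg
  have hKM' : K * M ≤ maj A l s := by linarith
  refine ⟨(ξ, q), ⟨hξ.mono hKM', hq, hqp, fun x => (hqb x).trans hKM', fun j x => ?_⟩,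
    fun j x => ?_, fun x => ?_⟩
  · rw [← heq j x]
    refine (abs_add_le _ _).trans ((add_le_add (hξ.bound j x) ((hR j).bound x)).trans ?_)
    linarith
  · rw [← heq j x, mul_add, mul_inv_cancel_left₀ hs0]
  · rw [hdiv x]; ring

/-- **Lagrangian Taylor coefficients.** A divergence-free field of class `C^{1,γ}` is the first
of a sequence of displacement coefficients with geometric bounds in `C^{1,γ}`, which satisfy the
coefficientwise forms of `(∇X)ᵀ ∂ₜ²X = ∇q` and `det ∇X = 1`. -/
theorem exists_taylor {γ M : ℝ} (hγ : 0 < γ) (hγ1 : γ < 1) {v : E3 → E3} (hv : C1B γ M v)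
    (hdiv : ∀ x, ∑ j, pd j (cmp v j) x = 0) :
    ∃ (l : ℝ) (ξ : ℕ → E3 → E3) (q : ℕ → E3 → ℝ), 0 < l ∧ ξ 0 = 0 ∧ ξ 1 = v ∧
      (∀ s, CoeffBound γ (l ^ s) (ξ s, q s)) ∧ ∀ s, CoeffEq s ξ (ξ s, q s) := by
  obtain ⟨A, hA, hA1, hstep⟩ := exists_coeff hγ hγ1
  have hM := hv.nonneg
  -- this rate makes `maj A l 1 = A * l` dominate the bound `M` of the initial velocity
  set l := M / A + 1 with hl
  have hl0 : 0 < l := by positivity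
  have hzero : ∀ s, CoeffBound γ (maj A l s) (0, 0) := by
    intro s
    have h0 := maj_nonneg hA.le hl0.le s
    refine ⟨(C1B.zero γ).mono h0, contDiff_const, fun _ _ => rfl, fun x => by simpa using h0,
      fun j x => ?_⟩
    have : pd j (0 : E3 → ℝ) x = 0 := by
      rw [pd, fderiv_zero]; rfl
    simpa [this] using h0
  obtain ⟨f, hf⟩ := exists_seq_of_step (α := (E3 → E3) × (E3 → ℝ))
    (fun s y => CoeffBound γ (maj A l s) y)
    (fun s f y => (s = 0 → y = 0) ∧ (s = 1 → y = (v, 0)) ∧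
      (2 ≤ s → CoeffEq s (fun m => (f m).1) y)) (by
      intro s f h1 h2
      rcases Nat.lt_or_ge s 2 with hs | hs
      · have hs' : s = 0 ∨ s = 1 := by omega
        rcases hs' with rfl | rfl
        · exact ⟨0, hzero 0, fun _ => rfl, by omega, by omega⟩
        · refine ⟨(v, 0), ⟨hv.mono ?_, (hzero 1).contDiff, (hzero 1).periodic, (hzero 1).bound,
            (hzero 1).grad⟩, by omega, fun _ => rfl, by omega⟩
          have : maj A l 1 = M + A := by
            simp only [maj, hl]; field_simp; norm_num
          rw [this]; linarith
      · obtain ⟨y, hy, hy'⟩ := hstep l hl0.le s hs (fun m => (f m).1) (fun m => by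
          rcases Nat.lt_or_ge m s with hm | hm
          · exact (h1 m hm).disp
          · rw [h2 m hm]; exact (hzero m).disp)
        exact ⟨y, hy, by omega, by omega, fun _ => hy'⟩)
  have h0 : f 0 = 0 := (hf 0).2.1 rfl
  have h1 : f 1 = (v, 0) := (hf 1).2.2.1 rfl
  have hc0 : ∀ j, cmp ((0 : E3 → E3)) j = fun _ => 0 := fun j => by funext y; simp [cmp]
  have hpz : ∀ i x, pd i (fun _ => (0 : ℝ)) x = 0 := by
    intro i x
    rw [pd, fderiv_const_apply]; rfl
  have hf0 : (f 0).1 = 0 := by rw [h0]; rfl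
  have hif : ∀ s, (if 0 < s then f 0 else 0).1 = 0 := fun s => by rw [h0, ite_self]; rfl
  -- terms involving an index `≥ s` also involve the index `0`, so that truncation is harmless
  have htr : ∀ s, CoeffEq s (fun m => (if m < s then f m else 0).1) (f s) →
      CoeffEq s (fun m => (f m).1) (f s) := by
    intro s h
    have hcase : ∀ m, m < s ∨ (s ≤ m ∧ ¬ m < s) := fun m => by omega
    have e1 : ∀ j x, accelSum (fun m => (if m < s then f m else 0).1) s j x =
        accelSum (fun m => (f m).1) s j x := by
      intro j x
      refine Finset.sum_congr rfl fun p hp => ?_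
      have hp := Finset.HasAntidiagonal.mem_antidiagonal.1 hp
      rcases hcase p.1 with h | h <;> rcases hcase p.2 with h' | h'
      · simp [h, h']
      · have : p.1 = 0 := by omega
        simp [this]
      · have : p.2 = 0 := by omega
        simp [this, hif, hf0, hpz, hc0, h.2]
      · have h3 : p.1 = 0 := by omega
        simp [h3]
    have e2 : ∀ x, minorSum (fun m => (if m < s then f m else 0).1) s x =
        minorSum (fun m => (f m).1) s x := by
      intro x
      refine Finset.sum_congr rfl fun p hp => ?_
      have hp := Finset.HasAntidiagonal.mem_antidiagonal.1 hp
      rcases hcase p.1 with h | h <;> rcases hcase p.2 with h' | h'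
      · simp [h, h']
      · have : p.1 = 0 := by omega
        simp [this, minors, minor, hif, hf0, hpz, hc0]
      · have : p.2 = 0 := by omega
        simp [this, minors, minor, hif, hf0, hpz, hc0]
      · have h3 : p.1 = 0 := by omega
        have h4 : p.2 = 0 := by omega
        simp [h3, h4, minors, minor, hif, hf0, hpz, hc0]
    have e3 : ∀ x, detSum (fun m => (if m < s then f m else 0).1) s x =
        detSum (fun m => (f m).1) s x := by
      intro x
      refine Finset.sum_congr rfl fun p hp => Finset.sum_congr rfl fun r hr => ?_
      have hp := Finset.HasAntidiagonal.mem_antidiagonal.1 hp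
      have hr := Finset.HasAntidiagonal.mem_antidiagonal.1 hr
      by_cases z1 : r.1 = 0
      · simp [z1, jac, hif, hf0, hpz, hc0]
      by_cases z2 : r.2 = 0
      · simp [z2, jac, hif, hf0, hpz, hc0]
      by_cases z3 : p.2 = 0
      · simp [z3, jac, hif, hf0, hpz, hc0]
      have l1 : r.1 < s := by omega
      have l2 : r.2 < s := by omega
      have l3 : p.2 < s := by omega
      simp [l1, l2, l3]
    refine ⟨fun j x => ?_, fun x => ?_⟩
    · rw [← e1]; exact h.1 j x
    · rw [← e2, ← e3]; exact h.2 x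
  have hle : ∀ s, maj A l s ≤ l ^ s := by
    intro s
    have h2 : (1 : ℝ) / (s : ℝ) ^ 2 ≤ 1 := by
      rcases Nat.eq_zero_or_pos s with rfl | h
      · simp
      · have : (1 : ℝ) ≤ s := by exact_mod_cast h
        rw [div_le_one (by positivity)]
        nlinarith
    have h3 : A * l ^ s ≤ l ^ s := mul_le_of_le_one_left (by positivity) hA1
    calc maj A l s ≤ A * l ^ s * 1 := mul_le_mul_of_nonneg_left h2 (by positivity)
      _ ≤ l ^ s := by rw [mul_one]; exact h3
  refine ⟨l, fun s => (f s).1, fun s => (f s).2, hl0, hf0, congrArg Prod.fst h1, fun s => ?_, fun s => ?_⟩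
  · have h := (hf s).1
    exact ⟨h.disp.mono (hle s), h.contDiff, h.periodic, fun x => (h.bound x).trans (hle s),
      fun j x => (h.grad j x).trans (hle s)⟩
  · rcases Nat.lt_or_ge s 2 with hs | hs
    · have hs' : s = 0 ∨ s = 1 := by omega
      rcases hs' with rfl | rfl
      · simp [CoeffEq, accelSum, minorSum, detSum, minors, minor, jac, hf0, hpz, hc0]
      · have ha : Finset.HasAntidiagonal.antidiagonal 1 = {((0 : ℕ), (1 : ℕ)), ((1 : ℕ), (0 : ℕ))} := rfl
        have ha0 : Finset.HasAntidiagonal.antidiagonal 0 = {((0 : ℕ), (0 : ℕ))} := rfl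
        simp [CoeffEq, accelSum, minorSum, detSum, minors, minor, jac, hf0, hpz, hc0, ha, ha0, h1, hdiv]
    · exact htr s ((hf s).2.2.2 hs)

/-! ### Power series in time with coefficients depending on space -/

section series

variable {F : Type} [NormedAddCommGroup F] [NormedSpace ℝ F]

/-- Continuously differentiable coefficients of a power series in time, with geometric bounds for
the coefficients and their gradients. -/
structure Geo (M l : ℝ) (f : ℕ → E3 → F) : Prop where
  nonneg : 0 ≤ M
  rate : 0 ≤ l
  contDiff : ∀ s, ContDiff ℝ 1 (f s)
  bound : ∀ s x, ‖f s x‖ ≤ M * l ^ s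
  grad : ∀ s x, ‖fderiv ℝ (f s) x‖ ≤ M * l ^ s

/-- The sum of the power series in time with coefficients `f`. -/
noncomputable def ser (f : ℕ → E3 → F) (t : ℝ) (x : E3) : F := ∑' s, t ^ s • f s x

/-- The coefficients of the time derivative. -/
noncomputable def shift (f : ℕ → E3 → F) (s : ℕ) (x : E3) : F := ((s : ℝ) + 1) • f (s + 1) x

/-- The coefficients of the spatial derivative. -/
noncomputable def dcoeff (f : ℕ → E3 → F) (s : ℕ) (x : E3) : E3 →L[ℝ] F := fderiv ℝ (f s) x

lemma succ_le_two_pow (s : ℕ) : (s : ℝ) + 1 ≤ 2 ^ s := by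
  exact_mod_cast (Nat.lt_two_pow_self (n := s))

lemma Geo.shift {M l : ℝ} {f : ℕ → E3 → F} (h : Geo M l f) : Geo (M * l) (2 * l) (shift f) := by
  have hM := h.nonneg
  have hl := h.rate
  have key : ∀ s : ℕ, ((s : ℝ) + 1) * (M * l ^ (s + 1)) ≤ M * l * (2 * l) ^ s := by
    intro s
    have := mul_le_mul_of_nonneg_right (succ_le_two_pow s)
      (by positivity : 0 ≤ M * l ^ (s + 1))
    calc _ ≤ _ := this
      _ = _ := by rw [mul_pow]; ring
  have hs : ∀ s : ℕ, ‖(s : ℝ) + 1‖ = s + 1 := fun s => Real.norm_of_nonneg (by positivity)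
  refine ⟨by positivity, by positivity, fun s => (h.contDiff _).const_smul _, fun s x => ?_,
    fun s x => ?_⟩
  · rw [PeriodicEuler.shift, norm_smul, hs]
    exact (mul_le_mul_of_nonneg_left (h.bound _ x) (by positivity)).trans (key s)
  · have : fderiv ℝ (PeriodicEuler.shift f s) x = ((s : ℝ) + 1) • fderiv ℝ (f (s + 1)) x :=
      fderiv_const_smul ((h.contDiff _).differentiable one_ne_zero x) _
    rw [this, norm_smul, hs]
    exact (mul_le_mul_of_nonneg_left (h.grad _ x) (by positivity)).trans (key s)

lemma norm_term_le {M l τ t : ℝ} {a : ℕ → F} (ha : ∀ s, ‖a s‖ ≤ M * l ^ s)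
    (ht : t ∈ Ioo (-τ) τ) (s : ℕ) : ‖t ^ s • a s‖ ≤ M * (l * τ) ^ s := by
  rw [norm_smul, norm_pow, Real.norm_eq_abs]
  have h1 : |t| ^ s ≤ τ ^ s := pow_le_pow_left₀ (abs_nonneg _) (abs_le.2 ⟨ht.1.le, ht.2.le⟩) s
  have h2 : 0 ≤ τ := (abs_nonneg t).trans (abs_le.2 ⟨ht.1.le, ht.2.le⟩)
  calc |t| ^ s * ‖a s‖ ≤ τ ^ s * (M * l ^ s) :=
        mul_le_mul h1 (ha s) (norm_nonneg _) (by positivity)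
    _ = _ := by rw [mul_pow]; ring

lemma summable_geo {M l τ : ℝ} (hl : 0 ≤ l) (hτ : 0 < τ) (h : l * τ < 1) :
    Summable fun s : ℕ => M * (l * τ) ^ s :=
  (summable_geometric_of_lt_one (by positivity) h).mul_left _

lemma summable_norm_term {M l τ t : ℝ} {a : ℕ → F} (hl : 0 ≤ l) (hlτ : l * τ < 1)
    (ha : ∀ s, ‖a s‖ ≤ M * l ^ s) (ht : t ∈ Ioo (-τ) τ) : Summable fun s => ‖t ^ s • a s‖ :=
  Summable.of_nonneg_of_le (fun _ => norm_nonneg _) (norm_term_le ha ht)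
    (summable_geo hl (by linarith [ht.1, ht.2]) hlτ)

lemma norm_tsum_le {M l τ t : ℝ} {a : ℕ → F} (hl : 0 ≤ l) (hlτ : l * τ < 1)
    (ha : ∀ s, ‖a s‖ ≤ M * l ^ s) (ht : t ∈ Ioo (-τ) τ) :
    ‖∑' s, t ^ s • a s‖ ≤ M * (1 - l * τ)⁻¹ := by
  have hτ : 0 < τ := by linarith [ht.1, ht.2]
  exact tsum_of_norm_bounded ((hasSum_geometric_of_lt_one (by positivity) hlτ).mul_left M)
    (norm_term_le ha ht)

variable [CompleteSpace F]

lemma hasSum_term {M l τ t : ℝ} {a : ℕ → F} (hl : 0 ≤ l) (hlτ : l * τ < 1)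
    (ha : ∀ s, ‖a s‖ ≤ M * l ^ s) (ht : t ∈ Ioo (-τ) τ) :
    HasSum (fun s => t ^ s • a s) (∑' s, t ^ s • a s) :=
  (summable_norm_term hl hlτ ha ht).of_norm.hasSum

lemma continuousOn_ser {M l τ : ℝ} {f : ℕ → E3 → F} (hl : 0 ≤ l) (hτ : 0 < τ) (hlτ : l * τ < 1)
    (hf : ∀ s, Continuous (f s)) (hb : ∀ s x, ‖f s x‖ ≤ M * l ^ s) :
    ContinuousOn (fun z : ℝ × E3 => ser f z.1 z.2) (Ioo (-τ) τ ×ˢ univ) :=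
  continuousOn_tsum (fun s => by have := hf s; fun_prop) (summable_geo hl hτ hlτ)
    fun s z hz => norm_term_le (fun s => hb s z.2) hz.1 s

/-- The total derivative of the sum of a power series in time. -/
noncomputable def dser (f : ℕ → E3 → F) (z : ℝ × E3) : ℝ × E3 →L[ℝ] F :=
  (ContinuousLinearMap.fst ℝ ℝ E3).smulRight (ser (shift f) z.1 z.2) +
    (ser (dcoeff f) z.1 z.2).comp (ContinuousLinearMap.snd ℝ ℝ E3)

lemma Geo.hasFDerivAt {M l τ : ℝ} {f : ℕ → E3 → F} (h : Geo M l f) (hτ : 0 < τ)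
    (hlτ : 2 * l * τ < 1) {z : ℝ × E3} (hz : z ∈ Ioo (-τ) τ ×ˢ (univ : Set E3)) :
    HasFDerivAt (fun z : ℝ × E3 => ser f z.1 z.2) (dser f z) z := by
  have hM := h.nonneg
  have hl := h.rate
  have hlτ' : l * τ < 1 := by nlinarith [mul_nonneg hl hτ.le]
  have hd : ∀ s x, DifferentiableAt ℝ (f s) x :=
    fun s x => (h.contDiff s).differentiable one_ne_zero x
  set f' : ℕ → ℝ × E3 → ℝ × E3 →L[ℝ] F := fun n z =>
    (ContinuousLinearMap.fst ℝ ℝ E3).smulRight (((n : ℝ) * z.1 ^ (n - 1)) • f n z.2) +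
      z.1 ^ n • (fderiv ℝ (f n) z.2).comp (ContinuousLinearMap.snd ℝ ℝ E3) with hf'
  have hsum : HasSum (fun n => f' n z) (dser f z) := by
    refine HasSum.add ?_ ?_
    · have h1 : HasSum (fun n : ℕ => ((n : ℝ) * z.1 ^ (n - 1)) • f n z.2)
          (ser (PeriodicEuler.shift f) z.1 z.2) := by
        have h2 : HasSum _ (ser (PeriodicEuler.shift f) z.1 z.2) :=
          hasSum_term h.shift.rate hlτ (fun s => h.shift.bound s z.2) hz.1
        rw [← hasSum_nat_add_iff' 1]
        simp only [Finset.range_one, Finset.sum_singleton, Nat.cast_zero, zero_mul, zero_smul,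
          sub_zero]
        convert h2 using 2 with n
        rw [PeriodicEuler.shift, smul_smul, mul_comm, Nat.add_sub_cancel, Nat.cast_succ]
      exact h1.mapL ((ContinuousLinearMap.smulRightL ℝ (ℝ × E3) F)
        (ContinuousLinearMap.fst ℝ ℝ E3))
    · have h2 := hasSum_term hl hlτ' (fun s => h.grad s z.2) hz.1
      exact h2.mapL ((ContinuousLinearMap.compL ℝ (ℝ × E3) E3 F).flip
        (ContinuousLinearMap.snd ℝ ℝ E3))
  rw [← hsum.tsum_eq]
  refine hasFDerivAt_tsum_of_isPreconnected (u := fun n : ℕ => M * l * (2 * l * τ) ^ (n - 1) +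
    M * (l * τ) ^ n) (f' := f') (s := Ioo (-τ) τ ×ˢ univ) (x₀ := z) ?_
    (isOpen_Ioo.prod isOpen_univ) (isPreconnected_Ioo.prod isPreconnected_univ)
    (fun n z _ => ?_) (fun n z hz => ?_) hz
    (hasSum_term hl hlτ' (fun s => h.bound s z.2) hz.1).summable hz
  · refine Summable.add ?_ (summable_geo hl hτ hlτ')
    refine (summable_nat_add_iff 1).1 ?_
    exact summable_geo (by positivity) hτ hlτ
  · have h1 : HasFDerivAt (fun z : ℝ × E3 => z.1 ^ n)
        (((n : ℝ) * z.1 ^ (n - 1)) • ContinuousLinearMap.fst ℝ ℝ E3) z := by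
      simpa using (hasFDerivAt_fst (𝕜 := ℝ) (p := z)).pow n
    have h2 : HasFDerivAt (fun z : ℝ × E3 => f n z.2)
        ((fderiv ℝ (f n) z.2).comp (ContinuousLinearMap.snd ℝ ℝ E3)) z :=
      (hd n z.2).hasFDerivAt.comp z hasFDerivAt_snd
    refine (h1.smul h2).congr_fderiv ?_
    ext <;> simp [hf', smul_smul]
  · refine (norm_add_le _ _).trans (add_le_add ?_ ?_)
    · rw [ContinuousLinearMap.norm_smulRight_apply]
      refine (mul_le_of_le_one_left (norm_nonneg _) (ContinuousLinearMap.norm_fst_le ℝ ℝ E3)).trans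
        ?_
      cases n with
      | zero => simpa using mul_nonneg hM hl
      | succ k =>
        have := norm_term_le (fun s => h.shift.bound s z.2) hz.1 k
        rwa [PeriodicEuler.shift, smul_smul, mul_comm, ← Nat.cast_succ] at this
    · have := norm_term_le (fun s => h.grad s z.2) hz.1 n
      rw [← ContinuousLinearMap.smul_comp]
      refine (ContinuousLinearMap.opNorm_comp_le _ _).trans ?_
      exact (mul_le_of_le_one_right (norm_nonneg _)
        (ContinuousLinearMap.norm_snd_le ℝ ℝ E3)).trans this

lemma Geo.contDiffOn {M l τ : ℝ} {f : ℕ → E3 → F} (h : Geo M l f) (hτ : 0 < τ)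
    (hlτ : 2 * l * τ < 1) :
    ContDiffOn ℝ 1 (fun z : ℝ × E3 => ser f z.1 z.2) (Ioo (-τ) τ ×ˢ univ) := by
  have hl := h.rate
  have hlτ' : l * τ < 1 := by nlinarith [mul_nonneg hl hτ.le]
  have hS : IsOpen (Ioo (-τ) τ ×ˢ (univ : Set E3)) := isOpen_Ioo.prod isOpen_univ
  rw [← zero_add (1 : WithTop ℕ∞), contDiffOn_succ_iff_fderiv_of_isOpen hS]
  refine ⟨fun z hz => (h.hasFDerivAt hτ hlτ hz).differentiableAt.differentiableWithinAt, by simp,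
    contDiffOn_zero.2 ?_⟩
  refine ContinuousOn.congr (f := dser f) ?_ fun z hz => (h.hasFDerivAt hτ hlτ hz).fderiv
  have h1 := continuousOn_ser h.shift.rate hτ hlτ (fun s => (h.shift.contDiff s).continuous)
    h.shift.bound
  have h2 := continuousOn_ser (f := dcoeff f) hl hτ hlτ'
    (fun s => (h.contDiff s).continuous_fderiv one_ne_zero) h.grad
  exact (((ContinuousLinearMap.smulRightL ℝ (ℝ × E3) F)
    (ContinuousLinearMap.fst ℝ ℝ E3)).continuous.comp_continuousOn h1).add
    (((ContinuousLinearMap.compL ℝ (ℝ × E3) E3 F).flip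
        (ContinuousLinearMap.snd ℝ ℝ E3)).continuous.comp_continuousOn h2)

lemma Geo.hasDerivAt {M l τ t : ℝ} {f : ℕ → E3 → F} (h : Geo M l f) (hτ : 0 < τ)
    (hlτ : 2 * l * τ < 1) (ht : t ∈ Ioo (-τ) τ) (x : E3) :
    HasDerivAt (fun t => ser f t x) (ser (PeriodicEuler.shift f) t x) t := by
  have h1 := (h.hasFDerivAt hτ hlτ (z := (t, x)) ⟨ht, mem_univ _⟩).comp_hasDerivAt t
    ((hasDerivAt_id t).prodMk (hasDerivAt_const t x))
  simpa [dser, Function.comp_def] using h1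

lemma Geo.hasFDerivAt_space {M l τ t : ℝ} {f : ℕ → E3 → F} (h : Geo M l f) (hτ : 0 < τ)
    (hlτ : 2 * l * τ < 1) (ht : t ∈ Ioo (-τ) τ) (x : E3) :
    HasFDerivAt (ser f t) (ser (dcoeff f) t x) x := by
  have h1 := (h.hasFDerivAt hτ hlτ (z := (t, x)) ⟨ht, mem_univ _⟩).comp x
    (hasFDerivAt_prodMk_right t x)
  refine h1.congr_fderiv ?_
  ext v
  simp [dser]

end series

/-! ### From a flow map to an Euler flow -/

/-- A particle map `X` with velocity `V` and acceleration `W` in Lagrangian coordinates, during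
the time interval `(-τ, τ)`: it preserves volumes, its gradient is close to the identity, and
`(∇X)ᵀ W = ∇Q`. -/
structure FlowMap (τ : ℝ) (X V W : ℝ → E3 → E3) (Q : ℝ → E3 → ℝ) : Prop where
  contDiffOn : ContDiffOn ℝ 1 (fun z : ℝ × E3 => X z.1 z.2) (Ioo (-τ) τ ×ˢ univ)
  contDiffOn_vel : ContDiffOn ℝ 1 (fun z : ℝ × E3 => V z.1 z.2) (Ioo (-τ) τ ×ˢ univ)
  hasDerivAt : ∀ t ∈ Ioo (-τ) τ, ∀ a, HasDerivAt (fun s => X s a) (V t a) t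
  hasDerivAt_vel : ∀ t ∈ Ioo (-τ) τ, ∀ a, HasDerivAt (fun s => V s a) (W t a) t
  hasDerivAt_grad : ∀ t ∈ Ioo (-τ) τ, ∀ a,
    HasDerivAt (fun s => fderiv ℝ (X s) a) (fderiv ℝ (V t) a) t
  near : ∀ t ∈ Ioo (-τ) τ, ∀ a, ‖fderiv ℝ (X t) a - ContinuousLinearMap.id ℝ E3‖ ≤ 1 / 2
  det : ∀ t ∈ Ioo (-τ) τ, ∀ a, jac (cmp (X t) 0) (cmp (X t) 1) (cmp (X t) 2) a = 1
  contDiff_pot : ∀ t ∈ Ioo (-τ) τ, ContDiff ℝ 1 (Q t)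
  grad_pot : ∀ t ∈ Ioo (-τ) τ, ∀ a h,
    fderiv ℝ (Q t) a h = inner ℝ (W t a) (fderiv ℝ (X t) a h)
  shift : ∀ t ∈ Ioo (-τ) τ, ∀ i a, X t (a + (2 * Real.pi) • e i) = X t a + (2 * Real.pi) • e i
  periodic_vel : ∀ t ∈ Ioo (-τ) τ, SpacePeriodic (V t)
  periodic_pot : ∀ t ∈ Ioo (-τ) τ, SpacePeriodic (Q t)

section slices

variable {F : Type} [NormedAddCommGroup F] [NormedSpace ℝ F] {J : Set ℝ} {f : ℝ → E3 → F}

/-- A jointly `C¹` field is `C¹` in space at each time. -/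
lemma contDiff_slice (h : ContDiffOn ℝ 1 (fun z : ℝ × E3 => f z.1 z.2) (J ×ˢ univ)) {t : ℝ}
    (ht : t ∈ J) : ContDiff ℝ 1 (f t) := by
  rw [← contDiffOn_univ]
  exact h.comp (f := fun x : E3 => (t, x)) (by fun_prop) fun x _ => ⟨ht, mem_univ _⟩

lemma differentiableAt_joint (hJ : IsOpen J)
    (h : ContDiffOn ℝ 1 (fun z : ℝ × E3 => f z.1 z.2) (J ×ˢ univ)) {t : ℝ} (ht : t ∈ J) (x : E3) :
    DifferentiableAt ℝ (fun z : ℝ × E3 => f z.1 z.2) (t, x) :=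
  (h.contDiffAt ((hJ.prod isOpen_univ).mem_nhds ⟨ht, mem_univ _⟩)).differentiableAt one_ne_zero

end slices

lemma norm_le_of_near {B : E3 →L[ℝ] E3} (hB : ‖B - ContinuousLinearMap.id ℝ E3‖ ≤ 1 / 2)
    {F : Type} [NormedAddCommGroup F] [NormedSpace ℝ F] (T : E3 →L[ℝ] F) :
    ‖T‖ ≤ 2 * ‖T.comp B‖ := by
  have h1 : T = T.comp B - T.comp (B - ContinuousLinearMap.id ℝ E3) := by
    rw [ContinuousLinearMap.comp_sub, ContinuousLinearMap.comp_id]; abel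
  have h2 : ‖T‖ ≤ ‖T.comp B‖ + ‖T‖ * (1 / 2) := by
    conv_lhs => rw [h1]
    exact (norm_sub_le _ _).trans (add_le_add le_rfl
      ((ContinuousLinearMap.opNorm_comp_le _ _).trans
        (mul_le_mul_of_nonneg_left hB (norm_nonneg _))))
  linarith

lemma bijective_of_near {B : E3 →L[ℝ] E3} (hB : ‖B - ContinuousLinearMap.id ℝ E3‖ ≤ 1 / 2) :
    Function.Bijective B := by
  have hinj : Function.Injective B := by
    refine (injective_iff_map_eq_zero B).2 fun x hx => ?_
    have h1 := (B - ContinuousLinearMap.id ℝ E3).le_of_opNorm_le hB x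
    simp only [sub_apply, hx, ContinuousLinearMap.id_apply, zero_sub,
      norm_neg] at h1
    have := norm_nonneg x
    exact norm_eq_zero.1 (by linarith)
  exact ⟨hinj, (LinearMap.injective_iff_surjective (f := (B : E3 →ₗ[ℝ] E3))).1 hinj⟩

namespace FlowMap

variable {τ : ℝ} {X V W : ℝ → E3 → E3} {Q : ℝ → E3 → ℝ}

lemma differentiable (h : FlowMap τ X V W Q) {t : ℝ} (ht : t ∈ Ioo (-τ) τ) :
    Differentiable ℝ (X t) := (contDiff_slice h.contDiffOn ht).differentiable one_ne_zero

lemma norm_sub_sub_le (h : FlowMap τ X V W Q) {t : ℝ} (ht : t ∈ Ioo (-τ) τ) (a b : E3) :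
    ‖(X t a - a) - (X t b - b)‖ ≤ 1 / 2 * ‖a - b‖ :=
  Convex.norm_image_sub_le_of_norm_hasFDerivWithin_le (s := univ) (f := fun a => X t a - a)
    (f' := fun a => fderiv ℝ (X t) a - ContinuousLinearMap.id ℝ E3)
    (fun x _ => ((h.differentiable ht x).hasFDerivAt.sub (hasFDerivAt_id x)).hasFDerivWithinAt)
    (fun x _ => h.near t ht x) convex_univ (mem_univ b) (mem_univ a)

lemma norm_sub_le (h : FlowMap τ X V W Q) {t : ℝ} (ht : t ∈ Ioo (-τ) τ) (a b : E3) :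
    ‖a - b‖ ≤ 2 * ‖X t a - X t b‖ := by
  have h1 := h.norm_sub_sub_le ht a b
  have h2 : ‖a - b‖ ≤ ‖X t a - X t b‖ + ‖(X t a - a) - (X t b - b)‖ := by
    have : a - b = (X t a - X t b) - ((X t a - a) - (X t b - b)) := by abel
    conv_lhs => rw [this]
    exact _root_.norm_sub_le _ _
  linarith

lemma bijective (h : FlowMap τ X V W Q) {t : ℝ} (ht : t ∈ Ioo (-τ) τ) :
    Function.Bijective (X t) := by
  refine ⟨fun a b hab => ?_, fun y => ?_⟩
  · have := h.norm_sub_le ht a b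
    rw [hab, sub_self, norm_zero, mul_zero] at this
    exact sub_eq_zero.1 (norm_le_zero_iff.1 this)
  -- solve `X t a = y` as a fixed point problem for the contraction `a ↦ y - (X t a - a)`
  · have hc : ContractingWith (1 / 2) (fun a => y - (X t a - a)) := by
      refine ⟨by rw [← NNReal.coe_lt_coe]; norm_num, LipschitzWith.of_dist_le_mul fun a b => ?_⟩
      have := h.norm_sub_sub_le ht a b
      rw [dist_eq_norm, dist_eq_norm, sub_sub_sub_cancel_left, ← norm_neg, neg_sub]
      simpa using this
    refine ⟨hc.fixedPoint, ?_⟩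
    have : y - (X t hc.fixedPoint - hc.fixedPoint) = hc.fixedPoint := hc.fixedPoint_isFixedPt
    rw [sub_sub_eq_add_sub, sub_eq_iff_eq_add, add_comm, add_left_cancel_iff] at this
    exact this.symm

/-- The inverse of a flow map is jointly `C¹`. -/
lemma exists_inverse (h : FlowMap τ X V W Q) : ∃ Y : ℝ → E3 → E3,
    (∀ t ∈ Ioo (-τ) τ, ∀ y, X t (Y t y) = y) ∧ (∀ t ∈ Ioo (-τ) τ, ∀ a, Y t (X t a) = a) ∧
      ContDiffOn ℝ 1 (fun z : ℝ × E3 => Y z.1 z.2) (Ioo (-τ) τ ×ˢ univ) := by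
  set Y : ℝ → E3 → E3 := fun t => Function.invFun (X t) with hYdef
  have hr : ∀ t ∈ Ioo (-τ) τ, ∀ y, X t (Y t y) = y := fun t ht y =>
    Function.invFun_eq ((h.bijective ht).surjective y)
  have hl : ∀ t ∈ Ioo (-τ) τ, ∀ a, Y t (X t a) = a := fun t ht a =>
    (h.bijective ht).injective (hr t ht _)
  have hS : IsOpen (Ioo (-τ) τ ×ˢ (univ : Set E3)) := isOpen_Ioo.prod isOpen_univ
  have hYc : ContinuousOn (fun z : ℝ × E3 => Y z.1 z.2) (Ioo (-τ) τ ×ˢ univ) := by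
    rintro ⟨t, y⟩ hz
    refine tendsto_iff_norm_sub_tendsto_zero.2 ?_
    have h1 : ContinuousWithinAt (fun z : ℝ × E3 => 2 * ‖z.2 - X z.1 (Y t y)‖)
        (Ioo (-τ) τ ×ˢ univ) (t, y) := by
      have : ContinuousOn (fun z : ℝ × E3 => X z.1 (Y t y)) (Ioo (-τ) τ ×ˢ univ) :=
        h.contDiffOn.continuousOn.comp (f := fun z : ℝ × E3 => (z.1, Y t y)) (by fun_prop)
          fun z hz => ⟨hz.1, mem_univ _⟩
      exact (continuousWithinAt_snd.sub (this _ hz)).norm.const_mul 2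
    have h2 : Tendsto (fun z : ℝ × E3 => 2 * ‖z.2 - X z.1 (Y t y)‖)
        (𝓝[Ioo (-τ) τ ×ˢ univ] (t, y)) (𝓝 0) := by
      have := h1.tendsto
      simpa [hr t hz.1 y] using this
    refine squeeze_zero' (Eventually.of_forall fun _ => norm_nonneg _) ?_ h2
    filter_upwards [self_mem_nhdsWithin] with z hz'
    have := h.norm_sub_le hz'.1 (Y z.1 z.2) (Y t y)
    rwa [hr z.1 hz'.1] at this
  let φ : OpenPartialHomeomorph (ℝ × E3) (ℝ × E3) :=
    { toFun := fun z => (z.1, X z.1 z.2)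
      invFun := fun z => (z.1, Y z.1 z.2)
      source := Ioo (-τ) τ ×ˢ univ
      target := Ioo (-τ) τ ×ˢ univ
      map_source' := fun z hz => ⟨hz.1, mem_univ _⟩
      map_target' := fun z hz => ⟨hz.1, mem_univ _⟩
      left_inv' := fun z hz => Prod.ext rfl (hl z.1 hz.1 z.2)
      right_inv' := fun z hz => Prod.ext rfl (hr z.1 hz.1 z.2)
      open_source := hS
      open_target := hS
      continuousOn_toFun := continuousOn_fst.prodMk h.contDiffOn.continuousOn
      continuousOn_invFun := continuousOn_fst.prodMk hYc }
  refine ⟨Y, hr, hl, fun z hz => ContDiffAt.contDiffWithinAt ?_⟩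
  set w : ℝ × E3 := (z.1, Y z.1 z.2) with hw
  have hws : w ∈ Ioo (-τ) τ ×ˢ (univ : Set E3) := ⟨hz.1, mem_univ _⟩
  have hd := (differentiableAt_joint isOpen_Ioo h.contDiffOn hz.1 (Y z.1 z.2)).hasFDerivAt
  set D := fderiv ℝ (fun z : ℝ × E3 => X z.1 z.2) (z.1, Y z.1 z.2) with hD
  have hD2 : ∀ b, D (0, b) = fderiv ℝ (X z.1) (Y z.1 z.2) b := fun b => by
    have := hd.comp (Y z.1 z.2) (hasFDerivAt_prodMk_right z.1 (Y z.1 z.2))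
    have h3 : fderiv ℝ (X z.1) (Y z.1 z.2) = _ := this.fderiv
    rw [h3]; rfl
  set D' : ℝ × E3 →L[ℝ] ℝ × E3 := (ContinuousLinearMap.fst ℝ ℝ E3).prod D with hD'
  have hinj : Function.Injective D' := by
    refine (injective_iff_map_eq_zero D').2 fun x hx => ?_
    have h1 : x.1 = 0 := congrArg Prod.fst hx
    have h2 : D x = 0 := congrArg Prod.snd hx
    have h3 : x = (0, x.2) := Prod.ext h1 rfl
    rw [h3, hD2] at h2
    have := (bijective_of_near (h.near z.1 hz.1 (Y z.1 z.2))).injective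
      (h2.trans (map_zero _).symm)
    exact Prod.ext h1 this
  let E : (ℝ × E3) ≃L[ℝ] (ℝ × E3) :=
    (LinearEquiv.ofInjectiveEndo (D' : ℝ × E3 →ₗ[ℝ] ℝ × E3) hinj).toContinuousLinearEquiv
  have hE : (E : ℝ × E3 →L[ℝ] ℝ × E3) = D' := by ext <;> rfl
  have hsymm : ContDiffAt ℝ 1 φ.symm z := by
    refine φ.contDiffAt_symm (f₀' := E) ⟨hz.1, mem_univ _⟩ ?_ ?_
    · rw [hE]
      exact hasFDerivAt_fst.prodMk hd
    · exact contDiffAt_fst.prodMk (h.contDiffOn.contDiffAt (hS.mem_nhds hws))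
  exact contDiffAt_snd.comp z hsymm

/-- The partial derivatives of a composition. -/
lemma pd_cmp_of_comp {L B G : E3 →L[ℝ] E3} (h : L.comp B = G) (i j : Fin 3) :
    G (e i) j = ∑ k, B (e i) k * L (e k) j := by
  rw [← h, ContinuousLinearMap.comp_apply]
  conv_lhs => rw [sum_smul_e (B (e i)), map_sum]
  simp [Fin.sum_univ_three]

/-- **From Lagrange to Euler.** The velocity field of a volume preserving flow map whose
acceleration satisfies `(∇X)ᵀ W = ∇Q` is an Euler flow. -/
theorem exists_isEulerFlow (h : FlowMap τ X V W Q) : ∃ u : ℝ → E3 → E3,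
    IsEulerFlow (Ioo (-τ) τ) u ∧ ∀ t ∈ Ioo (-τ) τ, ∀ a, u t (X t a) = V t a := by
  obtain ⟨Y, hr, hl, hY⟩ := h.exists_inverse
  have hYd : ∀ t ∈ Ioo (-τ) τ, ContDiff ℝ 1 (Y t) := fun t ht => contDiff_slice hY ht
  have hYp : ∀ t ∈ Ioo (-τ) τ, ∀ i y, Y t (y + (2 * Real.pi) • e i) =
      Y t y + (2 * Real.pi) • e i := by
    intro t ht i y
    apply (h.bijective ht).injective
    rw [hr t ht, h.shift t ht, hr t ht]
  set u : ℝ → E3 → E3 := fun t y => V t (Y t y) with hu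
  have huX : ∀ t ∈ Ioo (-τ) τ, ∀ a, u t (X t a) = V t a := fun t ht a => by
    rw [hu]; simp only [hl t ht]
  have huc : ContDiffOn ℝ 1 (fun z : ℝ × E3 => u z.1 z.2) (Ioo (-τ) τ ×ˢ univ) :=
    h.contDiffOn_vel.comp (contDiffOn_fst.prodMk hY) fun z hz => ⟨hz.1, mem_univ _⟩
  have hud : ∀ t ∈ Ioo (-τ) τ, Differentiable ℝ (u t) := fun t ht =>
    (contDiff_slice huc ht).differentiable one_ne_zero
  have hcomp : ∀ t ∈ Ioo (-τ) τ, ∀ a,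
      (fderiv ℝ (u t) (X t a)).comp (fderiv ℝ (X t) a) = fderiv ℝ (V t) a := by
    intro t ht a
    rw [← fderiv_comp a (hud t ht _) (h.differentiable ht a)]
    congr 1
    funext b
    exact huX t ht b
  refine ⟨u, ⟨huc, fun t ht i y => ?_, fun t ht y => ?_, fun t y => -Q t (Y t y),
    fun t ht => ⟨?_, fun i y => ?_, fun y => ?_⟩⟩, huX⟩
  · rw [hu]; simp only [hYp t ht, h.periodic_vel t ht i]
  · -- the time derivative of `det ∇X = 1` is `div u * det ∇X`
    obtain ⟨a, rfl⟩ := (h.bijective ht).surjective y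
    have hXd : ∀ s ∈ Ioo (-τ) τ, ∀ i j,
        pd i (cmp (X s) j) a = fderiv ℝ (X s) a (e i) j := fun s hs i j =>
      pd_cmp (h.differentiable hs a) i j
    have hB : ∀ i j, HasDerivAt (fun s => fderiv ℝ (X s) a (e i) j)
        (fderiv ℝ (V t) a (e i) j) t := by
      intro i j
      have h1 := (h.hasDerivAt_grad t ht a).clm_apply (hasDerivAt_const t (e i))
      have h2 := ((EuclideanSpace.proj j : E3 →L[ℝ] ℝ).hasFDerivAt).comp_hasDerivAt t h1
      simpa [Function.comp_def] using h2
    have hdet := h.det t ht a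
    simp only [jac, hXd t ht] at hdet
    have hj : HasDerivAt (fun s => jac (cmp (X s) 0) (cmp (X s) 1) (cmp (X s) 2) a) 0 t := by
      refine (hasDerivAt_const t (1 : ℝ)).congr_of_eventuallyEq ?_
      filter_upwards [isOpen_Ioo.mem_nhds ht] with s hs
      exact h.det s hs a
    have hj' : HasDerivAt (fun s => jac (cmp (X s) 0) (cmp (X s) 1) (cmp (X s) 2) a) _ t :=
      (((hB 0 0).mul (((hB 1 1).mul (hB 2 2)).sub ((hB 2 1).mul (hB 1 2)))).add
        ((hB 1 0).mul (((hB 2 1).mul (hB 0 2)).sub ((hB 0 1).mul (hB 2 2))))).add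
        ((hB 2 0).mul (((hB 0 1).mul (hB 1 2)).sub ((hB 1 1).mul (hB 0 2))))
        |>.congr_of_eventuallyEq (by
          filter_upwards [isOpen_Ioo.mem_nhds ht] with s hs
          simp only [jac, hXd s hs]; rfl)
    have h0 := hj.unique hj'
    simp only [Pi.mul_apply, Pi.sub_apply, pd_cmp_of_comp (hcomp t ht a),
      Fin.sum_univ_three] at h0
    simp only [divergence, partialDeriv, Fin.sum_univ_three]
    rw [← mul_one (_ + _), ← hdet]
    rw [eq_comm, h0]
    ring
  · exact ((h.contDiff_pot t ht).comp (hYd t ht)).neg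
  · simp only [hYp t ht, h.periodic_pot t ht i]
  · obtain ⟨a, rfl⟩ := (h.bijective ht).surjective y
    -- the pressure gradient at the position of the particle is minus the acceleration
    have hgrad : gradient (fun y => -Q t (Y t y)) (X t a) = -W t a := by
      have h1 : DifferentiableAt ℝ (fun y => Q t (Y t y)) (X t a) :=
        ((h.contDiff_pot t ht).comp (hYd t ht)).differentiable one_ne_zero _
      have h2 : (fderiv ℝ (fun y => Q t (Y t y)) (X t a)).comp (fderiv ℝ (X t) a) =
          fderiv ℝ (Q t) a := by
        rw [← fderiv_comp a h1 (h.differentiable ht a)]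
        congr 1
        funext b
        simp only [Function.comp_apply, hl t ht]
      have h3 : HasGradientAt (fun y => -Q t (Y t y)) (-W t a) (X t a) := by
        rw [hasGradientAt_iff_hasFDerivAt, map_neg]
        refine HasFDerivAt.neg (h1.hasFDerivAt.congr_fderiv ?_)
        ext k
        obtain ⟨k, rfl⟩ := (bijective_of_near (h.near t ht a)).surjective k
        rw [InnerProductSpace.toDual_apply_apply, ← h.grad_pot t ht a k, ← h2]
        rfl
      exact h3.gradient
    have hD := (differentiableAt_joint isOpen_Ioo huc ht (X t a)).hasFDerivAt
    set D := fderiv ℝ (fun z : ℝ × E3 => u z.1 z.2) (t, X t a) with hDdef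
    have h1 : HasDerivAt (fun s => u s (X t a)) (D (1, 0)) t :=
      HasFDerivAt.comp_hasDerivAt (f := fun s => (s, X t a)) t hD
        ((hasDerivAt_id t).prodMk (hasDerivAt_const t (X t a)))
    have h2 : ∀ b, D (0, b) = fderiv ℝ (u t) (X t a) b := fun b => by
      have h3 : fderiv ℝ (u t) (X t a) = _ :=
        (hD.comp (X t a) (hasFDerivAt_prodMk_right t (X t a))).fderiv
      rw [h3]; rfl
    have h3 : HasDerivAt (fun s => u s (X s a)) (D (1, V t a)) t :=
      HasFDerivAt.comp_hasDerivAt (f := fun s => (s, X s a)) t hD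
        ((hasDerivAt_id t).prodMk (h.hasDerivAt t ht a))
    have h4 : D (1, V t a) = W t a := by
      refine h3.unique ((h.hasDerivAt_vel t ht a).congr_of_eventuallyEq ?_)
      filter_upwards [isOpen_Ioo.mem_nhds ht] with s hs
      exact huX s hs a
    have h5 : D (1, 0) = W t a - fderiv ℝ (u t) (X t a) (V t a) := by
      rw [← h4, ← h2, ← map_sub]; simp
    rw [hgrad, huX t ht a, sub_neg_eq_add, neg_add_eq_sub, ← h5]
    exact h1.hasDerivWithinAt

/-- The velocity of a flow map has a Hölder continuous vorticity if the gradients of the flow map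
and of its velocity in Lagrangian coordinates are Hölder continuous. -/
lemma isHolder_curl (h : FlowMap τ X V W Q) {u : ℝ → E3 → E3} {t γ C : ℝ} (ht : t ∈ Ioo (-τ) τ)
    (hu : Differentiable ℝ (u t)) (huX : ∀ a, u t (X t a) = V t a) (hγ : 0 < γ) (hC : 0 ≤ C)
    (hX : ∀ a b, ‖fderiv ℝ (X t) a - fderiv ℝ (X t) b‖ ≤ C * ‖a - b‖ ^ γ)
    (hV : ∀ a b, ‖fderiv ℝ (V t) a - fderiv ℝ (V t) b‖ ≤ C * ‖a - b‖ ^ γ)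
    (hV' : ∀ a, ‖fderiv ℝ (V t) a‖ ≤ C) : IsHolder (curl (u t)) := by
  have hcomp : ∀ a, (fderiv ℝ (u t) (X t a)).comp (fderiv ℝ (X t) a) = fderiv ℝ (V t) a := by
    intro a
    rw [← fderiv_comp a (hu _) (h.differentiable ht a)]
    congr 1
    funext b
    exact huX b
  refine ⟨γ.toNNReal, Real.toNNReal_pos.2 hγ, memHolder_iff.2
    ⟨6 * (2 * (C + 2 * C * C)) * 2 ^ γ, fun x y => ?_⟩⟩
  rw [Real.coe_toNNReal _ hγ.le]
  obtain ⟨a, rfl⟩ := (h.bijective ht).surjective x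
  obtain ⟨b, rfl⟩ := (h.bijective ht).surjective y
  set L := fderiv ℝ (u t) (X t a) with hL
  set L' := fderiv ℝ (u t) (X t b) with hL'
  have h1 : ‖L'‖ ≤ 2 * C := by
    have := norm_le_of_near (h.near t ht b) L'
    rw [hcomp b] at this
    linarith [hV' b]
  have h2 : ‖L - L'‖ ≤ 2 * (C + 2 * C * C) * ‖a - b‖ ^ γ := by
    have h3 : (L - L').comp (fderiv ℝ (X t) a) = (fderiv ℝ (V t) a - fderiv ℝ (V t) b) -
        L'.comp (fderiv ℝ (X t) a - fderiv ℝ (X t) b) := by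
      rw [ContinuousLinearMap.sub_comp, ContinuousLinearMap.comp_sub, hcomp a, hcomp b]; abel
    have h4 := norm_le_of_near (h.near t ht a) (L - L')
    rw [h3] at h4
    have h5 : ‖L'.comp (fderiv ℝ (X t) a - fderiv ℝ (X t) b)‖ ≤ 2 * C * (C * ‖a - b‖ ^ γ) :=
      (ContinuousLinearMap.opNorm_comp_le _ _).trans
        (mul_le_mul h1 (hX a b) (norm_nonneg _) (by positivity))
    have h6 := _root_.norm_sub_le (fderiv ℝ (V t) a - fderiv ℝ (V t) b)
      (L'.comp (fderiv ℝ (X t) a - fderiv ℝ (X t) b))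
    linarith [hV a b]
  have h7 : ‖a - b‖ ^ γ ≤ 2 ^ γ * ‖X t a - X t b‖ ^ γ := by
    rw [← Real.mul_rpow (by norm_num) (norm_nonneg _)]
    exact Real.rpow_le_rpow (norm_nonneg _) (h.norm_sub_le ht a b) hγ.le
  calc ‖curl (u t) (X t a) - curl (u t) (X t b)‖ ≤ 6 * ‖L - L'‖ := norm_curl_sub_le _ _ _
    _ ≤ 6 * (2 * (C + 2 * C * C) * (2 ^ γ * ‖X t a - X t b‖ ^ γ)) := by
        refine mul_le_mul_of_nonneg_left (h2.trans ?_) (by norm_num)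
        exact mul_le_mul_of_nonneg_left h7 (by positivity)
    _ = _ := by ring

end FlowMap

/-! ### Absolutely convergent scalar power series -/

/-- The power series with coefficients `a` converges absolutely at `t`, with sum `A`. -/
structure PowSum (t : ℝ) (a : ℕ → ℝ) (A : ℝ) : Prop where
  abs : Summable fun s => ‖t ^ s * a s‖
  hasSum : HasSum (fun s => t ^ s * a s) A

namespace PowSum

variable {t A B : ℝ} {a b : ℕ → ℝ}

lemma add (ha : PowSum t a A) (hb : PowSum t b B) : PowSum t (fun s => a s + b s) (A + B) := by
  refine ⟨Summable.of_nonneg_of_le (fun _ => norm_nonneg _) (fun s => ?_) (ha.abs.add hb.abs), ?_⟩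
  · rw [mul_add]; exact norm_add_le _ _
  · simpa only [mul_add] using ha.hasSum.add hb.hasSum

lemma neg (ha : PowSum t a A) : PowSum t (fun s => -a s) (-A) :=
  ⟨by simpa only [mul_neg, norm_neg] using ha.abs, by simpa only [mul_neg] using ha.hasSum.neg⟩

lemma sub (ha : PowSum t a A) (hb : PowSum t b B) : PowSum t (fun s => a s - b s) (A - B) := by
  simpa only [sub_eq_add_neg] using ha.add hb.neg

/-- The Cauchy product. -/
lemma mul (ha : PowSum t a A) (hb : PowSum t b B) :
    PowSum t (fun s => ∑ p ∈ antidiagonal s, a p.1 * b p.2) (A * B) := by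
  have key : ∀ s, t ^ s * ∑ p ∈ antidiagonal s, a p.1 * b p.2 =
      ∑ p ∈ antidiagonal s, (t ^ p.1 * a p.1) * (t ^ p.2 * b p.2) := by
    intro s
    rw [Finset.mul_sum]
    refine Finset.sum_congr rfl fun p hp => ?_
    rw [← Finset.HasAntidiagonal.mem_antidiagonal.1 hp, pow_add]
    ring
  have habs := summable_norm_sum_mul_antidiagonal_of_summable_norm ha.abs hb.abs
  refine ⟨by simpa only [key] using habs, ?_⟩
  simp only [key]
  rw [← ha.hasSum.tsum_eq, ← hb.hasSum.tsum_eq,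
    tsum_mul_tsum_eq_tsum_sum_antidiagonal_of_summable_norm ha.abs hb.abs]
  exact habs.of_norm.hasSum

lemma congr (ha : PowSum t a A) (h : ∀ s, a s = b s) : PowSum t b A := by
  rwa [← funext h]

lemma sum {a : Fin 3 → ℕ → ℝ} {A : Fin 3 → ℝ} (h : ∀ k, PowSum t (a k) (A k)) :
    PowSum t (fun s => ∑ k, a k s) (∑ k, A k) := by
  simp only [Fin.sum_univ_three]
  exact ((h 0).add (h 1)).add (h 2)

lemma unique (ha : PowSum t a A) (hb : PowSum t a B) : A = B := ha.hasSum.unique hb.hasSum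

end PowSum

/-- A continuous linear functional maps a vector valued power series to a scalar one. -/
lemma powSum_clm {F : Type} [NormedAddCommGroup F] [NormedSpace ℝ F] [CompleteSpace F]
    {M l τ t : ℝ} {a : ℕ → F} (hl : 0 ≤ l) (hlτ : l * τ < 1) (ha : ∀ s, ‖a s‖ ≤ M * l ^ s)
    (ht : t ∈ Ioo (-τ) τ) (L : F →L[ℝ] ℝ) :
    PowSum t (fun s => L (a s)) (L (∑' s, t ^ s • a s)) := by
  have h1 : ∀ s, ‖L (a s)‖ ≤ ‖L‖ * M * l ^ s := fun s => (L.le_opNorm _).trans (by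
    rw [mul_assoc]; exact mul_le_mul_of_nonneg_left (ha s) (norm_nonneg _))
  refine ⟨summable_norm_term hl hlτ h1 ht, ?_⟩
  simpa using (hasSum_term hl hlτ ha ht).mapL L

/-! ### The flow map defined by the Taylor coefficients -/

lemma dcoeff_shift {M l : ℝ} {F : Type} [NormedAddCommGroup F] [NormedSpace ℝ F]
    {f : ℕ → E3 → F} (h : Geo M l f) : dcoeff (shift f) = shift (dcoeff f) := by
  funext s x
  exact fderiv_const_smul ((h.contDiff _).differentiable one_ne_zero x) _

lemma CoeffBound.norm_fderiv_pot_le {γ B : ℝ} {y : (E3 → E3) × (E3 → ℝ)} (h : CoeffBound γ B y)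
    (x : E3) : ‖fderiv ℝ y.2 x‖ ≤ 3 * B := by
  rw [clm_eq_covec (fderiv ℝ y.2 x)]
  refine (norm_covec_le _).trans ((Finset.sum_le_sum fun i _ => h.grad i x).trans_eq ?_)
  simp

section flow

variable {γ l : ℝ} {ξ : ℕ → E3 → E3} {q : ℕ → E3 → ℝ}

lemma geo_disp (hl : 0 < l) (hb : ∀ s, CoeffBound γ (l ^ s) (ξ s, q s)) : Geo 9 l ξ where
  nonneg := by norm_num
  rate := hl.le
  contDiff s := (hb s).disp.contDiff
  bound s x := by
    refine (norm_le_sum_abs _).trans ((Finset.sum_le_sum fun j _ => (hb s).disp.bound j x).trans ?_)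
    have : 0 < l ^ s := by positivity
    simp only [Finset.sum_const, Finset.card_univ, Fintype.card_fin, nsmul_eq_mul]
    push_cast
    linarith
  grad s x := (hb s).disp.norm_fderiv_le x

lemma geo_pot (hl : 0 < l) (hb : ∀ s, CoeffBound γ (l ^ s) (ξ s, q s)) : Geo 9 l q where
  nonneg := by norm_num
  rate := hl.le
  contDiff s := (hb s).contDiff
  bound s x := by
    have : 0 < l ^ s := by positivity
    exact ((hb s).bound x).trans (by linarith)
  grad s x := by
    have : 0 < l ^ s := by positivity
    exact (hb s).norm_fderiv_pot_le x |>.trans (by linarith)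

lemma periodic_ser {F : Type} [NormedAddCommGroup F] [NormedSpace ℝ F] {f : ℕ → E3 → F}
    (h : ∀ s, SpacePeriodic (f s)) (t : ℝ) : SpacePeriodic (ser f t) := fun i x => by
  simp only [ser, h _ i x]

lemma periodic_shift {F : Type} [NormedAddCommGroup F] [NormedSpace ℝ F] {f : ℕ → E3 → F}
    (h : ∀ s, SpacePeriodic (f s)) (s : ℕ) : SpacePeriodic (shift f s) := fun i x => by
  simp only [shift, h _ i x]

/-- The equation for the acceleration coefficients, with the factor `t ^ 2` removed. -/
lemma accel_coeff (hE : ∀ s, CoeffEq s ξ (ξ s, q s)) (s : ℕ) (j : Fin 3) (x : E3) :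
    cmp (shift (shift ξ) s) j x + ∑ k, ∑ p ∈ antidiagonal s,
      cmp (shift (shift ξ) p.1) k x * pd j (cmp (ξ p.2) k) x =
      ((s : ℝ) + 1) * ((s : ℝ) + 2) * pd j (q (s + 2)) x := by
  have h := (hE (s + 2)).1 j x
  simp only [accelSum] at h
  rw [Finset.Nat.sum_antidiagonal_succ, Finset.Nat.sum_antidiagonal_succ] at h
  simp only [Nat.cast_zero, zero_mul, zero_add, Nat.cast_one, sub_self, mul_zero,
    Nat.cast_add, Nat.cast_ofNat] at h
  rw [Finset.sum_comm]
  simp only [cmp, shift, PiLp.smul_apply, smul_eq_mul, Nat.cast_add, Nat.cast_one] at h ⊢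
  rw [show ((s : ℝ) + 2) * ((s : ℝ) + 2 - 1) = ((s : ℝ) + 1) * ((s : ℝ) + 2) by ring] at h
  rw [← h]
  congr 1
  · ring
  · refine Finset.sum_congr rfl fun p _ => ?_
    rw [Finset.mul_sum]
    refine Finset.sum_congr rfl fun k _ => ?_
    ring

/-- Cauchy products turn the divergence equations into an equation for the gradient of the
displacement: its trace, the sum of its principal minors and its determinant add up to zero. -/
lemma sum_minors_eq_zero {t : ℝ} {a : E3} {d : Fin 3 → Fin 3 → ℝ}
    (hD : ∀ i j, PowSum t (fun s => pd i (cmp (ξ s) j) a) (d i j))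
    (hE : ∀ s, ∑ j, pd j (cmp (ξ s) j) a + (minorSum ξ s a + detSum ξ s a) = 0) :
    ∑ j, d j j + (∑ c : Fin 3, (d c c * d (c + 1) (c + 1) - d (c + 1) c * d c (c + 1)) +
      (d 0 0 * d 1 1 * d 2 2 - d 0 0 * d 2 1 * d 1 2 + (d 1 0 * d 2 1 * d 0 2 -
          d 1 0 * d 0 1 * d 2 2) + (d 2 0 * d 0 1 * d 1 2 - d 2 0 * d 1 1 * d 0 2))) = 0 := by
  have htr := PowSum.sum fun j => hD j j
  have hmin := PowSum.sum fun c : Fin 3 => ((hD c c).mul (hD (c + 1) (c + 1))).sub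
    ((hD (c + 1) c).mul (hD c (c + 1)))
  have hdet := ((((hD 0 0).mul (hD 1 1)).mul (hD 2 2)).sub
    (((hD 0 0).mul (hD 2 1)).mul (hD 1 2))).add
      ((((hD 1 0).mul (hD 2 1)).mul (hD 0 2)).sub (((hD 1 0).mul (hD 0 1)).mul (hD 2 2)))
  have hdet' := hdet.add ((((hD 2 0).mul (hD 0 1)).mul (hD 1 2)).sub
    (((hD 2 0).mul (hD 1 1)).mul (hD 0 2)))
  have h := htr.add (hmin.add hdet')
  refine (h.congr (b := fun _ => 0) fun s => ?_).hasSum.unique (by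
    simp only [mul_zero]; exact hasSum_zero)
  rw [← hE s]
  congr 2
  · rw [minorSum]
    simp only [minors, minor]
    rw [Finset.sum_comm]
    simp only [Finset.sum_sub_distrib]
  · rw [detSum]
    simp only [jac, Finset.sum_mul, ← Finset.sum_sub_distrib, ← Finset.sum_add_distrib]
    refine Finset.sum_congr rfl fun p _ => Finset.sum_congr rfl fun r _ => ?_
    ring

/-- The Taylor series of the displacement defines a flow map. -/
theorem flowMap_of_taylor (hl : 0 < l) (hb : ∀ s, CoeffBound γ (l ^ s) (ξ s, q s)) (h0 : ξ 0 = 0)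
    (hE : ∀ s, CoeffEq s ξ (ξ s, q s)) :
    FlowMap (20 * l)⁻¹ (fun t x => x + ser ξ t x) (ser (shift ξ)) (ser (shift (shift ξ)))
      (ser (shift (shift q))) := by
  obtain ⟨τ, hτdef⟩ : ∃ τ, τ = (20 * l)⁻¹ := ⟨_, rfl⟩
  rw [← hτdef]
  have hτ : 0 < τ := by rw [hτdef]; positivity
  have hlτ : l * τ = 1 / 20 := by rw [hτdef]; field_simp
  have g0 := geo_disp hl hb
  have g1 := g0.shift
  have g2 := g1.shift
  have gq := (geo_pot hl hb).shift.shift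
  have r0 : l * τ < 1 := by linarith
  have r1 : 2 * l * τ < 1 := by linarith
  have r2 : 2 * (2 * l) * τ < 1 := by linarith
  have r3 : 2 * (2 * (2 * l)) * τ < 1 := by linarith
  have hdiff : ∀ s x, DifferentiableAt ℝ (ξ s) x := fun s x =>
    (g0.contDiff s).differentiable one_ne_zero x
  have hX' : ∀ t ∈ Ioo (-τ) τ, ∀ a, HasFDerivAt (fun x => x + ser ξ t x)
      (ContinuousLinearMap.id ℝ E3 + ser (dcoeff ξ) t a) a := fun t ht a =>
    (hasFDerivAt_id a).add (g0.hasFDerivAt_space hτ r1 ht a)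
  have hV' : ∀ t ∈ Ioo (-τ) τ, ∀ a, HasFDerivAt (ser (shift ξ) t)
      (ser (shift (dcoeff ξ)) t a) a := fun t ht a => by
    rw [← dcoeff_shift g0]
    exact g1.hasFDerivAt_space hτ r2 ht a
  -- the power series of the partial derivatives of the displacement
  have hd : ∀ t ∈ Ioo (-τ) τ, ∀ a i j,
      PowSum t (fun s => pd i (cmp (ξ s) j) a) (ser (dcoeff ξ) t a (e i) j) := by
    intro t ht a i j
    have := powSum_clm hl.le r0 (fun s => g0.grad s a) ht
      ((EuclideanSpace.proj j : E3 →L[ℝ] ℝ).comp (ContinuousLinearMap.apply ℝ E3 (e i)))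
    refine this.congr fun s => ?_
    rw [pd_cmp (hdiff s a)]
    rfl
  refine
    { contDiffOn := contDiffOn_snd.add (g0.contDiffOn hτ r1)
      contDiffOn_vel := g1.contDiffOn hτ r2
      hasDerivAt := fun t ht a => (g0.hasDerivAt hτ r1 ht a).const_add a
      hasDerivAt_vel := fun t ht a => g1.hasDerivAt hτ r2 ht a
      hasDerivAt_grad := fun t ht a => ?_
      near := fun t ht a => ?_
      det := fun t ht a => ?_
      contDiff_pot := fun t ht => contDiff_slice (gq.contDiffOn hτ r3) ht
      grad_pot := fun t ht a h => ?_
      shift := fun t ht i a => ?_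
      periodic_vel := fun t _ => periodic_ser (periodic_shift fun s => (hb s).disp.periodic) t
      periodic_pot := fun t _ =>
        periodic_ser (periodic_shift (periodic_shift fun s => (hb s).periodic)) t }
  · -- the coefficients are frozen at `a`, so that only bounds on first derivatives are used
    have hfr : Geo 9 l (fun s (_ : E3) => dcoeff ξ s a) :=
      ⟨by norm_num, hl.le, fun s => contDiff_const, fun s _ => g0.grad s a, fun s _ => by
        rw [fderiv_const_apply, norm_zero]; positivity⟩
    have h1 := (hfr.hasDerivAt hτ r1 ht a).const_add (ContinuousLinearMap.id ℝ E3)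
    rw [(hV' t ht a).fderiv]
    refine h1.congr_of_eventuallyEq ?_
    filter_upwards [isOpen_Ioo.mem_nhds ht] with s hs
    rw [(hX' s hs a).fderiv]
    rfl
  · rw [(hX' t ht a).fderiv, add_sub_cancel_left]
    have hz : dcoeff ξ 0 a = 0 := by
      rw [dcoeff, h0, fderiv_zero]; rfl
    have hs := (hasSum_term hl.le r0 (fun s => g0.grad s a) ht).summable
    have h1 : ser (dcoeff ξ) t a = t • ∑' s, t ^ s • dcoeff ξ (s + 1) a := by
      rw [ser, ← tsum_const_smul'']
      rw [Summable.tsum_eq_zero_add (f := fun s => t ^ s • dcoeff ξ s a) hs, hz, smul_zero,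
        zero_add]
      simp only [smul_smul, pow_succ']
    have hb' : ∀ s, ‖dcoeff ξ (s + 1) a‖ ≤ 9 * l * l ^ s := fun s =>
      (g0.grad (s + 1) a).trans_eq (by rw [pow_succ]; ring)
    have h2 : ‖∑' s, t ^ s • dcoeff ξ (s + 1) a‖ ≤ 9 * l * (1 - l * τ)⁻¹ :=
      norm_tsum_le (a := fun s => dcoeff ξ (s + 1) a) hl.le r0 hb' ht
    rw [h1, norm_smul]
    have h3 : ‖t‖ ≤ τ := (abs_le.2 ⟨ht.1.le, ht.2.le⟩ : |t| ≤ τ)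
    calc ‖t‖ * _ ≤ τ * (9 * l * (1 - l * τ)⁻¹) := mul_le_mul h3 h2 (norm_nonneg _) hτ.le
      _ = 9 * (l * τ) * (1 - l * τ)⁻¹ := by ring
      _ ≤ 1 / 2 := by rw [hlτ]; norm_num
  · set d : Fin 3 → Fin 3 → ℝ := fun i j => ser (dcoeff ξ) t a (e i) j with hddef
    have hD : ∀ i j, PowSum t (fun s => pd i (cmp (ξ s) j) a) (d i j) := hd t ht a
    have hpdX : ∀ i j, pd i (cmp (fun x => x + ser ξ t x) j) a = e i j + d i j := by
      intro i j
      rw [pd_cmp (hX' t ht a).differentiableAt, partialDeriv, (hX' t ht a).fderiv]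
      rfl
    have hz := sum_minors_eq_zero hD fun s => (hE s).2 a
    have hc : (0 : Fin 3) + 1 = 1 ∧ (1 : Fin 3) + 1 = 2 ∧ (2 : Fin 3) + 1 = 0 := ⟨rfl, rfl, rfl⟩
    simp only [Fin.sum_univ_three, hc] at hz
    have he : ∀ i j : Fin 3, e i j = if j = i then 1 else 0 := fun i j => by simp [e]
    simp only [jac, hpdX, he, Fin.reduceEq, if_true, if_false]
    linear_combination hz
  · rw [(gq.hasFDerivAt_space hτ r3 ht a).fderiv, (hX' t ht a).fderiv]
    set S := ser (dcoeff (shift (shift q))) t a with hS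
    set D := ser (dcoeff ξ) t a with hDdef
    set w := ser (shift (shift ξ)) t a with hw
    have hj : ∀ j, S (e j) = inner ℝ w ((ContinuousLinearMap.id ℝ E3 + D) (e j)) := by
      intro j
      have hwk : ∀ k, PowSum t (fun s => cmp (shift (shift ξ) s) k a) (w k) := fun k =>
        powSum_clm g2.rate r2 (fun s => g2.bound s a) ht (EuclideanSpace.proj k : E3 →L[ℝ] ℝ)
      have h1 := (hwk j).add (PowSum.sum fun k => (hwk k).mul (hd t ht a j k))
      have h2 : PowSum t (fun s => dcoeff (shift (shift q)) s a (e j)) (S (e j)) :=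
        powSum_clm gq.rate (by linarith) (fun s => gq.grad s a) ht
          (ContinuousLinearMap.apply ℝ ℝ (e j))
      have h3 : S (e j) = w j + ∑ k, w k * D (e j) k := by
        refine h2.unique (h1.congr fun s => ?_)
        rw [accel_coeff hE, dcoeff_shift (geo_pot hl hb).shift, dcoeff_shift (geo_pot hl hb)]
        simp only [shift, dcoeff, smul_apply, smul_eq_mul, pd]
        push_cast
        ring
      rw [h3, add_apply, ContinuousLinearMap.id_apply, inner_add_right]
      congr 1
      · simp [e, EuclideanSpace.inner_single_right]
      · simp [PiLp.inner_apply, mul_comm]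
    conv_lhs => rw [sum_smul_e h, map_sum]
    conv_rhs => rw [sum_smul_e h, map_sum, inner_sum]
    refine Finset.sum_congr rfl fun j _ => ?_
    rw [map_smul, map_smul, inner_smul_right, hj, smul_eq_mul]
  · simp only [periodic_ser (fun s => (hb s).disp.periodic) t i a]
    abel

end flow

/-! ### Local existence of flows with Hölder continuous vorticity -/

lemma IsEulerFlow.translate {I : Set ℝ} {u : ℝ → E3 → E3} (h : IsEulerFlow I u) (c : ℝ) :
    IsEulerFlow ((fun t => t - c) ⁻¹' I) (fun t => u (t - c)) := by
  obtain ⟨p, hp⟩ := h.momentum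
  refine ⟨?_, fun t ht => h.periodic _ ht, fun t ht => h.div_free _ ht,
    fun t => p (t - c), fun t ht => ⟨(hp _ ht).1, (hp _ ht).2.1, fun x => ?_⟩⟩
  · exact h.contDiffOn.comp (f := fun z : ℝ × E3 => (z.1 - c, z.2)) (by fun_prop)
      fun z hz => ⟨hz.1, mem_univ _⟩
  · have h1 := ((hp _ ht).2.2 x).scomp t (h := fun t => t - c) (s := (fun t => t - c) ⁻¹' I)
      ((hasDerivAt_id t).sub_const c).hasDerivWithinAt (fun s hs => hs)
    simpa [Function.comp_def] using h1

lemma ser_zero {F : Type} [NormedAddCommGroup F] [NormedSpace ℝ F] (f : ℕ → E3 → F) (x : E3) :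
    ser f 0 x = f 0 x := by
  rw [ser, tsum_eq_single 0 (fun s hs => by rw [zero_pow hs, zero_smul]), pow_zero, one_smul]

lemma norm_succ_smul_le {F : Type} [NormedAddCommGroup F] [NormedSpace ℝ F] {M l : ℝ} {a : ℕ → F}
    (ha : ∀ s, ‖a s‖ ≤ M * l ^ s) (s : ℕ) :
    ‖((s : ℝ) + 1) • a (s + 1)‖ ≤ M * l * (2 * l) ^ s := by
  rw [norm_smul, Real.norm_of_nonneg (by positivity)]
  calc ((s : ℝ) + 1) * ‖a (s + 1)‖ ≤ 2 ^ s * (M * l ^ (s + 1)) :=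
        mul_le_mul (succ_le_two_pow s) (ha _) (norm_nonneg _) (by positivity)
    _ = _ := by rw [mul_pow]; ring

lemma ser_sub {F : Type} [NormedAddCommGroup F] [NormedSpace ℝ F] [CompleteSpace F]
    {M l τ t : ℝ} {f : ℕ → E3 → F} (hl : 0 ≤ l) (hlτ : l * τ < 1)
    (hf : ∀ s x, ‖f s x‖ ≤ M * l ^ s) (ht : t ∈ Ioo (-τ) τ) (a b : E3) :
    ser f t a - ser f t b = ∑' s, t ^ s • (f s a - f s b) := by
  rw [ser, ser, ← (hasSum_term hl hlτ (fun s => hf s a) ht).summable.tsum_sub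
    (hasSum_term hl hlτ (fun s => hf s b) ht).summable]
  simp only [smul_sub]

/-- **Local existence.** Through a divergence-free periodic field with Hölder continuous curl
passes an Euler flow with Hölder continuous vorticity, whose trajectories are given by Taylor
series converging on a common time interval. -/
theorem exists_local_flow {v₀ : E3 → E3} (hv : ContDiff ℝ 1 v₀) (hp : SpacePeriodic v₀)
    (hdiv : ∀ x, divergence v₀ x = 0) (hω : IsHolder (curl v₀)) (t₀ : ℝ) :
    ∃ τ : ℝ, 0 < τ ∧ ∃ (u X : ℝ → E3 → E3) (ξ : ℕ → E3 → E3),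
      IsEulerFlow (Ioo (t₀ - τ) (t₀ + τ)) u ∧ u t₀ = v₀ ∧
      (∀ t ∈ Ioo (t₀ - τ) (t₀ + τ), IsHolder (curl (u t))) ∧
      ∀ a, X t₀ a = a ∧ IsTrajectory (Ioo (t₀ - τ) (t₀ + τ)) u (fun t => X t a) ∧
        ∀ t ∈ Ioo (t₀ - τ) (t₀ + τ),
          HasSum (fun s : ℕ => (t - t₀) ^ (s + 1) • ξ (s + 1) a) (X t a - a) := by
  obtain ⟨γ, M, hγ, hγ1, hC⟩ := exists_C1B_of_isHolder hv hp hdiv hω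
  obtain ⟨l, ξ, q, hl, h0, h1, hb, hE⟩ := exists_taylor hγ hγ1 hC fun x => by
    rw [← divergence_eq (hv.differentiable one_ne_zero x), hdiv]
  have hflow := flowMap_of_taylor hl hb h0 hE
  obtain ⟨τ, hτdef⟩ : ∃ τ, τ = (20 * l)⁻¹ := ⟨_, rfl⟩
  rw [← hτdef] at hflow
  have hτ : 0 < τ := by rw [hτdef]; positivity
  have hlτ : l * τ = 1 / 20 := by rw [hτdef]; field_simp
  have r0 : l * τ < 1 := by linarith
  have r1 : 2 * l * τ < 1 := by linarith
  have r2 : 2 * (2 * l) * τ < 1 := by linarith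
  have g0 := geo_disp hl hb
  have g1 := g0.shift
  obtain ⟨u, hu, huX⟩ := hflow.exists_isEulerFlow
  have hset : (fun t => t - t₀) ⁻¹' Ioo (-τ) τ = Ioo (t₀ - τ) (t₀ + τ) := by
    ext t; simp only [mem_preimage, mem_Ioo]; constructor <;> rintro ⟨h, h'⟩ <;> constructor <;>
      linarith
  have hmem : ∀ t ∈ Ioo (t₀ - τ) (t₀ + τ), t - t₀ ∈ Ioo (-τ) τ := fun t ht => by
    rw [← hset] at ht; exact ht
  have hX0 : ∀ a, a + ser ξ 0 a = a := fun a => by rw [ser_zero, h0]; simp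
  refine ⟨τ, hτ, fun t => u (t - t₀), fun t a => a + ser ξ (t - t₀) a, ξ, ?_, ?_, fun t ht => ?_,
    fun a => ⟨?_, fun t ht => ?_, fun t ht => ?_⟩⟩
  · rw [← hset]; exact hu.translate t₀
  · funext a
    have h2 := huX 0 ⟨by linarith, hτ⟩ a
    simp only [hX0] at h2
    simp [h2, ser_zero, shift, h1]
  · have ht' := hmem t ht
    have hdX : ∀ a, fderiv ℝ (fun x => x + ser ξ (t - t₀) x) a =
        ContinuousLinearMap.id ℝ E3 + ser (dcoeff ξ) (t - t₀) a := fun a =>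
      ((hasFDerivAt_id a).add (g0.hasFDerivAt_space hτ r1 ht' a)).fderiv
    have hdV : ∀ a, fderiv ℝ (ser (shift ξ) (t - t₀)) a =
        ser (shift (dcoeff ξ)) (t - t₀) a := fun a => by
      rw [(g1.hasFDerivAt_space hτ r2 ht' a).fderiv, dcoeff_shift g0]
    have hV : ∀ s a, ‖shift (dcoeff ξ) s a‖ ≤ 9 * l * (2 * l) ^ s := fun s a =>
      norm_succ_smul_le (fun s => g0.grad s a) s
    have hdiff : ∀ a b s, ‖dcoeff ξ s a - dcoeff ξ s b‖ ≤ 9 * ‖a - b‖ ^ γ * l ^ s :=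
      fun a b s => ((hb s).disp.norm_fderiv_sub_le a b).trans_eq (by ring)
    have i1 : (1 - l * τ)⁻¹ ≤ 2 := by rw [hlτ]; norm_num
    have i2 : (1 - 2 * l * τ)⁻¹ ≤ 2 := by rw [mul_assoc, hlτ]; norm_num
    refine hflow.isHolder_curl ht'
      ((contDiff_slice hu.contDiffOn ht').differentiable one_ne_zero) (huX _ ht') hγ
      (C := 18 * (1 + l)) (by positivity) (fun a b => ?_) (fun a b => ?_) (fun a => ?_)
    · have hn : 0 ≤ ‖a - b‖ ^ γ := by positivity
      rw [hdX, hdX, add_sub_add_left_eq_sub, ser_sub (f := dcoeff ξ) hl.le r0 g0.grad ht']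
      refine (norm_tsum_le hl.le r0 (hdiff a b) ht').trans ?_
      calc 9 * ‖a - b‖ ^ γ * (1 - l * τ)⁻¹ ≤ 9 * ‖a - b‖ ^ γ * 2 :=
            mul_le_mul_of_nonneg_left i1 (by positivity)
        _ ≤ _ := by nlinarith
    · have hn : 0 ≤ ‖a - b‖ ^ γ := by positivity
      rw [hdV, hdV, ser_sub (by positivity) r1 hV ht']
      have := norm_tsum_le (a := fun s => shift (dcoeff ξ) s a - shift (dcoeff ξ) s b)
        (M := 9 * ‖a - b‖ ^ γ * l) (l := 2 * l) (by positivity) r1 (fun s => by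
          have := norm_succ_smul_le (a := fun s => dcoeff ξ s a - dcoeff ξ s b)
            (hdiff a b) s
          rwa [smul_sub] at this) ht'
      refine this.trans ?_
      calc 9 * ‖a - b‖ ^ γ * l * (1 - 2 * l * τ)⁻¹ ≤ 9 * ‖a - b‖ ^ γ * l * 2 :=
            mul_le_mul_of_nonneg_left i2 (by positivity)
        _ ≤ _ := by nlinarith
    · rw [hdV]
      refine (norm_tsum_le (by positivity) r1 (fun s => hV s a) ht').trans ?_
      calc 9 * l * (1 - 2 * l * τ)⁻¹ ≤ 9 * l * 2 := mul_le_mul_of_nonneg_left i2 (by positivity)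
        _ ≤ _ := by linarith
  · simp only [sub_self, hX0]
  · have ht' := hmem t ht
    have h2 := (hflow.hasDerivAt _ ht' a).comp_sub_const t t₀
    rw [← huX _ ht'] at h2
    exact h2.hasDerivWithinAt
  · have h2 := hasSum_term hl.le r0 (fun s => g0.bound s a) (hmem t ht)
    rw [← hasSum_nat_add_iff' 1] at h2
    simpa [h0, ser] using h2

/-! ### The divergence theorem on a period box -/

/-- The period box in coordinates. -/
def box : Set (Fin 3 → ℝ) := Icc 0 fun _ => 2 * Real.pi

lemma isCompact_box : IsCompact box := isCompact_Icc

/-- The point with coordinates `y` relative to the corner `x₀` of a period box. -/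
noncomputable def boxPt (x₀ : E3) (y : Fin 3 → ℝ) : E3 :=
  x₀ + (EuclideanSpace.equiv (Fin 3) ℝ).symm y

lemma hasFDerivAt_boxPt (x₀ : E3) (y : Fin 3 → ℝ) :
    HasFDerivAt (boxPt x₀)
      ((EuclideanSpace.equiv (Fin 3) ℝ).symm : (Fin 3 → ℝ) →L[ℝ] E3) y :=
  ((EuclideanSpace.equiv (Fin 3) ℝ).symm.hasFDerivAt).const_add x₀

lemma continuous_boxPt (x₀ : E3) : Continuous (boxPt x₀) := by
  unfold boxPt; fun_prop

lemma boxPt_insertNth (x₀ : E3) (i : Fin 3) (c : ℝ) (y : Fin 2 → ℝ) :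
    boxPt x₀ (i.insertNth c y) = boxPt x₀ (i.insertNth 0 y) + c • e i := by
  rw [boxPt, boxPt, add_assoc]
  congr 1
  ext j
  rcases eq_or_ne j i with rfl | hj
  · simp [e]
  · obtain ⟨k, rfl⟩ := Fin.exists_succAbove_eq hj
    simp [e, hj]

/-- The divergence of a periodic field integrates to zero over a period box. -/
lemma integral_box_div {G : Fin 3 → E3 → ℝ} (hG : ∀ i, ContDiff ℝ 1 (G i))
    (hp : ∀ i, SpacePeriodic (G i)) (x₀ : E3) :
    ∫ y in box, ∑ i, pd i (G i) (boxPt x₀ y) = 0 := by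
  have hsingle : ∀ i, (EuclideanSpace.equiv (Fin 3) ℝ).symm (Pi.single i 1) = e i := fun i => by
    ext j; simp [e]
  have h := integral_divergence_of_hasFDerivAt_off_countable' (E := ℝ) (n := 2)
    (0 : Fin 3 → ℝ) (fun _ => 2 * Real.pi) (fun _ => Real.two_pi_pos.le)
    (fun i y => G i (boxPt x₀ y))
    (fun i y => (fderiv ℝ (G i) (boxPt x₀ y)).comp
      ((EuclideanSpace.equiv (Fin 3) ℝ).symm : (Fin 3 → ℝ) →L[ℝ] E3)) ∅ countable_empty
    (fun i => ((hG i).continuous.comp (continuous_boxPt x₀)).continuousOn)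
    (fun y _ i => (((hG i).differentiable one_ne_zero _).hasFDerivAt).comp y
      (hasFDerivAt_boxPt x₀ y))
    (by
      refine ContinuousOn.integrableOn_compact isCompact_Icc (Continuous.continuousOn ?_)
      refine continuous_finsetSum _ fun i _ => ?_
      exact (((hG i).continuous_fderiv one_ne_zero).comp (continuous_boxPt x₀)).clm_apply
        continuous_const)
  have h2 : ∀ y, ∑ i, pd i (G i) (boxPt x₀ y) = ∑ i, ((fderiv ℝ (G i) (boxPt x₀ y)).comp
      ((EuclideanSpace.equiv (Fin 3) ℝ).symm : (Fin 3 → ℝ) →L[ℝ] E3)) (Pi.single i 1) := by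
    intro y
    refine Finset.sum_congr rfl fun i _ => ?_
    rw [ContinuousLinearMap.comp_apply, ContinuousLinearEquiv.coe_coe, hsingle, pd]
  simp only [h2]
  refine h.trans (Finset.sum_eq_zero fun i _ => ?_)
  rw [sub_eq_zero]
  congr 1
  funext y
  rw [boxPt_insertNth x₀ i (2 * Real.pi), hp]
  rfl

/-! ### The energy estimate -/

/-- The acceleration of a fluid with velocity `u` and pressure `p`, at a fixed time. -/
noncomputable def accel (u : E3 → E3) (p : E3 → ℝ) (x : E3) : E3 :=
  -(fderiv ℝ u x (u x)) - gradient p x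

lemma sum_clm_mul {L : E3 →L[ℝ] ℝ} (v : E3) : ∑ i, L (e i) * v i = L v := by
  conv_rhs => rw [sum_smul_e v, map_sum]
  simp [mul_comm]

/-- The energy of the difference of two flows changes at a rate which is a divergence, up to a
quadratic term. -/
lemma inner_accel_sub {u v : E3 → E3} {p r : E3 → ℝ} (hu : ContDiff ℝ 1 u) (hv : ContDiff ℝ 1 v)
    (hp : ContDiff ℝ 1 p) (hr : ContDiff ℝ 1 r) {x : E3} (hud : divergence u x = 0)
    (hvd : divergence v x = 0) :
    2 * inner ℝ (u x - v x) (accel u p x - accel v r x) =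
      -(2 * inner ℝ (u x - v x) (fderiv ℝ u x (u x - v x))) -
      ∑ i, pd i (fun y => inner ℝ (u y - v y) (u y - v y) * v y i +
        2 * (p y - r y) * (u y - v y) i) x := by
  have du := (hu.differentiable one_ne_zero x).hasFDerivAt
  have dv := (hv.differentiable one_ne_zero x).hasFDerivAt
  have dp := (hp.differentiable one_ne_zero x).hasFDerivAt
  have dr := (hr.differentiable one_ne_zero x).hasFDerivAt
  have hpr : ∀ (f : E3 → ℝ) k, inner ℝ k (gradient f x) = fderiv ℝ f x k := fun f k => by
    rw [real_inner_comm, gradient, InnerProductSpace.toDual_symm_apply]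
  set Lu := fderiv ℝ u x
  set Lv := fderiv ℝ v x
  set P := fderiv ℝ p x with hP
  set R := fderiv ℝ r x with hR
  have hpd : ∀ i, pd i (fun y => inner ℝ (u y - v y) (u y - v y) * v y i +
        2 * (p y - r y) * (u y - v y) i) x =
      (2 * inner ℝ (u x - v x) (Lu (e i) - Lv (e i))) * v x i +
        inner ℝ (u x - v x) (u x - v x) * Lv (e i) i +
      (2 * (P (e i) - R (e i)) * (u x - v x) i +
        2 * (p x - r x) * (Lu (e i) i - Lv (e i) i)) := by
    intro i
    have dw := du.sub dv
    have hproj : ∀ {f : E3 → E3} {L : E3 →L[ℝ] E3}, HasFDerivAt f L x →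
        HasFDerivAt (fun y => f y i) ((EuclideanSpace.proj i : E3 →L[ℝ] ℝ).comp L) x :=
      fun h => (EuclideanSpace.proj i : E3 →L[ℝ] ℝ).hasFDerivAt.comp x h
    have h1 := ((dw.inner ℝ dw).mul (hproj dv)).add
      (((dp.sub dr).const_mul 2).mul (hproj dw))
    have h2 : HasFDerivAt (fun y => inner ℝ (u y - v y) (u y - v y) * v y i +
        2 * (p y - r y) * (u y - v y) i) _ x := h1
    rw [pd, h2.fderiv]
    simp [fderivInnerCLM_apply, real_inner_comm]
    ring
  simp only [hpd, Finset.sum_add_distrib]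
  have s1 : ∑ i, 2 * inner ℝ (u x - v x) (Lu (e i) - Lv (e i)) * v x i =
      2 * inner ℝ (u x - v x) (Lu (v x) - Lv (v x)) := by
    have := sum_clm_mul (L := (innerSL ℝ (u x - v x)).comp (Lu - Lv)) (v x)
    simp only [ContinuousLinearMap.comp_apply, innerSL_apply_apply, sub_apply] at this
    rw [← this, Finset.mul_sum]
    exact Finset.sum_congr rfl fun i _ => by ring
  have s2 : ∑ i, inner ℝ (u x - v x) (u x - v x) * Lv (e i) i = 0 := by
    rw [← Finset.mul_sum]
    have : ∑ i, Lv (e i) i = 0 := hvd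
    rw [this, mul_zero]
  have s3 : ∑ i, 2 * (P (e i) - R (e i)) * (u x - v x) i =
      2 * (P (u x - v x) - R (u x - v x)) := by
    have := sum_clm_mul (L := P - R) (u x - v x)
    simp only [sub_apply] at this
    rw [← this, Finset.mul_sum]
    exact Finset.sum_congr rfl fun i _ => by ring
  have s4 : ∑ i, 2 * (p x - r x) * (Lu (e i) i - Lv (e i) i) = 0 := by
    rw [← Finset.mul_sum, Finset.sum_sub_distrib]
    have h1 : ∑ i, Lu (e i) i = 0 := hud
    have h2 : ∑ i, Lv (e i) i = 0 := hvd
    rw [h1, h2, sub_self, mul_zero]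
  rw [s1, s2, s3, s4]
  simp only [accel, inner_sub_right, inner_neg_right, hpr, map_sub]
  simp only [← hP, ← hR]
  ring

/-- The rate of change of the energy of the difference of two flows. -/
lemma abs_energy_rate_le {u v : E3 → E3} {p r : E3 → ℝ} (hu : ContDiff ℝ 1 u)
    (hv : ContDiff ℝ 1 v) (hp : ContDiff ℝ 1 p) (hr : ContDiff ℝ 1 r) (hup : SpacePeriodic u)
    (hvp : SpacePeriodic v) (hpp : SpacePeriodic p) (hrp : SpacePeriodic r)
    (hud : ∀ x, divergence u x = 0) (hvd : ∀ x, divergence v x = 0) {K : ℝ}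
    (hK : ∀ x, ‖fderiv ℝ u x‖ ≤ K) (x₀ : E3) :
    |∫ y in box, 2 * inner ℝ (u (boxPt x₀ y) - v (boxPt x₀ y))
        (accel u p (boxPt x₀ y) - accel v r (boxPt x₀ y))| ≤
      2 * K * ∫ y in box, ‖u (boxPt x₀ y) - v (boxPt x₀ y)‖ ^ 2 := by
  have hc := continuous_boxPt x₀
  have hu' := hu.continuous_fderiv one_ne_zero
  have huc := hu.continuous
  have hvc := hv.continuous
  set G : Fin 3 → E3 → ℝ := fun i y => inner ℝ (u y - v y) (u y - v y) * v y i +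
        2 * (p y - r y) * (u y - v y) i with hG
  have hGd : ∀ i, ContDiff ℝ 1 (G i) := fun i => by
    have h1 : ∀ {f : E3 → E3}, ContDiff ℝ 1 f → ContDiff ℝ 1 (fun y => f y i) :=
      fun h => contDiff_cmp h i
    exact (((hu.sub hv).inner ℝ (hu.sub hv)).mul (h1 hv)).add
      ((contDiff_const.mul (hp.sub hr)).mul (h1 (hu.sub hv)))
  have hGp : ∀ i, SpacePeriodic (G i) := fun i j x => by
    simp only [hG, hup j, hvp j, hpp j, hrp j]
  simp only [fun y => inner_accel_sub hu hv hp hr (hud (boxPt x₀ y)) (hvd (boxPt x₀ y))]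
  have i1 : IntegrableOn (fun y => -(2 * inner ℝ (u (boxPt x₀ y) - v (boxPt x₀ y))
      (fderiv ℝ u (boxPt x₀ y) (u (boxPt x₀ y) - v (boxPt x₀ y))))) box :=
    ContinuousOn.integrableOn_compact isCompact_box (Continuous.continuousOn (by fun_prop))
  have i2 : IntegrableOn (fun y => ∑ i, pd i (G i) (boxPt x₀ y)) box :=
    ContinuousOn.integrableOn_compact isCompact_box (Continuous.continuousOn
      (continuous_finsetSum _ fun i _ => (continuous_pd (hGd i) i).comp hc))
  rw [integral_sub i1 i2, integral_box_div hGd hGp, sub_zero, ← integral_const_mul,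
    ← Real.norm_eq_abs]
  refine norm_integral_le_of_norm_le (ContinuousOn.integrableOn_compact isCompact_box
    (Continuous.continuousOn (by fun_prop))) (ae_of_all _ fun y => ?_)
  rw [norm_neg, norm_mul, Real.norm_of_nonneg zero_le_two, mul_assoc]
  refine mul_le_mul_of_nonneg_left ?_ zero_le_two
  refine (norm_inner_le_norm _ _).trans ?_
  rw [sq, ← mul_assoc, mul_comm]
  refine mul_le_mul_of_nonneg_right ?_ (norm_nonneg _)
  exact (ContinuousLinearMap.le_opNorm _ _).trans
    (mul_le_mul_of_nonneg_right (hK _) (norm_nonneg _))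

/-! ### Uniqueness of classical flows -/

lemma IsEulerFlow.mono {I J : Set ℝ} {u : ℝ → E3 → E3} (h : IsEulerFlow I u) (hJ : J ⊆ I) :
    IsEulerFlow J u := by
  obtain ⟨p, hp⟩ := h.momentum
  exact ⟨h.contDiffOn.mono (prod_mono hJ Subset.rfl), fun t ht => h.periodic t (hJ ht),
    fun t ht => h.div_free t (hJ ht), p, fun t ht => ⟨(hp t (hJ ht)).1, (hp t (hJ ht)).2.1,
      fun x => ((hp t (hJ ht)).2.2 x).mono hJ⟩⟩

lemma IsEulerFlow.contDiff {I : Set ℝ} {u : ℝ → E3 → E3} (h : IsEulerFlow I u) {t : ℝ}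
    (ht : t ∈ I) : ContDiff ℝ 1 (u t) := contDiff_slice h.contDiffOn ht

/-- The spatial derivative of a jointly `C¹` field is continuous up to the end points of the time
interval. -/
lemma continuousOn_fderiv_slice {F : Type} [NormedAddCommGroup F] [NormedSpace ℝ F] {J : Set ℝ}
    {f : ℝ → E3 → F} (hJ : UniqueDiffOn ℝ J)
    (h : ContDiffOn ℝ 1 (fun z : ℝ × E3 => f z.1 z.2) (J ×ˢ univ)) :
    ContinuousOn (fun z : ℝ × E3 => fderiv ℝ (f z.1) z.2) (J ×ˢ univ) := by
  have hS : UniqueDiffOn ℝ (J ×ˢ (univ : Set E3)) := hJ.prod uniqueDiffOn_univ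
  have h1 := h.continuousOn_fderivWithin hS le_rfl
  refine ((((ContinuousLinearMap.compL ℝ E3 (ℝ × E3) F).flip
    (ContinuousLinearMap.inr ℝ ℝ E3)).continuous).comp_continuousOn h1).congr ?_
  rintro ⟨t, x⟩ hz
  have hi : HasFDerivWithinAt (fun x : E3 => (t, x)) (ContinuousLinearMap.inr ℝ ℝ E3) univ x :=
    (hasFDerivAt_prodMk_right t x).hasFDerivWithinAt
  have h2 := HasFDerivWithinAt.comp (g := fun z : ℝ × E3 => f z.1 z.2) x
    (h.differentiableOn one_ne_zero (t, x) hz).hasFDerivWithinAt hi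
    (fun y _ => (⟨hz.1, mem_univ _⟩ : (t, y) ∈ J ×ˢ univ))
  exact (hasFDerivWithinAt_univ.1 h2).fderiv

lemma IsEulerFlow.exists_fderiv_bound {a b : ℝ} (hab : a < b) {u : ℝ → E3 → E3}
    (h : IsEulerFlow (Icc a b) u) : ∃ K, ∀ t ∈ Icc a b, ∀ x, ‖fderiv ℝ (u t) x‖ ≤ K := by
  obtain ⟨K, hK⟩ := (isCompact_Icc.prod
    (isCompact_closedBall (0 : E3) (6 * Real.pi))).exists_bound_of_continuousOn
      ((continuousOn_fderiv_slice (uniqueDiffOn_Icc hab) h.contDiffOn).mono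
        (prod_mono Subset.rfl (subset_univ _)))
  refine ⟨K, fun t ht x => ?_⟩
  obtain ⟨y, hy, hxy⟩ := exists_reduced x
  rw [hxy _ (periodic_fderiv (h.periodic t ht))]
  exact hK (t, y) ⟨ht, hy⟩

/-- A nonnegative function whose rate of change is bounded by a multiple of the function vanishes
if it does so at one point. -/
lemma eq_zero_of_abs_deriv_le {a b c C : ℝ} {y y' : ℝ → ℝ} (hy : ContinuousOn y (Icc a b))
    (hd : ∀ t ∈ Ioo a b, HasDerivAt y (y' t) t) (h0 : ∀ t ∈ Icc a b, 0 ≤ y t)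
    (hb : ∀ t ∈ Ioo a b, |y' t| ≤ C * y t) (hc : c ∈ Icc a b) (hyc : y c = 0) {t : ℝ}
    (ht : t ∈ Icc a b) : y t = 0 := by
  have hd' : ∀ k, ∀ t ∈ Ioo a b, HasDerivAt (fun t => Real.exp (k * t) * y t)
      (Real.exp (k * t) * (k * y t + y' t)) t := fun k t ht => by
    have h1 : HasDerivAt (fun t => Real.exp (k * t)) (Real.exp (k * t) * k) t := by
      simpa using ((hasDerivAt_id t).const_mul k).exp
    exact (h1.mul (hd t ht)).congr_deriv (by ring)
  have hc' : ∀ k, ContinuousOn (fun t => Real.exp (k * t) * y t) (Icc a b) := fun k =>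
    (by fun_prop : Continuous fun t => Real.exp (k * t)).continuousOn.mul hy
  have hconv : Convex ℝ (Icc a b) := convex_Icc a b
  have h1 : AntitoneOn (fun t => Real.exp (-C * t) * y t) (Icc a b) :=
    antitoneOn_of_deriv_nonpos hconv (hc' _)
      (fun t ht => by
        rw [interior_Icc] at ht; exact (hd' _ t ht).differentiableAt.differentiableWithinAt)
      (fun t ht => by
        rw [interior_Icc] at ht
        rw [(hd' _ t ht).deriv]
        refine mul_nonpos_of_nonneg_of_nonpos (Real.exp_pos _).le ?_
        linarith [(abs_le.1 (hb t ht)).2])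
  have h2 : MonotoneOn (fun t => Real.exp (C * t) * y t) (Icc a b) :=
    monotoneOn_of_deriv_nonneg hconv (hc' _)
      (fun t ht => by
        rw [interior_Icc] at ht; exact (hd' _ t ht).differentiableAt.differentiableWithinAt)
      (fun t ht => by
        rw [interior_Icc] at ht
        rw [(hd' _ t ht).deriv]
        refine mul_nonneg (Real.exp_pos _).le ?_
        linarith [(abs_le.1 (hb t ht)).1])
  refine le_antisymm ?_ (h0 t ht)
  rcases le_total c t with h | h
  · have := h1 hc ht h
    simp only [hyc, mul_zero] at this
    exact nonpos_of_mul_nonpos_right this (Real.exp_pos _)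
  · have := h2 ht hc h
    simp only [hyc, mul_zero] at this
    exact nonpos_of_mul_nonpos_right this (Real.exp_pos _)

/-- The acceleration of a jointly `C¹` field is jointly continuous. -/
lemma continuousOn_accel {a b : ℝ} {u : ℝ → E3 → E3} {p : ℝ → E3 → ℝ}
    (h : ContDiffOn ℝ 1 (fun z : ℝ × E3 => u z.1 z.2) (Ioo a b ×ˢ univ))
    (hp : ∀ t ∈ Ioo a b, ∀ x, HasDerivAt (fun s => u s x) (accel (u t) (p t) x) t) :
    ContinuousOn (fun z : ℝ × E3 => accel (u z.1) (p z.1) z.2) (Ioo a b ×ˢ univ) := by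
  have h1 := (h.continuousOn_fderiv_of_isOpen (isOpen_Ioo.prod isOpen_univ) le_rfl)
  refine (h1.clm_apply (continuousOn_const (c := ((1 : ℝ), (0 : E3))))).congr ?_
  rintro ⟨t, x⟩ hz
  refine (hp t hz.1 x).unique ?_
  exact HasFDerivAt.comp_hasDerivAt (f := fun s => (s, x)) t
    (differentiableAt_joint isOpen_Ioo h hz.1 x).hasFDerivAt
    ((hasDerivAt_id t).prodMk (hasDerivAt_const t x))

lemma continuous_of_continuousOn_prod {Z : Type} [TopologicalSpace Z] {G : ℝ → Z → ℝ} {S : Set ℝ}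
    (hG : ContinuousOn (fun z : ℝ × Z => G z.1 z.2) (S ×ˢ univ)) {s : ℝ} (hs : s ∈ S) :
    Continuous (G s) :=
  hG.comp_continuous (f := fun y => (s, y)) (by fun_prop) fun y => ⟨hs, mem_univ _⟩

lemma continuousOn_integral_box {a b : ℝ} {F : ℝ → (Fin 3 → ℝ) → ℝ}
    (hF : ContinuousOn (fun z : ℝ × (Fin 3 → ℝ) => F z.1 z.2) (Icc a b ×ˢ univ)) :
    ContinuousOn (fun s => ∫ z in box, F s z) (Icc a b) := by
  rw [continuousOn_iff_continuous_domRestrict]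
  refine continuous_parametric_integral_of_continuous (X := Icc a b)
    (f := fun s z => F s z) ?_ isCompact_box
  exact hF.comp_continuous (f := fun z : Icc a b × (Fin 3 → ℝ) => ((z.1 : ℝ), z.2))
    (by fun_prop) fun z => ⟨z.1.2, mem_univ _⟩

lemma hasDerivAt_integral_box {a b s : ℝ} {F F' : ℝ → (Fin 3 → ℝ) → ℝ}
    (hF : ∀ s ∈ Ioo a b, Continuous (F s))
    (hF' : ContinuousOn (fun z : ℝ × (Fin 3 → ℝ) => F' z.1 z.2) (Ioo a b ×ˢ univ))
    (hd : ∀ s ∈ Ioo a b, ∀ z, HasDerivAt (fun s => F s z) (F' s z) s) (hs : s ∈ Ioo a b) :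
    HasDerivAt (fun s => ∫ z in box, F s z) (∫ z in box, F' s z) s := by
  obtain ⟨ε, hε, hεs⟩ := Metric.nhds_basis_closedBall.mem_iff.1 (isOpen_Ioo.mem_nhds hs)
  obtain ⟨M, hM⟩ := ((isCompact_closedBall s ε).prod isCompact_box).exists_bound_of_continuousOn
    (hF'.mono (prod_mono hεs (subset_univ _)))
  refine (hasDerivAt_integral_of_dominated_loc_of_deriv_le
    (μ := volume.restrict box) (F := F) (F' := F') (bound := fun _ => M)
    (Metric.closedBall_mem_nhds s hε) ?_ ?_ ?_ ?_ ?_ ?_).2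
  · filter_upwards [isOpen_Ioo.mem_nhds hs] with s' hs'
    exact (hF s' hs').aestronglyMeasurable
  · exact (hF s hs).continuousOn.integrableOn_compact isCompact_box
  · exact (continuous_of_continuousOn_prod hF' hs).aestronglyMeasurable
  · refine (ae_restrict_iff' isCompact_box.measurableSet).2 (ae_of_all _ fun z hz s' hs' => ?_)
    exact hM (s', z) ⟨hs', hz⟩
  · exact integrableOn_const (hs := isCompact_box.measure_lt_top.ne)
  · exact ae_of_all _ fun z s' hs' => hd s' (hεs hs') z

/-- A nonnegative continuous function with vanishing integral over the box vanishes at its centre. -/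
lemma eq_zero_of_integral_box_eq_zero {f : (Fin 3 → ℝ) → ℝ} (hf : Continuous f) (h0 : ∀ z, 0 ≤ f z)
    (h : ∫ z in box, f z = 0) : f (fun _ => Real.pi) = 0 := by
  have hae : f =ᵐ[volume.restrict box] 0 :=
    (setIntegral_eq_zero_iff_of_nonneg_ae (ae_of_all _ h0)
      (hf.continuousOn.integrableOn_compact isCompact_box)).1 h
  set U : Set (Fin 3 → ℝ) := univ.pi fun _ => Ioo 0 (2 * Real.pi) with hU
  have hUo : IsOpen U := isOpen_set_pi finite_univ fun _ _ => isOpen_Ioo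
  have hUb : U ⊆ box := fun z hz => ⟨fun i => (hz i (mem_univ i)).1.le,
    fun i => (hz i (mem_univ i)).2.le⟩
  have heq := Measure.eqOn_open_of_ae_eq (hae.filter_mono (ae_mono (Measure.restrict_mono hUb
    le_rfl))) hUo hf.continuousOn continuousOn_const
  exact heq (x := fun _ => Real.pi) fun i _ => ⟨Real.pi_pos, by linarith [Real.pi_pos]⟩

lemma continuousOn_accel_boxPt {a b : ℝ} {u : ℝ → E3 → E3} {p : ℝ → E3 → ℝ}
    (h : ContDiffOn ℝ 1 (fun z : ℝ × E3 => u z.1 z.2) (Ioo a b ×ˢ univ))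
    (hp : ∀ t ∈ Ioo a b, ∀ x, HasDerivAt (fun s => u s x) (accel (u t) (p t) x) t) (x₀ : E3) :
    ContinuousOn (fun z : ℝ × (Fin 3 → ℝ) => accel (u z.1) (p z.1) (boxPt x₀ z.2))
      (Ioo a b ×ˢ univ) := by
  have h1 := continuousOn_accel h hp
  have h2 : Continuous (fun z : ℝ × (Fin 3 → ℝ) => (z.1, boxPt x₀ z.2)) := by
    have := continuous_boxPt x₀
    fun_prop
  -- only the continuity of the acceleration matters here, not its formula
  generalize accel = A at h1 ⊢
  exact h1.comp h2.continuousOn fun z hz => ⟨hz.1, mem_univ _⟩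

/-- Two flows on a compact interval which agree at one time agree at all times. -/
lemma IsEulerFlow.eq_of_eq_Icc {a b c t : ℝ} (hab : a < b) {u v : ℝ → E3 → E3}
    (hu : IsEulerFlow (Icc a b) u) (hv : IsEulerFlow (Icc a b) v) (hc : c ∈ Icc a b)
    (huv : u c = v c) (ht : t ∈ Icc a b) : u t = v t := by
  funext x
  obtain ⟨K, hK⟩ := hu.exists_fderiv_bound hab
  obtain ⟨p, hp⟩ := hu.momentum
  obtain ⟨r, hr⟩ := hv.momentum
  have hI : ∀ s ∈ Ioo a b, s ∈ Icc a b := fun s hs => Ioo_subset_Icc_self hs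
  have hnhds : ∀ s ∈ Ioo a b, Icc a b ∈ 𝓝 s := fun s hs => Icc_mem_nhds hs.1 hs.2
  have hpd : ∀ s ∈ Ioo a b, ∀ x, HasDerivAt (fun s => u s x) (accel (u s) (p s) x) s :=
    fun s hs x => ((hp s (hI s hs)).2.2 x).hasDerivAt (hnhds s hs)
  have hrd : ∀ s ∈ Ioo a b, ∀ x, HasDerivAt (fun s => v s x) (accel (v s) (r s) x) s :=
    fun s hs x => ((hr s (hI s hs)).2.2 x).hasDerivAt (hnhds s hs)
  -- the corner of the box is chosen so that `x` is its centre
  obtain ⟨x₀, hx₀⟩ : ∃ x₀ : E3,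
      x₀ = x - (EuclideanSpace.equiv (Fin 3) ℝ).symm (fun _ => Real.pi) := ⟨_, rfl⟩
  have hc₀ := continuous_boxPt x₀
  have hpt : ∀ S : Set ℝ, MapsTo (fun z : ℝ × (Fin 3 → ℝ) => (z.1, boxPt x₀ z.2)) (S ×ˢ univ)
      (S ×ˢ univ) := fun S z hz => ⟨hz.1, mem_univ _⟩
  have hptc : Continuous (fun z : ℝ × (Fin 3 → ℝ) => (z.1, boxPt x₀ z.2)) := by fun_prop
  have huc : ContinuousOn (fun z : ℝ × (Fin 3 → ℝ) => u z.1 (boxPt x₀ z.2)) (Icc a b ×ˢ univ) :=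
    hu.contDiffOn.continuousOn.comp hptc.continuousOn (hpt _)
  have hvc : ContinuousOn (fun z : ℝ × (Fin 3 → ℝ) => v z.1 (boxPt x₀ z.2)) (Icc a b ×ˢ univ) :=
    hv.contDiffOn.continuousOn.comp hptc.continuousOn (hpt _)
  have hsub : Ioo a b ×ˢ (univ : Set E3) ⊆ Icc a b ×ˢ univ := prod_mono hI Subset.rfl
  have hsub' : Ioo a b ×ˢ (univ : Set (Fin 3 → ℝ)) ⊆ Icc a b ×ˢ univ := prod_mono hI Subset.rfl
  have hFc : ContinuousOn (fun z : ℝ × (Fin 3 → ℝ) =>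
      ‖u z.1 (boxPt x₀ z.2) - v z.1 (boxPt x₀ z.2)‖ ^ 2) (Icc a b ×ˢ univ) :=
    (huc.sub hvc).norm.pow 2
  have hac : ContinuousOn (fun z : ℝ × (Fin 3 → ℝ) => accel (u z.1) (p z.1) (boxPt x₀ z.2))
      (Ioo a b ×ˢ univ) :=
    continuousOn_accel_boxPt (hu.contDiffOn.mono hsub) hpd x₀
  have hac' : ContinuousOn (fun z : ℝ × (Fin 3 → ℝ) => accel (v z.1) (r z.1) (boxPt x₀ z.2))
      (Ioo a b ×ˢ univ) :=
    continuousOn_accel_boxPt (hv.contDiffOn.mono hsub) hrd x₀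
  have hFc' : ContinuousOn (fun z : ℝ × (Fin 3 → ℝ) =>
      2 * inner ℝ (u z.1 (boxPt x₀ z.2) - v z.1 (boxPt x₀ z.2))
        (accel (u z.1) (p z.1) (boxPt x₀ z.2) - accel (v z.1) (r z.1) (boxPt x₀ z.2)))
      (Ioo a b ×ˢ univ) :=
    continuousOn_const.mul (((huc.sub hvc).mono hsub').inner (hac.sub hac'))
  have hslice : ∀ s ∈ Icc a b,
      Continuous fun z => ‖u s (boxPt x₀ z) - v s (boxPt x₀ z)‖ ^ 2 := fun s hs =>
    continuous_of_continuousOn_prod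
      (G := fun s z => ‖u s (boxPt x₀ z) - v s (boxPt x₀ z)‖ ^ 2) hFc hs
  have hyz : ∫ z in box, ‖u t (boxPt x₀ z) - v t (boxPt x₀ z)‖ ^ 2 = 0 := by
    refine eq_zero_of_abs_deriv_le (C := 2 * K)
      (y := fun s => ∫ z in box, ‖u s (boxPt x₀ z) - v s (boxPt x₀ z)‖ ^ 2)
      (continuousOn_integral_box (F := fun s z => ‖u s (boxPt x₀ z) - v s (boxPt x₀ z)‖ ^ 2) hFc)
      (fun s hs => hasDerivAt_integral_box
        (F := fun s z => ‖u s (boxPt x₀ z) - v s (boxPt x₀ z)‖ ^ 2)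
        (F' := fun s z => 2 * inner ℝ (u s (boxPt x₀ z) - v s (boxPt x₀ z))
          (accel (u s) (p s) (boxPt x₀ z) - accel (v s) (r s) (boxPt x₀ z)))
        (fun s hs => hslice s (hI s hs)) hFc'
        (fun s hs z => ((hpd s hs (boxPt x₀ z)).sub (hrd s hs (boxPt x₀ z))).norm_sq) hs)
      (fun s _ => integral_nonneg fun z => by positivity) (fun s hs => ?_) hc ?_ ht
    · have hs' := hI s hs
      exact abs_energy_rate_le (hu.contDiff hs') (hv.contDiff hs') (hp s hs').1 (hr s hs').1
        (hu.periodic s hs') (hv.periodic s hs') (hp s hs').2.1 (hr s hs').2.1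
        (hu.div_free s hs') (hv.div_free s hs') (hK s hs') x₀
    · simp [huv]
  have hx : boxPt x₀ (fun _ => Real.pi) = x := by rw [boxPt, hx₀, sub_add_cancel]
  have := eq_zero_of_integral_box_eq_zero (hslice t ht) (fun z => by positivity) hyz
  rw [hx] at this
  exact sub_eq_zero.1 (norm_eq_zero.1 (pow_eq_zero_iff two_ne_zero |>.1 this))

/-- **Uniqueness.** Two flows on an interval which agree at one time agree at all times. -/
theorem IsEulerFlow.eq_of_eq {J : Set ℝ} (hJ : J.OrdConnected) {u v : ℝ → E3 → E3}
    (hu : IsEulerFlow J u) (hv : IsEulerFlow J v) {c t : ℝ} (hc : c ∈ J) (huv : u c = v c)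
    (ht : t ∈ J) : u t = v t := by
  rcases lt_trichotomy c t with h | rfl | h
  · have hs := hJ.out hc ht
    exact (hu.mono hs).eq_of_eq_Icc h (hv.mono hs) (left_mem_Icc.2 h.le) huv (right_mem_Icc.2 h.le)
  · exact huv
  · have hs := hJ.out ht hc
    exact (hu.mono hs).eq_of_eq_Icc h (hv.mono hs) (right_mem_Icc.2 h.le) huv (left_mem_Icc.2 h.le)

/-! ### Trajectories -/

lemma IsTrajectory.mono {I J : Set ℝ} {u : ℝ → E3 → E3} {x : ℝ → E3} (h : IsTrajectory I u x)
    (hJ : J ⊆ I) : IsTrajectory J u x := fun t ht => (h t (hJ ht)).mono hJ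

lemma IsTrajectory.congr {I : Set ℝ} {u v : ℝ → E3 → E3} {x : ℝ → E3} (h : IsTrajectory I u x)
    (huv : ∀ t ∈ I, v t = u t) : IsTrajectory I v x := fun t ht => by
  rw [huv t ht]; exact h t ht

lemma IsEulerFlow.eq_of_isTrajectory_Icc {a b c t : ℝ} (hab : a < b) {u : ℝ → E3 → E3}
    (hu : IsEulerFlow (Icc a b) u) {x y : ℝ → E3} (hx : IsTrajectory (Icc a b) u x)
    (hy : IsTrajectory (Icc a b) u y) (hc : c ∈ Icc a b) (hxy : x c = y c) (ht : t ∈ Icc a b) :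
    x t = y t := by
  obtain ⟨K, hK⟩ := hu.exists_fderiv_bound hab
  have hcont : ContinuousOn (fun s => ‖x s - y s‖ ^ 2) (Icc a b) := by
    have h1 : ContinuousOn x (Icc a b) := fun s hs => (hx s hs).continuousWithinAt
    have h2 : ContinuousOn y (Icc a b) := fun s hs => (hy s hs).continuousWithinAt
    exact (h1.sub h2).norm.pow 2
  have h0 := eq_zero_of_abs_deriv_le (C := 2 * K) (y := fun s => ‖x s - y s‖ ^ 2)
    (y' := fun s => 2 * inner ℝ (x s - y s) (u s (x s) - u s (y s))) hcont
    (fun s hs => (((hx s (Ioo_subset_Icc_self hs)).hasDerivAt (Icc_mem_nhds hs.1 hs.2)).sub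
      ((hy s (Ioo_subset_Icc_self hs)).hasDerivAt (Icc_mem_nhds hs.1 hs.2))).norm_sq)
    (fun s _ => by positivity) (fun s hs => ?_) hc (by simp [hxy]) ht
  · exact sub_eq_zero.1 (norm_eq_zero.1 (pow_eq_zero_iff two_ne_zero |>.1 h0))
  · have hs' : s ∈ Icc a b := Ioo_subset_Icc_self hs
    have h1 : ‖u s (x s) - u s (y s)‖ ≤ K * ‖x s - y s‖ :=
      Convex.norm_image_sub_le_of_norm_fderiv_le (s := univ)
        (fun z _ => (hu.contDiff hs').differentiable one_ne_zero z) (fun z _ => hK s hs' z)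
        convex_univ (mem_univ _) (mem_univ _)
    have h2 := abs_real_inner_le_norm (x s - y s) (u s (x s) - u s (y s))
    rw [abs_mul, abs_of_pos (by norm_num : (0 : ℝ) < 2), mul_assoc]
    refine mul_le_mul_of_nonneg_left (h2.trans ?_) (by norm_num)
    calc _ ≤ ‖x s - y s‖ * (K * ‖x s - y s‖) := mul_le_mul_of_nonneg_left h1 (norm_nonneg _)
      _ = _ := by ring

/-- Trajectories of a flow are determined by their position at one time. -/
lemma IsEulerFlow.eq_of_isTrajectory {J : Set ℝ} (hJ : J.OrdConnected) {u : ℝ → E3 → E3}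
    (hu : IsEulerFlow J u) {x y : ℝ → E3} (hx : IsTrajectory J u x) (hy : IsTrajectory J u y)
    {c t : ℝ} (hc : c ∈ J) (hxy : x c = y c) (ht : t ∈ J) : x t = y t := by
  rcases lt_trichotomy c t with h | rfl | h
  · have hs := hJ.out hc ht
    exact (hu.mono hs).eq_of_isTrajectory_Icc h (hx.mono hs) (hy.mono hs) (left_mem_Icc.2 h.le)
      hxy (right_mem_Icc.2 h.le)
  · exact hxy
  · have hs := hJ.out ht hc
    exact (hu.mono hs).eq_of_isTrajectory_Icc h (hx.mono hs) (hy.mono hs) (right_mem_Icc.2 h.le)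
      hxy (left_mem_Icc.2 h.le)

/-- On a compact time interval there is a trajectory through every point. -/
lemma IsEulerFlow.exists_isTrajectory_Icc {a b : ℝ} (hab : a < b) {u : ℝ → E3 → E3}
    (hu : IsEulerFlow (Icc a b) u) (x₀ : E3) :
    ∃ x : ℝ → E3, x a = x₀ ∧ IsTrajectory (Icc a b) u x := by
  obtain ⟨K, hK⟩ := hu.exists_fderiv_bound hab
  obtain ⟨L, hL⟩ := (isCompact_Icc.prod
    (isCompact_closedBall (0 : E3) (6 * Real.pi))).exists_bound_of_continuousOn
      (hu.contDiffOn.continuousOn.mono (prod_mono Subset.rfl (subset_univ _)))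
  have hL' : ∀ t ∈ Icc a b, ∀ x, ‖u t x‖ ≤ L := fun t ht x => by
    obtain ⟨y, hy, hxy⟩ := exists_reduced x
    rw [hxy _ (hu.periodic t ht)]
    exact hL (t, y) ⟨ht, hy⟩
  -- the velocity is bounded, so that a trajectory stays in a ball of radius `L * (b - a)`
  have hP : IsPicardLindelof u (tmin := a) (tmax := b) ⟨a, left_mem_Icc.2 hab.le⟩ x₀
      (L.toNNReal * (b - a).toNNReal) 0 L.toNNReal K.toNNReal := by
    refine ⟨fun t ht => LipschitzOnWith.of_dist_le_mul fun x _ y _ => ?_, fun x _ => ?_,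
      fun t ht x _ => (hL' t ht x).trans (Real.le_coe_toNNReal L), ?_⟩
    · rw [dist_eq_norm, dist_eq_norm]
      refine Convex.norm_image_sub_le_of_norm_fderiv_le (s := univ)
        (fun z _ => (hu.contDiff ht).differentiable one_ne_zero z)
        (fun z _ => (hK t ht z).trans (Real.le_coe_toNNReal K))
        convex_univ (mem_univ _) (mem_univ _)
    · exact hu.contDiffOn.continuousOn.comp (f := fun t => (t, x)) (by fun_prop)
        fun t ht => ⟨ht, mem_univ _⟩
    · simp [hab.le]
  obtain ⟨x, hx, hx'⟩ := hP.exists_eq_forall_mem_Icc_hasDerivWithinAt₀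
  exact ⟨x, hx, hx'⟩

/-! ### Analyticity in time -/

/-- A convergent expansion in powers of `t - t₀` on a neighbourhood gives analyticity at `t₀`. -/
lemma analyticAt_of_hasSum {F : Type} [NormedAddCommGroup F] [NormedSpace ℝ F] {x : ℝ → F}
    {c : ℕ → F} {t₀ τ : ℝ} (hτ : 0 < τ)
    (h : ∀ t ∈ Ioo (t₀ - τ) (t₀ + τ),
      HasSum (fun s : ℕ => (t - t₀) ^ (s + 1) • c (s + 1)) (x t - x t₀)) : AnalyticAt ℝ x t₀ := by
  obtain ⟨p, hp⟩ : ∃ p : FormalMultilinearSeries ℝ ℝ F,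
      ∀ n, p.coeff n = if n = 0 then x t₀ else c n :=
    ⟨fun n => ContinuousMultilinearMap.mkPiRing ℝ (Fin n) (if n = 0 then x t₀ else c n),
      fun n => by simp [FormalMultilinearSeries.coeff]⟩
  refine ⟨p, hasFPowerSeriesAt_iff'.2 ?_⟩
  filter_upwards [Ioo_mem_nhds (by linarith : t₀ - τ < t₀) (by linarith : t₀ < t₀ + τ)] with t ht
  rw [← hasSum_nat_add_iff' 1]
  simpa [hp] using h t ht

/-- Trajectories of a flow with Hölder continuous vorticity are analytic in time. -/
theorem IsEulerFlow.analyticOn {I : Set ℝ} (hI : I.OrdConnected) {v : ℝ → E3 → E3}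
    (hv : IsEulerFlow I v) (hω : ∀ t ∈ I, IsHolder (curl (v t))) {x : ℝ → E3}
    (hx : IsTrajectory I v x) : AnalyticOn ℝ x I := by
  intro t₀ ht₀
  obtain ⟨τ, hτ, u, X, ξ, hu, hu0, -, hX⟩ := exists_local_flow (hv.contDiff ht₀)
    (hv.periodic t₀ ht₀) (hv.div_free t₀ ht₀) (hω t₀ ht₀) t₀
  obtain ⟨hX0, hXt, hXs⟩ := hX (x t₀)
  set J := I ∩ Ioo (t₀ - τ) (t₀ + τ) with hJ
  have hmem : t₀ ∈ Ioo (t₀ - τ) (t₀ + τ) := ⟨by linarith, by linarith⟩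
  have hJc : J.OrdConnected := hI.inter ordConnected_Ioo
  have huv : ∀ t ∈ J, u t = v t := fun t ht =>
    (hu.mono inter_subset_right).eq_of_eq hJc (hv.mono inter_subset_left) ⟨ht₀, hmem⟩ hu0 ht
  have heq : ∀ t ∈ J, x t = X t (x t₀) := fun t ht =>
    (hv.mono inter_subset_left).eq_of_isTrajectory hJc (hx.mono inter_subset_left)
      ((hXt.mono inter_subset_right).congr fun s hs => (huv s hs).symm) ⟨ht₀, hmem⟩ hX0.symm ht
  have han : AnalyticAt ℝ (fun t => X t (x t₀)) t₀ :=
    analyticAt_of_hasSum (c := fun s => ξ s (x t₀)) hτ fun t ht => by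
      rw [hX0]; exact hXs t ht
  refine han.analyticWithinAt.congr_of_eventuallyEq ?_ (heq t₀ ⟨ht₀, hmem⟩)
  filter_upwards [inter_mem_nhdsWithin I (isOpen_Ioo.mem_nhds hmem)] with t ht
  exact heq t ht

/-! ### Continuation -/

/-- Being an Euler flow is a local property in time. -/
lemma isEulerFlow_of_local {J : Set ℝ} {u : ℝ → E3 → E3}
    (h : ∀ t ∈ J, ∃ U : Set ℝ, IsOpen U ∧ t ∈ U ∧ ∃ w, IsEulerFlow (J ∩ U) w ∧
      ∀ s ∈ J ∩ U, u s = w s) : IsEulerFlow J u := by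
  have h' : ∀ t ∈ J, ∃ U : Set ℝ, IsOpen U ∧ t ∈ U ∧ IsEulerFlow (J ∩ U) u := by
    intro t ht
    obtain ⟨U, hU, htU, w, hw, hs⟩ := h t ht
    obtain ⟨p, hp⟩ := hw.momentum
    refine ⟨U, hU, htU, hw.contDiffOn.congr fun z hz => by rw [hs z.1 hz.1],
      fun s hs' => ?_, fun s hs' => ?_, p, fun s hs' => ⟨(hp s hs').1, (hp s hs').2.1,
        fun x => ?_⟩⟩
    · rw [hs s hs']; exact hw.periodic s hs'
    · rw [hs s hs']; exact hw.div_free s hs'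
    · rw [hs s hs']
      exact ((hp s hs').2.2 x).congr (fun r hr => by rw [hs r hr]) (by rw [hs s hs'])
  choose! U hU htU hw using h'
  have hp : ∀ t ∈ J, ∃ p : E3 → ℝ, ContDiff ℝ 1 p ∧ SpacePeriodic p ∧
      ∀ x, HasDerivWithinAt (fun s => u s x) (-(fderiv ℝ (u t) x (u t x)) - gradient p x) J t := by
    intro t ht
    obtain ⟨p, hp⟩ := (hw t ht).momentum
    obtain ⟨h1, h2, h3⟩ := hp t ⟨ht, htU t ht⟩
    exact ⟨p t, h1, h2, fun x => (h3 x).mono_of_mem_nhdsWithin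
      (inter_mem_nhdsWithin J ((hU t ht).mem_nhds (htU t ht)))⟩
  choose! p hp using hp
  refine ⟨fun z hz => ?_, fun t ht => (hw t ht).periodic t ⟨ht, htU t ht⟩,
    fun t ht => (hw t ht).div_free t ⟨ht, htU t ht⟩, p, hp⟩
  have h1 := (hw z.1 hz.1).contDiffOn z ⟨⟨hz.1, htU z.1 hz.1⟩, mem_univ _⟩
  refine h1.mono_of_mem_nhdsWithin ?_
  have h2 : Prod.fst ⁻¹' U z.1 ∈ 𝓝 z :=
    ((hU z.1 hz.1).preimage continuous_fst).mem_nhds (htU z.1 hz.1)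
  filter_upwards [inter_mem_nhdsWithin (J ×ˢ (univ : Set E3)) h2] with y hy
  exact ⟨⟨hy.1.1, hy.2⟩, mem_univ _⟩

/-- A flow on `[t₀, t₁]` which starts at `v₀` and has a Hölder continuous vorticity. -/
structure IsContinuation (t₀ t₁ : ℝ) (v₀ : E3 → E3) (w : ℝ → E3 → E3) : Prop where
  flow : IsEulerFlow (Icc t₀ t₁) w
  init : w t₀ = v₀
  holder : ∀ t ∈ Icc t₀ t₁, IsHolder (curl (w t))

/-- A continuation can be continued beyond its final time. -/
lemma IsContinuation.extend {t₀ t₁ : ℝ} {v₀ : E3 → E3} {w : ℝ → E3 → E3} (h01 : t₀ ≤ t₁)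
    (h : IsContinuation t₀ t₁ v₀ w) : ∃ t₂ > t₁, ∃ w', IsContinuation t₀ t₂ v₀ w' := by
  have hmem : t₁ ∈ Icc t₀ t₁ := right_mem_Icc.2 h01
  obtain ⟨τ, hτ, u, -, -, hu, hu1, huh, -⟩ := exists_local_flow (h.flow.contDiff hmem)
    (h.flow.periodic t₁ hmem) (h.flow.div_free t₁ hmem) (h.holder t₁ hmem) t₁
  have hmem' : t₁ ∈ Ioo (t₁ - τ) (t₁ + τ) := ⟨by linarith, by linarith⟩
  have huw : ∀ t ∈ Icc t₀ t₁ ∩ Ioo (t₁ - τ) (t₁ + τ), w t = u t := fun t ht =>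
    (h.flow.mono inter_subset_left).eq_of_eq (ordConnected_Icc.inter ordConnected_Ioo)
      (hu.mono inter_subset_right) ⟨hmem, hmem'⟩ hu1.symm ht
  refine ⟨t₁ + τ / 2, by linarith, fun t => if t ≤ t₁ then w t else u t,
    isEulerFlow_of_local fun t ht => ?_, by simp [h01, h.init], fun t ht => ?_⟩
  · rcases lt_or_ge t t₁ with hlt | hge
    · refine ⟨Iio t₁, isOpen_Iio, hlt, w, h.flow.mono fun s hs => ⟨hs.1.1, le_of_lt hs.2⟩,
        fun s hs => if_pos (le_of_lt hs.2)⟩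
    · refine ⟨Ioo (t₁ - τ) (t₁ + τ), isOpen_Ioo, ⟨by linarith, by linarith [ht.2]⟩, u,
        hu.mono inter_subset_right, fun s hs => ?_⟩
      by_cases hs1 : s ≤ t₁
      · simp only [hs1, if_true]
        exact huw s ⟨⟨hs.1.1, hs1⟩, hs.2⟩
      · simp only [hs1, if_false]
  · by_cases ht1 : t ≤ t₁
    · simp only [ht1, if_true]
      exact h.holder t ⟨ht.1, ht1⟩
    · simp only [ht1, if_false]
      exact huh t ⟨by linarith, by linarith [ht.2]⟩

/-- Continuations of the same field agree where both are defined. -/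
lemma IsContinuation.eq {t₀ t₁ t₂ t : ℝ} {v₀ : E3 → E3} {w w' : ℝ → E3 → E3}
    (h : IsContinuation t₀ t₁ v₀ w) (h' : IsContinuation t₀ t₂ v₀ w') (h0 : t₀ ≤ t)
    (h1 : t ≤ t₁) (h2 : t ≤ t₂) : w t = w' t :=
  (h.flow.mono (Icc_subset_Icc_right h1)).eq_of_eq ordConnected_Icc
    (h'.flow.mono (Icc_subset_Icc_right h2)) (left_mem_Icc.2 h0) (h.init.trans h'.init.symm)
    (right_mem_Icc.2 h0)

/-- The supremum of the times up to which a continuation exists. -/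
noncomputable def maximalTime (t₀ : ℝ) (v₀ : E3 → E3) : EReal :=
  sSup ((fun t : ℝ => (t : EReal)) '' {t₁ | ∃ w, IsContinuation t₀ t₁ v₀ w})

lemma lt_maximalTime {t₀ t : ℝ} {v₀ : E3 → E3} :
    (t : EReal) < maximalTime t₀ v₀ ↔ ∃ t₁, t < t₁ ∧ ∃ w, IsContinuation t₀ t₁ v₀ w := by
  rw [maximalTime, lt_sSup_iff]
  constructor
  · rintro ⟨_, ⟨t₁, ht₁, rfl⟩, h⟩
    exact ⟨t₁, EReal.coe_lt_coe_iff.1 h, ht₁⟩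
  · rintro ⟨t₁, h, ht₁⟩
    exact ⟨_, ⟨t₁, ht₁, rfl⟩, EReal.coe_lt_coe_iff.2 h⟩

lemma ordConnected_timeInterval (t₀ : ℝ) (T : EReal) : (timeInterval t₀ T).OrdConnected :=
  ⟨fun _ hx _ hy _ hz => ⟨hx.1.trans hz.1, (EReal.coe_le_coe_iff.2 hz.2).trans_lt hy.2⟩⟩

/-- **Maximal continuation.** The flow with Hölder continuous vorticity which starts at a given
field exists up to the maximal time, where it has no extension with Hölder continuous vorticity. -/
theorem exists_maximal {t₀ : ℝ} {v₀ : E3 → E3} {w₀ : ℝ → E3 → E3}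
    (h₀ : IsContinuation t₀ t₀ v₀ w₀) :
    (t₀ : EReal) < maximalTime t₀ v₀ ∧ ∃ u : ℝ → E3 → E3,
      IsEulerFlow (timeInterval t₀ (maximalTime t₀ v₀)) u ∧ u t₀ = v₀ ∧
      (∀ t ∈ timeInterval t₀ (maximalTime t₀ v₀), IsHolder (curl (u t))) ∧
      ∀ t₁ : ℝ, maximalTime t₀ v₀ = t₁ → ¬ ∃ w : ℝ → E3 → E3, IsEulerFlow (Icc t₀ t₁) w ∧
        (∀ t ∈ Ico t₀ t₁, w t = u t) ∧ IsHolder (curl (w t₁)) := by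
  obtain ⟨t₂, ht₂, w₂, hw₂⟩ := h₀.extend le_rfl
  have hT : (t₀ : EReal) < maximalTime t₀ v₀ := lt_maximalTime.2 ⟨t₂, ht₂, w₂, hw₂⟩
  have hS : ∀ t ∈ timeInterval t₀ (maximalTime t₀ v₀), ∃ t₁, t < t₁ ∧
      ∃ w, IsContinuation t₀ t₁ v₀ w := fun t ht => lt_maximalTime.1 ht.2
  choose! r hr w hw using hS
  have hmem : t₀ ∈ timeInterval t₀ (maximalTime t₀ v₀) := ⟨le_rfl, hT⟩
  -- at time `t`, use a continuation `w t` which reaches beyond `t`; by uniqueness the choice is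
  -- immaterial
  refine ⟨hT, fun t => w t t, isEulerFlow_of_local fun t ht => ?_, (hw t₀ hmem).init,
    fun t ht => (hw t ht).holder t ⟨ht.1, (hr t ht).le⟩, fun t₁ ht₁ => ?_⟩
  · refine ⟨Iio (r t), isOpen_Iio, hr t ht, w t,
      (hw t ht).flow.mono fun s hs => ⟨hs.1.1, le_of_lt hs.2⟩, fun s hs => ?_⟩
    exact (hw s hs.1).eq (hw t ht) hs.1.1 (hr s hs.1).le (le_of_lt hs.2)
  · rintro ⟨z, hz, hzw, hzh⟩
    have h01 : t₀ < t₁ := by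
      rw [ht₁] at hT; exact EReal.coe_lt_coe_iff.1 hT
    have hlt : ∀ t ∈ Ico t₀ t₁, t ∈ timeInterval t₀ (maximalTime t₀ v₀) := fun t ht =>
      ⟨ht.1, by rw [ht₁]; exact EReal.coe_lt_coe_iff.2 ht.2⟩
    -- an extension to the maximal time would be a continuation, and could be continued further
    have hc : IsContinuation t₀ t₁ v₀ z := by
      refine ⟨hz, ?_, fun t ht => ?_⟩
      · rw [hzw t₀ ⟨le_rfl, h01⟩]; exact (hw t₀ hmem).init
      · rcases ht.2.lt_or_eq with h | rfl
        · rw [hzw t ⟨ht.1, h⟩]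
          have ht' := hlt t ⟨ht.1, h⟩
          exact (hw t ht').holder t ⟨ht.1, (hr t ht').le⟩
        · exact hzh
    obtain ⟨t₃, ht₃, w₃, hw₃⟩ := hc.extend h01.le
    have h3 : (t₁ : EReal) < maximalTime t₀ v₀ := lt_maximalTime.2 ⟨t₃, ht₃, w₃, hw₃⟩
    rw [ht₁] at h3
    exact lt_irrefl _ h3

/-- On a half-open time interval there is a trajectory starting at every point. -/
lemma IsEulerFlow.exists_isTrajectory {t₀ : ℝ} {T : EReal} (hT : (t₀ : EReal) < T)
    {u : ℝ → E3 → E3} (hu : IsEulerFlow (timeInterval t₀ T) u) (a : E3) :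
    ∃ x : ℝ → E3, x t₀ = a ∧ IsTrajectory (timeInterval t₀ T) u x := by
  have hex : ∀ t ∈ timeInterval t₀ T, ∃ r, t < r ∧ ∃ x : ℝ → E3, x t₀ = a ∧
      Icc t₀ r ⊆ timeInterval t₀ T ∧ IsTrajectory (Icc t₀ r) u x := by
    intro t ht
    obtain ⟨r, hr, hrT⟩ := EReal.lt_iff_exists_real_btwn.1 ht.2
    have hr' : t < r := EReal.coe_lt_coe_iff.1 hr
    have hsub : Icc t₀ r ⊆ timeInterval t₀ T := fun s hs =>
      ⟨hs.1, (EReal.coe_le_coe_iff.2 hs.2).trans_lt hrT⟩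
    obtain ⟨x, hx, hx'⟩ := (hu.mono hsub).exists_isTrajectory_Icc (ht.1.trans_lt hr') a
    exact ⟨r, hr', x, hx, hsub, hx'⟩
  choose! r hr x hx0 hsub hx using hex
  refine ⟨fun t => x t t, hx0 t₀ ⟨le_rfl, hT⟩, fun t ht => ?_⟩
  have heq : ∀ s ∈ timeInterval t₀ T ∩ Iio (r t), x s s = x t s := fun s hs => by
    have h1 : Icc t₀ s ⊆ Icc t₀ (r s) := Icc_subset_Icc_right (hr s hs.1).le
    have h2 : Icc t₀ s ⊆ Icc t₀ (r t) := Icc_subset_Icc_right (le_of_lt hs.2)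
    exact (hu.mono (h1.trans (hsub s hs.1))).eq_of_isTrajectory ordConnected_Icc
      ((hx s hs.1).mono h1) ((hx t ht).mono h2) (left_mem_Icc.2 hs.1.1)
      ((hx0 s hs.1).trans (hx0 t ht).symm) (right_mem_Icc.2 hs.1.1)
  have hnhds : timeInterval t₀ T ∩ Iio (r t) ∈ 𝓝[timeInterval t₀ T] t :=
    inter_mem_nhdsWithin _ (Iio_mem_nhds (hr t ht))
  have h3 : HasDerivWithinAt (x t) (u t (x t t)) (timeInterval t₀ T ∩ Iio (r t)) t :=
    (hx t ht t ⟨ht.1, (hr t ht).le⟩).mono fun s hs => ⟨hs.1.1, le_of_lt hs.2⟩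
  exact (h3.congr heq rfl).mono_of_mem_nhdsWithin hnhds

end PeriodicEuler

theorem mainTheorem2
    (I : Set ℝ) (hI : I.OrdConnected) (v : ℝ → PeriodicEuler.E3 → PeriodicEuler.E3)
    (hv : PeriodicEuler.IsEulerFlow I v) :
    -- restarting the Taylor expansion at a time with Hölder continuous vorticity
    (∀ t₀ ∈ I, PeriodicEuler.IsHolder (PeriodicEuler.curl (v t₀)) →
      ∃ τ : ℝ, 0 < τ ∧ ∃ (u X : ℝ → PeriodicEuler.E3 → PeriodicEuler.E3)
        (ξ : ℕ → PeriodicEuler.E3 → PeriodicEuler.E3),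
        PeriodicEuler.IsEulerFlow (Set.Ioo (t₀ - τ) (t₀ + τ)) u ∧
        (∀ t ∈ I ∩ Set.Ioo (t₀ - τ) (t₀ + τ), u t = v t) ∧
        (∀ t ∈ Set.Ioo (t₀ - τ) (t₀ + τ),
          PeriodicEuler.IsHolder (PeriodicEuler.curl (u t))) ∧
        ∀ a, X t₀ a = a ∧
          PeriodicEuler.IsTrajectory (Set.Ioo (t₀ - τ) (t₀ + τ)) u (fun t => X t a) ∧
          ∀ t ∈ Set.Ioo (t₀ - τ) (t₀ + τ),
            HasSum (fun s : ℕ => (t - t₀) ^ (s + 1) • ξ (s + 1) a) (X t a - a)) ∧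
    -- continuation until the vorticity ceases to be Hölder continuous
    (∀ t₀ ∈ I, PeriodicEuler.IsHolder (PeriodicEuler.curl (v t₀)) →
      ∃ T : EReal, (t₀ : EReal) < T ∧ ∃ u : ℝ → PeriodicEuler.E3 → PeriodicEuler.E3,
        PeriodicEuler.IsEulerFlow (PeriodicEuler.timeInterval t₀ T) u ∧
        (∀ t ∈ I ∩ PeriodicEuler.timeInterval t₀ T, u t = v t) ∧
        (∀ t ∈ PeriodicEuler.timeInterval t₀ T,
          PeriodicEuler.IsHolder (PeriodicEuler.curl (u t))) ∧
        (∀ a, ∃ x : ℝ → PeriodicEuler.E3, x t₀ = a ∧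
          PeriodicEuler.IsTrajectory (PeriodicEuler.timeInterval t₀ T) u x ∧
          AnalyticOn ℝ x (PeriodicEuler.timeInterval t₀ T)) ∧
        ∀ t₁ : ℝ, T = (t₁ : EReal) →
          ¬ ∃ w : ℝ → PeriodicEuler.E3 → PeriodicEuler.E3,
            PeriodicEuler.IsEulerFlow (Set.Icc t₀ t₁) w ∧
            (∀ t ∈ Set.Ico t₀ t₁, w t = u t) ∧
            PeriodicEuler.IsHolder (PeriodicEuler.curl (w t₁))) ∧
    -- trajectories are analytic as long as the vorticity is Hölder continuous
    ((∀ t ∈ I, PeriodicEuler.IsHolder (PeriodicEuler.curl (v t))) →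
      ∀ x : ℝ → PeriodicEuler.E3, PeriodicEuler.IsTrajectory I v x → AnalyticOn ℝ x I) ∧
    -- the equivalent condition on the velocity
    (∀ t ∈ I, ∀ γ : NNReal, 0 < γ → γ < 1 →
      (MemHolder γ (PeriodicEuler.curl (v t)) ↔ PeriodicEuler.IsC1Holder γ (v t))) ∧
    ((∀ t ∈ I, ∃ γ : NNReal, 0 < γ ∧ γ < 1 ∧ PeriodicEuler.IsC1Holder γ (v t)) →
      ∀ x : ℝ → PeriodicEuler.E3, PeriodicEuler.IsTrajectory I v x → AnalyticOn ℝ x I) := by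
  have hanalytic : (∀ t ∈ I, PeriodicEuler.IsHolder (PeriodicEuler.curl (v t))) →
      ∀ x : ℝ → PeriodicEuler.E3, PeriodicEuler.IsTrajectory I v x → AnalyticOn ℝ x I :=
    fun hω x hx => hv.analyticOn hI hω hx
  refine ⟨fun t₀ ht₀ hω => ?_, fun t₀ ht₀ hω => ?_, hanalytic, fun t ht γ hγ hγ1 =>
    PeriodicEuler.memHolder_curl_iff (hv.contDiff ht) (hv.periodic t ht) (hv.div_free t ht) hγ hγ1,
    fun h => hanalytic fun t ht => ?_⟩
  · obtain ⟨τ, hτ, u, X, ξ, hu, hu0, huh, hX⟩ := PeriodicEuler.exists_local_flow (hv.contDiff ht₀)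
      (hv.periodic t₀ ht₀) (hv.div_free t₀ ht₀) hω t₀
    refine ⟨τ, hτ, u, X, ξ, hu, fun t ht => ?_, huh, hX⟩
    exact (hu.mono Set.inter_subset_right).eq_of_eq (hI.inter Set.ordConnected_Ioo)
      (hv.mono Set.inter_subset_left) ⟨ht₀, by linarith, by linarith⟩ hu0 ht
  · have hc : PeriodicEuler.IsContinuation t₀ t₀ (v t₀) v := by
      refine ⟨hv.mono ?_, rfl, fun t ht => ?_⟩
      · rw [Set.Icc_self, Set.singleton_subset_iff]; exact ht₀
      · rw [Set.Icc_self, Set.mem_singleton_iff] at ht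
        rw [ht]; exact hω
    obtain ⟨hT, u, hu, hu0, huh, hmax⟩ := PeriodicEuler.exists_maximal hc
    have hJ := PeriodicEuler.ordConnected_timeInterval t₀
      (PeriodicEuler.maximalTime t₀ (v t₀))
    refine ⟨_, hT, u, hu, fun t ht => ?_, huh, fun a => ?_, hmax⟩
    · exact (hu.mono Set.inter_subset_right).eq_of_eq (hI.inter hJ)
        (hv.mono Set.inter_subset_left) ⟨ht₀, le_rfl, hT⟩ hu0 ht
    · obtain ⟨x, hx0, hx⟩ := hu.exists_isTrajectory hT a
      exact ⟨x, hx0, hx, hu.analyticOn hJ huh hx⟩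
  · obtain ⟨γ, hγ, hγ1, h1⟩ := h t ht
    exact ⟨γ, hγ, (PeriodicEuler.memHolder_curl_iff (hv.contDiff ht) (hv.periodic t ht)
      (hv.div_free t ht) hγ hγ1).2 h1⟩
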